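/- Let $G$ be a flower graph, i.e. a finite graph with exactly one vertex $v$, all of whose edges are loops, and suppose that its edge set $E$ satisfies $|E|\ge 2$. Identify each edge with $[0,1]$. Let $\mathcal A_+$ be the set of pairs $(g,\rho)$, where $g=(g_e)_{e\in E}\in(0,\infty)^{E}$ is a metric on $G$ (the edge $e$ has length element $dx_g=\sqrt{g_e}\,dx$, hence length $\ell_e=\sqrt{g_e}$) and $\rho=(\rho_e)_{e\in E}$ is a density, each $\rho_e:[0,1]\to(0,\infty)$ being smooth on the closed interval (no continuity of $\rho$ across the vertex is required). Let $0=\lambda_0(g,\rho)<\lambda_1(g,\rho)\le\lambda_2(g,\rho)\le\cdots$ be the eigenvalues, repeated according to multiplicity, of $$-\frac1{g_e}f_e''=\lambda\,\rho_e f_e\ \text{ on every edge } e,\qquad f\text{ continuous on }G,\qquad \text{the outward arc-length derivatives of } f \text{ at } v \text{ sum to } 0$$ (each loop contributes both of its ends to the sum). Write $\lambda_1(g)=\lambda_1(g,1)$, and put $$\overline{\lambda_1}(g,\rho)=\lambda_1(g,\rho)\Big(\sum_{e}\sqrt{g_e}\Big)\Big(\sum_e\sqrt{g_e}\int_0^1\rho_e\,dx\Big),\qquad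 \overline{\lambda_1}^{(\alpha)}(g,\rho)=\lambda_1(g,\rho)\Big(\sum_{e} g_e^{1-\alpha}\Big)\Big(\sum_e g_e^{\alpha}\int_0^1\rho_e\,dx\Big)\quad(\alpha\in\mathbb R).$$ A pair $(g_*,\rho_*)\in\mathcal A_+$ is called extremal for a functional $\Phi:\mathcal A_+\to\mathbb R$ if for every smooth one-parameter family $(g(t),\rho(t))\in\mathcal A_+$, $|t|<\delta$, with $(g(0),\rho(0))=(g_*,\rho_*)$ one has, as $t\to0$, either $\Phi(g(t),\rho(t))\le\Phi(g_*,\rho_*)+o(t)$ or $\Phi(g(t),\rho(t))\ge\Phi(g_*,\rho_*)+o(t)$. Then: 1. The functional $\overline{\lambda_1}$ has no maximiser in $\mathcal A_+$. 2. If $\alpha\notin\{1/2,1\}$, then $\overline{\lambda_1}^{(\alpha)}$ has no extremal pair; consequently, it has neither a maximiser nor a minimiser in $\mathcal A_+$. 3. If $g$ is a regular metric (all $g_e$ are equal), then for no $n$ and no $R>0$ is there an isometric minimal immersion $F$ of $(G,g)$ into the sphere of radius $R$ centred at the origin of $\mathbb R^n$ whose coordinate functions all lie in the $\lambda_1(g)$-eigenspace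 (with density $1$). Here an isometric minimal immersion is a continuous map $F$, smooth on the closed edges, that has unit speed with respect to arc length, maps every edge to a geodesic of the sphere, and whose outward unit tangent vectors at $v$ sum to zero. -/

import Mathlib

open Set Filter Topology Asymptotics MeasureTheory
open scoped ContDiff

namespace QuantumGraph

/-- A discrete multigraph with vertex set `V` and edge set `E`; loops and parallel edges are
allowed. Every edge is identified with the unit interval `[0, 1]`, the point `0` being glued to the
vertex `src e` and the point `1` to the vertex `tgt e`. A function on the graph is a family
`f : E → ℝ → ℝ`, of which only the values `f e x` with `x ∈ [0, 1]` matter. -/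
structure Multigraph (V E : Type*) where
  src : E → V
  tgt : E → V

/-- A flower graph has exactly one vertex, so that all its edges are loops. -/
def Multigraph.IsFlower {V E : Type*} (_G : Multigraph V E) : Prop :=
  Nat.card V = 1

/-- The pairs `(g, ρ)` of a metric and a density: `g e > 0` is the squared length of the edge `e`
(the length element is `√(g e) dx`), and `ρ e` is smooth and positive on the closed edge. No
continuity of `ρ` across the vertices is required. -/
structure IsMetricDensity {E : Type*} (g : E → ℝ) (ρ : E → ℝ → ℝ) : Prop where
  metric_pos : ∀ e, 0 < g e
  density_smooth : ∀ e, ContDiffOn ℝ ∞ (ρ e) (Icc 0 1)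
  density_pos : ∀ e, ∀ x ∈ Icc (0 : ℝ) 1, 0 < ρ e x

/-- The outward unit-speed derivative of `f` along `e` at its initial point. -/
noncomputable def derivSrc {E F : Type*} [NormedAddCommGroup F] [NormedSpace ℝ F]
    (g : E → ℝ) (f : E → ℝ → F) (e : E) : F :=
  (Real.sqrt (g e))⁻¹ • derivWithin (f e) (Icc 0 1) 0

/-- The outward unit-speed derivative of `f` along `e` at its end point. -/
noncomputable def derivTgt {E F : Type*} [NormedAddCommGroup F] [NormedSpace ℝ F]
    (g : E → ℝ) (f : E → ℝ → F) (e : E) : F :=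
  -((Real.sqrt (g e))⁻¹ • derivWithin (f e) (Icc 0 1) 1)

open Classical in
/-- The sum, over all edge ends attached to `v`, of the derivatives of `f` in the direction
pointing out of `v` into the edge, with respect to arc length. A loop contributes both its ends. -/
noncomputable def outwardDerivSum {V E F : Type*} [Fintype E]
    [NormedAddCommGroup F] [NormedSpace ℝ F] (G : Multigraph V E)
    (g : E → ℝ) (f : E → ℝ → F) (v : V) : F :=
  (∑ e ∈ Finset.univ.filter (fun e => G.src e = v), derivSrc g f e) +
    ∑ e ∈ Finset.univ.filter (fun e => G.tgt e = v), derivTgt g f e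

/-- `f` is single-valued at the vertices. -/
def AgreesAtVertices {V E F : Type*} (G : Multigraph V E) (f : E → ℝ → F) : Prop :=
  ∃ φ : V → F, ∀ e, f e 0 = φ (G.src e) ∧ f e 1 = φ (G.tgt e)

/-- `f` belongs to the eigenspace `E(μ)` of the weighted problem: `Δ_g f = μ ρ f` on the edges,
where `Δ_g f = -(1 / g e) f''`; `f` is continuous on the graph; and at each vertex the outward
derivatives of `f` sum up to zero. (The zero function belongs to every `E(μ)`.) -/
structure MemEigenspace {V E : Type*} [Fintype E] (G : Multigraph V E)
    (g : E → ℝ) (ρ : E → ℝ → ℝ) (μ : ℝ) (f : E → ℝ → ℝ) : Prop where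
  contDiff : ∀ e, ContDiffOn ℝ 2 (f e) (Icc 0 1)
  equation : ∀ e, ∀ x ∈ Icc (0 : ℝ) 1,
    -(1 / g e) * iteratedDerivWithin 2 (f e) (Icc 0 1) x = μ * ρ e x * f e x
  continuous : AgreesAtVertices G f
  kirchhoff : ∀ v, outwardDerivSum G g f v = 0

/-- The family `f` viewed as a function on the disjoint union of the closed edges. -/
def onEdges {E : Type*} (f : E → ℝ → ℝ) (p : E × Icc (0 : ℝ) 1) : ℝ :=
  f p.1 p.2

/-- The eigenvalues that are at most `t`, counted with multiplicity, number at least `n`: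
there are `n` linearly independent eigenfunctions with eigenvalues at most `t`. -/
def HasEigenvaluesUpTo {V E : Type*} [Fintype E] (G : Multigraph V E)
    (g : E → ℝ) (ρ : E → ℝ → ℝ) (n : ℕ) (t : ℝ) : Prop :=
  ∃ f : Fin n → E → ℝ → ℝ, LinearIndependent ℝ (fun i => onEdges (f i)) ∧
    ∀ i, ∃ μ ≤ t, MemEigenspace G g ρ μ (f i)

/-- The `k`-th eigenvalue `λ_k(g, ρ)`, for `k = 0, 1, 2, …`, in the increasing enumeration
`0 = λ_0 ≤ λ_1 ≤ λ_2 ≤ …` with multiplicity. -/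
noncomputable def eigenvalue {V E : Type*} [Fintype E] (G : Multigraph V E) (k : ℕ)
    (g : E → ℝ) (ρ : E → ℝ → ℝ) : ℝ :=
  sInf {t : ℝ | HasEigenvaluesUpTo G g ρ (k + 1) t}

/-- The total length `L(g)`. -/
noncomputable def totalLength {E : Type*} [Fintype E] (g : E → ℝ) : ℝ :=
  ∑ e, Real.sqrt (g e)

/-- The total mass of the density with respect to arc length. -/
noncomputable def totalMass {E : Type*} [Fintype E] (g : E → ℝ) (ρ : E → ℝ → ℝ) : ℝ :=
  ∑ e, Real.sqrt (g e) * ∫ x in (0 : ℝ)..1, ρ e x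

/-- The naturally normalised eigenvalue `λ_k(g, ρ) L(g) ∫ ρ`. -/
noncomputable def naturalEigenvalue {V E : Type*} [Fintype E] (G : Multigraph V E) (k : ℕ)
    (g : E → ℝ) (ρ : E → ℝ → ℝ) : ℝ :=
  eigenvalue G k g ρ * totalLength g * totalMass g ρ

/-- The `α`-normalised eigenvalue `λ_k(g, ρ) (∑ g_e^(1-α)) (∑ g_e^α ∫₀¹ ρ_e dx)`. -/
noncomputable def alphaEigenvalue {V E : Type*} [Fintype E] (G : Multigraph V E) (α : ℝ) (k : ℕ)
    (g : E → ℝ) (ρ : E → ℝ → ℝ) : ℝ :=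
  eigenvalue G k g ρ * (∑ e, g e ^ (1 - α)) * ∑ e, g e ^ α * ∫ x in (0 : ℝ)..1, ρ e x

/-- `(g, ρ)` maximises `Φ` among all pairs of a metric and a density. -/
def IsMaximiser {E : Type*} (Φ : (E → ℝ) → (E → ℝ → ℝ) → ℝ) (g : E → ℝ) (ρ : E → ℝ → ℝ) : Prop :=
  IsMetricDensity g ρ ∧ ∀ g' ρ', IsMetricDensity g' ρ' → Φ g' ρ' ≤ Φ g ρ

/-- `(g, ρ)` minimises `Φ` among all pairs of a metric and a density. -/
def IsMinimiser {E : Type*} (Φ : (E → ℝ) → (E → ℝ → ℝ) → ℝ) (g : E → ℝ) (ρ : E → ℝ → ℝ) : Prop :=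
  IsMetricDensity g ρ ∧ ∀ g' ρ', IsMetricDensity g' ρ' → Φ g ρ ≤ Φ g' ρ'

/-- A smooth one-parameter family `(g(t), ρ(t))`, `|t| < δ`, of pairs that passes through `(g, ρ)`
at `t = 0`. -/
structure IsSmoothFamilyThrough {E : Type*} (g : E → ℝ) (ρ : E → ℝ → ℝ) (δ : ℝ)
    (gt : ℝ → E → ℝ) (ρt : ℝ → E → ℝ → ℝ) : Prop where
  pos : 0 < δ
  mem : ∀ t ∈ Ioo (-δ) δ, IsMetricDensity (gt t) (ρt t)
  metric_smooth : ∀ e, ContDiffOn ℝ ∞ (fun t => gt t e) (Ioo (-δ) δ)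
  density_smooth : ∀ e,
    ContDiffOn ℝ ∞ (fun p : ℝ × ℝ => ρt p.1 e p.2) (Ioo (-δ) δ ×ˢ Icc (0 : ℝ) 1)
  metric_zero : gt 0 = g
  density_zero : ∀ e, EqOn (ρt 0 e) (ρ e) (Icc 0 1)

/-- `(g, ρ)` is `Φ`-extremal: along every smooth family through `(g, ρ)` one has
`Φ(g(t), ρ(t)) ≤ Φ(g, ρ) + o(t)` or `Φ(g(t), ρ(t)) ≥ Φ(g, ρ) + o(t)` as `t → 0`. -/
def IsExtremalPair {E : Type*} (Φ : (E → ℝ) → (E → ℝ → ℝ) → ℝ)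
    (g : E → ℝ) (ρ : E → ℝ → ℝ) : Prop :=
  IsMetricDensity g ρ ∧ ∀ δ gt ρt, IsSmoothFamilyThrough g ρ δ gt ρt →
    (∃ r : ℝ → ℝ, r =o[𝓝 0] (fun t => t) ∧ ∀ᶠ t in 𝓝 0, Φ (gt t) (ρt t) ≤ Φ g ρ + r t) ∨
    (∃ r : ℝ → ℝ, r =o[𝓝 0] (fun t => t) ∧ ∀ᶠ t in 𝓝 0, Φ g ρ + r t ≤ Φ (gt t) (ρt t))

/-- A regular metric: all edges have the same length. -/
def IsRegularMetric {E : Type*} (g : E → ℝ) : Prop :=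
  ∃ c, 0 < c ∧ ∀ e, g e = c

/-- `F` is an isometric minimal immersion of the metric graph `(G, g)` into the sphere of radius
`R` centred at the origin of `ℝⁿ`: it is continuous on the graph and smooth on the edges, it has
unit speed with respect to arc length, it maps every edge to a geodesic of the sphere (the
acceleration is everywhere normal to the sphere), and at every vertex the outward unit tangent
vectors sum up to zero. -/
structure IsIsometricMinimalImmersion {V E : Type*} [Fintype E] (G : Multigraph V E)
    (g : E → ℝ) (n : ℕ) (R : ℝ) (F : E → ℝ → EuclideanSpace ℝ (Fin n)) : Prop where
  agrees : AgreesAtVertices G F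
  smooth : ∀ e, ContDiffOn ℝ ∞ (F e) (Icc 0 1)
  mem_sphere : ∀ e, ∀ x ∈ Icc (0 : ℝ) 1, F e x ∈ Metric.sphere 0 R
  isometric : ∀ e, ∀ x ∈ Icc (0 : ℝ) 1,
    ‖derivWithin (F e) (Icc 0 1) x‖ = Real.sqrt (g e)
  geodesic : ∀ e, ∀ x ∈ Icc (0 : ℝ) 1,
    ∃ c : ℝ, iteratedDerivWithin 2 (F e) (Icc 0 1) x = c • F e x
  balanced : ∀ v, outwardDerivSum G g F v = 0

end QuantumGraph

/-! The first positive eigenvalue λ is the least value of energy over weighted square norm among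
mean-zero test functions. Since `eigenvalue` is an infimum over independent eigenfunctions, this is
established first: for a source of mean zero, the solution vanishing at the vertex satisfies the
Kirchhoff condition automatically. Solving and then centring is a compact, symmetric, positive
operator, and `exists_top_eigenvector` applied to it gives `exists_isFirst`. `IsFirst.eigenvalue_eq`
identifies the value found with `eigenvalue`.

Natural normalisation. If the density concentrates at the vertex, an eigenfunction differs little
from its vertex value c where the mass sits, because (f - c)² ≤ x ∫ (f')². Being of mean zero, f
then has large energy. Hence the functional is unbounded (`le_naturalEigenvalue_bump`).

Extremality. Only linear variations ρ + tσ with fixed metric are needed. Transplanting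
eigenfunctions between ρ and ρ + tσ bounds the change of λ to first order, without differentiating
it and whatever its multiplicity. If ∫ σ f² ≤ η ∫ ρ_t f² for all first eigenfunctions with small t ≥
0, and the normalising factor grows at a relative rate above η, then the functional increases
strictly through t = 0, which excludes both alternatives (`not_isExtremalPair_of_perturb`). There
are two choices of σ.

If g is not regular, then g^(α - 1/2) is not constant because α ≠ 1/2. Mass close to the vertex is
moved from one loop to another: f² is about c² on both, so the square norm hardly changes, while the
normalising factor grows (`not_isExtremalPair_of_lt`).

If g is regular, constant mass is removed from a loop e and slightly more is put at the vertex end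
of a loop e'. This works if ∫ f² over e exceeds c² by a definite factor, which concavity provides as
long as f does not change sign against c on e (`integral_sq_ge`). A sign change would put the first
Dirichlet eigenvalue of e strictly below λ (`isSupercritical_of_neg`), and at most one loop can have
that property (`IsFirst.not_isSupercritical`). So e is taken to be the loop with the larger
Dirichlet eigenvalue, and the variation preserves this order.

Immersions. On a regular flower, opposite sine arches on two loops give λ g ≤ π². Comparison with a
cosine centred at the midpoint then forces first eigenfunctions to vanish at the vertex, so the
vertex would be mapped to the origin, which is not on the sphere. -/

namespace QuantumGraph

/-! ### Top eigenvector of a compact symmetric operator -/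

/-- A symmetric positive operator which maps bounded sequences to sequences with convergent
subsequences has an eigenvector at the top of its numerical range. No completeness is needed. -/
theorem exists_top_eigenvector {X : Type*} [AddCommGroup X] [Module ℝ X]
    (B : X →ₗ[ℝ] X →ₗ[ℝ] ℝ) (T : X →ₗ[ℝ] X)
    (hsymm : ∀ x y, B x y = B y x) (hpos : ∀ x, 0 ≤ B x x) (hdef : ∀ x, B x x = 0 → x = 0)
    (hT : ∀ x y, B (T x) y = B x (T y)) (hTpos : ∀ x, 0 ≤ B (T x) x)
    (hne : ∃ x, 0 < B (T x) x) (hbdd : ∃ C, ∀ x, B x x ≤ 1 → B (T x) x ≤ C)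
    (hcpt : ∀ x : ℕ → X, (∀ n, B (x n) (x n) ≤ 1) → ∃ w, ∃ φ : ℕ → ℕ,
      Tendsto φ atTop atTop ∧
      Tendsto (fun n => B (T (x (φ n)) - w) (T (x (φ n)) - w)) atTop (𝓝 0)) :
    ∃ μ : ℝ, 0 < μ ∧ ∃ w, w ≠ 0 ∧ T w = μ • w ∧ ∀ x, B (T x) x ≤ μ * B x x := by
  set S : Set ℝ := {r | ∃ x, B x x ≤ 1 ∧ r = B (T x) x} with hS
  obtain ⟨C, hC⟩ := hbdd
  have hSb : BddAbove S := ⟨C, by rintro _ ⟨x, hx, rfl⟩; exact hC x hx⟩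
  have hSn : S.Nonempty := ⟨0, 0, by simp, by simp⟩
  set μ := sSup S with hμ
  have hscale : ∀ x, B (T x) x ≤ μ * B x x := by
    intro x
    rcases (hpos x).eq_or_lt with h | h
    · have : x = 0 := hdef x h.symm
      simp [this]
    · have hs : 0 < Real.sqrt (B x x) := Real.sqrt_pos.2 h
      have hsq : Real.sqrt (B x x) * Real.sqrt (B x x) = B x x := Real.mul_self_sqrt h.le
      have h1 : (Real.sqrt (B x x))⁻¹ * ((Real.sqrt (B x x))⁻¹ * B x x) = 1 := by
        field_simp; nlinarith
      have hmem : (Real.sqrt (B x x))⁻¹ * ((Real.sqrt (B x x))⁻¹ * B (T x) x) ∈ S := by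
        refine ⟨(Real.sqrt (B x x))⁻¹ • x, ?_, ?_⟩
        · simpa using h1.le
        · simp
      have h2 := le_csSup hSb hmem
      have h3 := mul_le_mul_of_nonneg_right h2 h.le
      have h4 : (Real.sqrt (B x x))⁻¹ * ((Real.sqrt (B x x))⁻¹ * B (T x) x) * B x x
          = B (T x) x := by
        calc _ = (Real.sqrt (B x x))⁻¹ * ((Real.sqrt (B x x))⁻¹ * B x x) * B (T x) x := by ring
          _ = _ := by rw [h1, one_mul]
      rw [h4] at h3
      exact h3
  have hμpos : 0 < μ := by
    obtain ⟨x, hx⟩ := hne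
    have := hscale x
    by_contra hcon
    push Not at hcon
    nlinarith [hpos x]
  -- Cauchy-Schwarz for the forms `μ B - B (T ·) ·` and `B (T ·) ·`
  let D : X →ₗ[ℝ] X →ₗ[ℝ] ℝ := μ • B - B.comp T
  have hD : ∀ x y, D x y = B (μ • x - T x) y := by intro x y; simp [D]
  have hD' : ∀ x y, D x y = μ * B x y - B (T x) y := by intro x y; simp [D]
  have hDpos : ∀ x, 0 ≤ D x x := fun x => by rw [hD']; linarith [hscale x]
  have hDsymm : D.IsSymm := ⟨fun x y => by
    simp only [RingHom.id_apply, hD', hT, hsymm x y, hsymm x (T y)]⟩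
  have hBT : ∀ x y, (B.comp T) x y = B (T x) y := fun x y => rfl
  have hTsymm : (B.comp T : X →ₗ[ℝ] X →ₗ[ℝ] ℝ).IsSymm := ⟨fun x y => by
    simp only [RingHom.id_apply, hBT, hT, hsymm x (T y)]⟩
  -- With y = μx - Tx, Cauchy-Schwarz for `D` gives B(y,y)² ≤ D(x,x) D(y,y), and D(y,y) ≤ μ B(y,y)
  -- because T is positive. Thus almost maximising vectors are almost eigenvectors.
  have key : ∀ x, B (μ • x - T x) (μ • x - T x) ≤ μ * (μ * B x x - B (T x) x) := by
    intro x
    set y := μ • x - T x with hy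
    have h1 := LinearMap.BilinForm.apply_sq_le_of_symm D hDpos hDsymm x y
    rw [hD x y, ← hy, hD' x x, hD' y y] at h1
    rcases (hpos y).eq_or_lt with h | h
    · rw [← h]; exact mul_nonneg hμpos.le (by linarith [hscale x])
    · have h2 := hTpos y
      have h3 : 0 ≤ μ * B x x - B (T x) x := by linarith [hscale x]
      have h4 : B y y * B y y ≤ μ * (μ * B x x - B (T x) x) * B y y := by
        nlinarith [mul_nonneg h3 h2]
      exact le_of_mul_le_mul_right h4 h
  -- T has norm at most μ; this replaces continuity of T when passing to the limit.
  have hTT : ∀ x, B (T x) (T x) ≤ μ ^ 2 * B x x := by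
    intro x
    have h1 := LinearMap.BilinForm.apply_sq_le_of_symm (B.comp T) hTpos hTsymm x (T x)
    simp only [hBT] at h1
    have h2 := hscale x
    have h3 := hscale (T x)
    rcases (hpos (T x)).eq_or_lt with h | h
    · rw [← h]; exact mul_nonneg (by positivity) (hpos x)
    · have h4 : B (T x) (T x) * B (T x) (T x) ≤ μ ^ 2 * B x x * B (T x) (T x) := by
        calc _ = B (T x) (T x) ^ 2 := by ring
          _ ≤ _ := h1
          _ ≤ (μ * B x x) * (μ * B (T x) (T x)) :=
            mul_le_mul h2 h3 (hTpos _) (mul_nonneg hμpos.le (hpos x))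
          _ = _ := by ring
      exact le_of_mul_le_mul_right h4 h
  have hseq : ∀ n : ℕ, ∃ x, B x x ≤ 1 ∧ μ - 1 / ((n : ℝ) + 1) < B (T x) x := by
    intro n
    have hlt : μ - 1 / ((n : ℝ) + 1) < sSup S := by
      have : 0 < 1 / ((n : ℝ) + 1) := by positivity
      linarith
    obtain ⟨_, ⟨x, hx, rfl⟩, h⟩ := exists_lt_of_lt_csSup hSn hlt
    exact ⟨x, hx, h⟩
  choose x hx1 hx2 using hseq
  obtain ⟨w, φ, hφ, hlim⟩ := hcpt x hx1
  have hsum : ∀ a b, B (a + b) (a + b) ≤ 2 * B a a + 2 * B b b := by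
    intro a b
    have h := hpos (a - b)
    simp only [map_sub, map_add, LinearMap.sub_apply, LinearMap.add_apply] at h ⊢
    linarith
  have heps : Tendsto (fun n => 1 / ((φ n : ℝ) + 1)) atTop (𝓝 0) :=
    tendsto_one_div_add_atTop_nhds_zero_nat.comp hφ
  refine ⟨μ, hμpos, w, ?_, ?_, hscale⟩
  -- Expanding ‖Tx - (μ/2)x‖² ≥ 0 gives μ⟨Tx, x⟩ ≤ ‖Tx‖² + μ²/4. If Tx tended to 0 along the
  -- maximising sequence, the limit would read μ² ≤ μ²/4.
  · rintro rfl
    have h1 : ∀ n, μ * (μ - 1 / ((φ n : ℝ) + 1)) ≤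
        B (T (x (φ n)) - 0) (T (x (φ n)) - 0) + μ ^ 2 / 4 := by
      intro n
      have h2 := hpos (T (x (φ n)) - (μ / 2) • x (φ n))
      simp only [map_sub, LinearMap.sub_apply, map_smul, LinearMap.smul_apply, smul_eq_mul,
        hsymm (x (φ n)) (T (x (φ n)))] at h2
      have h3 := mul_le_mul_of_nonneg_left (hx2 (φ n)).le hμpos.le
      have h4 := mul_le_mul_of_nonneg_left (hx1 (φ n)) (sq_nonneg μ)
      simp only [sub_zero]
      nlinarith
    have h7 := le_of_tendsto_of_tendsto' ((tendsto_const_nhds.sub heps).const_mul μ)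
      (hlim.add_const (μ ^ 2 / 4)) h1
    nlinarith
  · have h1 : ∀ n, B (T w - μ • w) (T w - μ • w) ≤
        4 * (μ ^ 2 * B (T (x (φ n)) - w) (T (x (φ n)) - w)) +
        4 * (μ ^ 2 * (μ * (1 / ((φ n : ℝ) + 1)))) +
        2 * (μ ^ 2 * B (T (x (φ n)) - w) (T (x (φ n)) - w)) := by
      intro n
      set v := T (x (φ n)) - w with hv
      set u := μ • x (φ n) - T (x (φ n)) with hu
      -- Only Tx converges, not x. The identity expresses the defect of w through v → 0 and through
      -- Tu, where u → 0 by `key`.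
      have e1 : T w - μ • w = (-(T v) + -(T u)) + μ • v := by
        rw [hv, hu]; simp only [map_sub, map_smul]; module
      rw [e1]
      have h2 := hsum (-(T v) + -(T u)) (μ • v)
      have h3 := hsum (-(T v)) (-(T u))
      have h4 := hTT v
      have h5 := hTT u
      have h6 := key (x (φ n))
      rw [← hu] at h6
      simp only [map_neg, LinearMap.neg_apply, neg_neg, map_smul, LinearMap.smul_apply,
        smul_eq_mul] at h2 h3
      have h7 : μ * B (x (φ n)) (x (φ n)) - B (T (x (φ n))) (x (φ n)) ≤ 1 / ((φ n : ℝ) + 1) := by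
        have := hx1 (φ n)
        have := hx2 (φ n)
        nlinarith
      have h8 : B u u ≤ μ * (1 / ((φ n : ℝ) + 1)) := h6.trans (by gcongr)
      have h9 : μ ^ 2 * B u u ≤ μ ^ 2 * (μ * (1 / ((φ n : ℝ) + 1))) := by gcongr
      simp only [map_add, LinearMap.add_apply, map_smul, LinearMap.smul_apply, map_neg,
        LinearMap.neg_apply, smul_eq_mul] at h2 h3 ⊢
      nlinarith
    have h2 := le_of_tendsto_of_tendsto' tendsto_const_nhds
      ((((hlim.const_mul (μ ^ 2)).const_mul 4).add
        (((heps.const_mul μ).const_mul (μ ^ 2)).const_mul 4)).add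
        ((hlim.const_mul (μ ^ 2)).const_mul 2)) h1
    have h3 : B (T w - μ • w) (T w - μ • w) = 0 := le_antisymm (by simpa using h2) (hpos _)
    exact sub_eq_zero.1 (hdef _ h3)

end QuantumGraph

namespace QuantumGraph

/-! ### Integration by parts and test functions -/

theorem HasDerivWithinAt.to_right {a b x : ℝ} {f : ℝ → ℝ} {f' : ℝ} (hx : x ∈ Ioo a b)
    (h : HasDerivWithinAt f f' (Icc a b) x) : HasDerivWithinAt f f' (Ioi x) x :=
  (h.hasDerivAt (Icc_mem_nhds hx.1 hx.2)).hasDerivWithinAt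

/-- Only a right derivative is asked of u, so that functions with corners, such as an eigenfunction
cut off at its zeros, are admissible test functions. -/
theorem integral_mul_right_deriv {a b : ℝ} (hab : a ≤ b) {w w' u d : ℝ → ℝ}
    (hw : ∀ x ∈ Icc a b, HasDerivWithinAt w (w' x) (Icc a b) x) (hw' : ContinuousOn w' (Icc a b))
    (hu : ContinuousOn u (Icc a b)) (hd : ∀ x ∈ Ioo a b, HasDerivWithinAt u (d x) (Ioi x) x)
    (hdi : IntervalIntegrable d volume a b) :
    ∫ x in a..b, w x * d x = w b * u b - w a * u a - ∫ x in a..b, w' x * u x := by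
  have hwc : ContinuousOn w (Icc a b) := fun x hx => (hw x hx).continuousWithinAt
  have i1 : IntervalIntegrable (fun x => w' x * u x) volume a b := by
    apply ContinuousOn.intervalIntegrable
    rw [uIcc_of_le hab]; exact hw'.mul hu
  have i2 : IntervalIntegrable (fun x => w x * d x) volume a b :=
    hdi.continuousOn_mul (by rw [uIcc_of_le hab]; exact hwc)
  have h := intervalIntegral.integral_eq_sub_of_hasDeriv_right_of_le hab (hwc.mul hu)
    (fun x hx => ((HasDerivWithinAt.to_right hx (hw x (Ioo_subset_Icc_self hx))).mul (hd x hx)))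
    (i1.add i2)
  rw [intervalIntegral.integral_add i1 i2] at h
  simp only [Pi.mul_apply] at h
  linarith

variable {E : Type*}

/-- A continuous function on a flower graph with value `c` at the vertex, whose right derivative
`d` is square integrable on the edges. -/
structure IsTest (u d : E → ℝ → ℝ) (c : ℝ) : Prop where
  cont : ∀ e, ContinuousOn (u e) (Icc 0 1)
  deriv : ∀ e, ∀ x ∈ Ioo (0 : ℝ) 1, HasDerivWithinAt (u e) (d e x) (Ioi x) x
  int : ∀ e, IntervalIntegrable (d e) volume 0 1
  sq : ∀ e, IntervalIntegrable (fun x => d e x * d e x) volume 0 1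
  left : ∀ e, u e 0 = c
  right : ∀ e, u e 1 = c

/-- Eigenfunctions of a flower graph, with their derivatives along the edges. -/
structure IsEig [Fintype E] (g : E → ℝ) (ρ : E → ℝ → ℝ) (μ : ℝ) (f d : E → ℝ → ℝ) (c : ℝ) :
    Prop where
  deriv : ∀ e, ∀ x ∈ Icc (0 : ℝ) 1, HasDerivWithinAt (f e) (d e x) (Icc 0 1) x
  deriv₂ : ∀ e, ∀ x ∈ Icc (0 : ℝ) 1,
    HasDerivWithinAt (d e) (-(μ * g e * (ρ e x * f e x))) (Icc 0 1) x
  left : ∀ e, f e 0 = c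
  right : ∀ e, f e 1 = c
  kirchhoff : ∑ e, (Real.sqrt (g e))⁻¹ * (d e 1 - d e 0) = 0

/-- Smooth, or at least continuous, positive data. -/
structure IsData (g : E → ℝ) (ρ : E → ℝ → ℝ) : Prop where
  pos : ∀ e, 0 < g e
  cont : ∀ e, ContinuousOn (ρ e) (Icc 0 1)
  dens : ∀ e, ∀ x ∈ Icc (0 : ℝ) 1, 0 < ρ e x

theorem IsMetricDensity.isData {g : E → ℝ} {ρ : E → ℝ → ℝ} (h : IsMetricDensity g ρ) :
    IsData g ρ :=
  ⟨h.metric_pos, fun e => (h.density_smooth e).continuousOn, h.density_pos⟩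

section forms
variable [Fintype E]

/-- The integral of `u` against the density. -/
noncomputable def wmean (g : E → ℝ) (ρ u : E → ℝ → ℝ) : ℝ :=
  ∑ e, Real.sqrt (g e) * ∫ x in (0 : ℝ)..1, ρ e x * u e x

/-- The weighted inner product. -/
noncomputable def pair (g : E → ℝ) (ρ u v : E → ℝ → ℝ) : ℝ :=
  ∑ e, Real.sqrt (g e) * ∫ x in (0 : ℝ)..1, ρ e x * u e x * v e x

/-- The energy form, evaluated at two families of derivatives. -/
noncomputable def energy (g : E → ℝ) (d d' : E → ℝ → ℝ) : ℝ :=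
  ∑ e, (Real.sqrt (g e))⁻¹ * ∫ x in (0 : ℝ)..1, d e x * d' e x

end forms

theorem intervalIntegrable_of_Icc {f : ℝ → ℝ} (h : ContinuousOn f (Icc 0 1)) :
    IntervalIntegrable f volume 0 1 := by
  apply ContinuousOn.intervalIntegrable
  rwa [uIcc_of_le zero_le_one]

theorem integral_congr_Icc {f h : ℝ → ℝ} (H : ∀ x ∈ Icc (0 : ℝ) 1, f x = h x) :
    ∫ x in (0 : ℝ)..1, f x = ∫ x in (0 : ℝ)..1, h x :=
  intervalIntegral.integral_congr (fun x hx => H x (by rwa [uIcc_of_le zero_le_one] at hx))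

theorem integral_mono_Icc {f h : ℝ → ℝ} (hf : IntervalIntegrable f volume 0 1)
    (hh : IntervalIntegrable h volume 0 1) (H : ∀ x ∈ Icc (0 : ℝ) 1, f x ≤ h x) :
    ∫ x in (0 : ℝ)..1, f x ≤ ∫ x in (0 : ℝ)..1, h x :=
  intervalIntegral.integral_mono_on zero_le_one hf hh H

theorem integral_nonneg_Icc {f : ℝ → ℝ} (H : ∀ x ∈ Icc (0 : ℝ) 1, 0 ≤ f x) :
    0 ≤ ∫ x in (0 : ℝ)..1, f x :=
  intervalIntegral.integral_nonneg zero_le_one H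

/-- Green's formula. -/
theorem energy_eq_of_hasDeriv [Fintype E] {g : E → ℝ} {d s u δ : E → ℝ → ℝ} {b : ℝ}
    (hg : ∀ e, 0 < g e) (hs : ∀ e, ContinuousOn (s e) (Icc 0 1))
    (h : ∀ e, ∀ x ∈ Icc (0 : ℝ) 1, HasDerivWithinAt (d e) (-(g e * s e x)) (Icc 0 1) x)
    (hu : IsTest u δ b) :
    energy g d δ = b * ∑ e, (Real.sqrt (g e))⁻¹ * (d e 1 - d e 0) +
      ∑ e, Real.sqrt (g e) * ∫ x in (0 : ℝ)..1, s e x * u e x := by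
  have key : ∀ e, (Real.sqrt (g e))⁻¹ * ∫ x in (0 : ℝ)..1, d e x * δ e x =
      b * ((Real.sqrt (g e))⁻¹ * (d e 1 - d e 0)) +
      (Real.sqrt (g e) * ∫ x in (0 : ℝ)..1, s e x * u e x) := by
    intro e
    rw [integral_mul_right_deriv zero_le_one (h e) (continuousOn_const.mul (hs e)).neg (hu.cont e)
      (hu.deriv e) (hu.int e), hu.left, hu.right]
    have h1 : ∫ x in (0 : ℝ)..1, -(g e * s e x) * u e x =
        -(g e) * ∫ x in (0 : ℝ)..1, s e x * u e x := by
      rw [← intervalIntegral.integral_const_mul]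
      congr 1; ext x; ring
    rw [h1]
    have h2 : 0 < Real.sqrt (g e) := Real.sqrt_pos.2 (hg e)
    have h3 : Real.sqrt (g e) * Real.sqrt (g e) = g e := Real.mul_self_sqrt (hg e).le
    have h4 : (Real.sqrt (g e))⁻¹ * g e = Real.sqrt (g e) := by
      rw [inv_mul_eq_iff_eq_mul₀ h2.ne', h3]
    calc _ = b * ((Real.sqrt (g e))⁻¹ * (d e 1 - d e 0)) + (((Real.sqrt (g e))⁻¹ * g e) *
          ∫ x in (0 : ℝ)..1, s e x * u e x) := by ring
      _ = _ := by rw [h4]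
  simp only [energy, key, Finset.sum_add_distrib, ← Finset.mul_sum]

theorem isTest_one : IsTest (fun (_ : E) (_ : ℝ) => (1 : ℝ)) (fun _ _ => 0) 1 :=
  ⟨fun e => continuousOn_const, fun e x _ => hasDerivWithinAt_const _ _ _,
    fun e => by simp, fun e => by simp, fun e => rfl, fun e => rfl⟩

/-- Green's formula for sources with zero mean: the flux at the vertex vanishes. -/
theorem flux_eq [Fintype E] {g : E → ℝ} {d s : E → ℝ → ℝ}
    (hg : ∀ e, 0 < g e) (hs : ∀ e, ContinuousOn (s e) (Icc 0 1))
    (h : ∀ e, ∀ x ∈ Icc (0 : ℝ) 1, HasDerivWithinAt (d e) (-(g e * s e x)) (Icc 0 1) x) :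
    ∑ e, (Real.sqrt (g e))⁻¹ * (d e 1 - d e 0) =
      - ∑ e, Real.sqrt (g e) * ∫ x in (0 : ℝ)..1, s e x := by
  have := energy_eq_of_hasDeriv hg hs h (isTest_one (E := E))
  simp only [energy, mul_zero, intervalIntegral.integral_zero, Finset.sum_const_zero,
    mul_one, one_mul] at this
  linarith

namespace IsEig
variable [Fintype E] {g : E → ℝ} {ρ f d u δ : E → ℝ → ℝ} {μ c b : ℝ}

theorem cont (h : IsEig g ρ μ f d c) (e : E) : ContinuousOn (f e) (Icc 0 1) :=
  fun x hx => (h.deriv e x hx).continuousWithinAt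

theorem cont_deriv (h : IsEig g ρ μ f d c) (e : E) : ContinuousOn (d e) (Icc 0 1) :=
  fun x hx => (h.deriv₂ e x hx).continuousWithinAt

theorem isTest (h : IsEig g ρ μ f d c) : IsTest f d c where
  cont := h.cont
  deriv e x hx := HasDerivWithinAt.to_right hx (h.deriv e x (Ioo_subset_Icc_self hx))
  int e := intervalIntegrable_of_Icc (h.cont_deriv e)
  sq e := intervalIntegrable_of_Icc ((h.cont_deriv e).mul (h.cont_deriv e))
  left := h.left
  right := h.right

/-- Green's formula for eigenfunctions. -/
theorem energy_eq (h : IsEig g ρ μ f d c) (hd : IsData g ρ) (hu : IsTest u δ b) :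
    energy g d δ = μ * pair g ρ f u := by
  have hs : ∀ e, ContinuousOn (fun x => μ * (ρ e x * f e x)) (Icc 0 1) :=
    fun e => continuousOn_const.mul ((hd.cont e).mul (h.cont e))
  rw [energy_eq_of_hasDeriv hd.pos hs (fun e x hx => by
    simpa only [mul_assoc, mul_left_comm] using h.deriv₂ e x hx) hu, h.kirchhoff, pair,
    Finset.mul_sum, mul_zero, zero_add]
  refine Finset.sum_congr rfl fun e _ => ?_
  simp only [mul_assoc, intervalIntegral.integral_const_mul]
  ring

theorem mean_eq_zero (h : IsEig g ρ μ f d c) (hd : IsData g ρ) (hμ : μ ≠ 0) :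
    wmean g ρ f = 0 := by
  have := h.energy_eq hd isTest_one
  simp only [energy, pair, mul_zero, intervalIntegral.integral_zero, Finset.sum_const_zero,
    mul_one, zero_eq_mul, hμ, false_or] at this
  exact this

end IsEig

/-! ### Flower graphs -/
theorem agrees_flower {V F : Type*} {G : Multigraph V E} (hG : G.IsFlower) {f : E → ℝ → F} :
    AgreesAtVertices G f ↔ ∃ c, ∀ e, f e 0 = c ∧ f e 1 = c := by
  obtain ⟨hs, ⟨v⟩⟩ := Nat.card_eq_one_iff_unique.1 hG
  constructor
  · rintro ⟨φ, hφ⟩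
    refine ⟨φ v, fun e => ?_⟩
    rw [(hφ e).1, (hφ e).2, Subsingleton.elim (G.src e) v, Subsingleton.elim (G.tgt e) v]
    exact ⟨rfl, rfl⟩
  · rintro ⟨c, hc⟩
    exact ⟨fun _ => c, hc⟩

section flower
variable {V : Type*} [Fintype E] {G : Multigraph V E} {g : E → ℝ} {ρ f d : E → ℝ → ℝ} {μ c : ℝ}

theorem outwardDerivSum_flower {F : Type*} [NormedAddCommGroup F] [NormedSpace ℝ F]
    (hG : G.IsFlower) (f : E → ℝ → F) (v : V) :
    outwardDerivSum G g f v = ∑ e, (Real.sqrt (g e))⁻¹ •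
      (derivWithin (f e) (Icc 0 1) 0 - derivWithin (f e) (Icc 0 1) 1) := by
  obtain ⟨hs, _⟩ := Nat.card_eq_one_iff_unique.1 hG
  have h1 : ∀ e, G.src e = v := fun e => Subsingleton.elim _ _
  have h2 : ∀ e, G.tgt e = v := fun e => Subsingleton.elim _ _
  simp only [outwardDerivSum, h1, h2, Finset.filter_true, derivSrc, derivTgt, smul_sub,
    Finset.sum_sub_distrib, Finset.sum_neg_distrib]
  abel

/-- Passes to a first-order system in f and its derivative, the form in which Green's formula and
the Wronskian argument are applied. -/
theorem MemEigenspace.isEig (hG : G.IsFlower) (hg : ∀ e, 0 < g e)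
    (h : MemEigenspace G g ρ μ f) :
    ∃ c, IsEig g ρ μ f (fun e => derivWithin (f e) (Icc 0 1)) c := by
  obtain ⟨c, hc⟩ := (agrees_flower hG).1 h.continuous
  obtain ⟨hs, ⟨v⟩⟩ := Nat.card_eq_one_iff_unique.1 hG
  refine ⟨c, ?_, ?_, fun e => (hc e).1, fun e => (hc e).2, ?_⟩
  · intro e x hx
    exact ((h.contDiff e).differentiableOn (by norm_num) x hx).hasDerivWithinAt
  · intro e x hx
    have h1 : ContDiffOn ℝ 1 (derivWithin (f e) (Icc 0 1)) (Icc 0 1) :=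
      (h.contDiff e).derivWithin (uniqueDiffOn_Icc zero_lt_one) (by norm_num)
    have h2 := (h1.differentiableOn (by norm_num) x hx).hasDerivWithinAt
    have h3 := h.equation e x hx
    rw [iteratedDerivWithin_succ] at h3
    simp only [iteratedDerivWithin_one] at h3
    have hge := (hg e).ne'
    field_simp at h3
    have h4 : derivWithin (derivWithin (f e) (Icc 0 1)) (Icc 0 1) x =
        -(μ * g e * (ρ e x * f e x)) := by linear_combination -h3
    rwa [h4] at h2
  · have := h.kirchhoff v
    rw [outwardDerivSum_flower hG] at this
    rw [← neg_eq_zero, ← Finset.sum_neg_distrib]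
    refine (Finset.sum_congr rfl fun e _ => ?_).trans this
    simp only [smul_eq_mul]; ring

theorem IsEig.memEigenspace (hG : G.IsFlower) (hd : IsData g ρ) (h : IsEig g ρ μ f d c) :
    MemEigenspace G g ρ μ f := by
  have hu : UniqueDiffOn ℝ (Icc (0 : ℝ) 1) := uniqueDiffOn_Icc zero_lt_one
  have e1 : ∀ e, ∀ x ∈ Icc (0 : ℝ) 1, derivWithin (f e) (Icc 0 1) x = d e x :=
    fun e x hx => (h.deriv e x hx).derivWithin (hu x hx)
  have e2 : ∀ e, ∀ x ∈ Icc (0 : ℝ) 1,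
      derivWithin (derivWithin (f e) (Icc 0 1)) (Icc 0 1) x = -(μ * g e * (ρ e x * f e x)) := by
    intro e x hx
    rw [derivWithin_congr (e1 e) (e1 e x hx)]
    exact (h.deriv₂ e x hx).derivWithin (hu x hx)
  refine ⟨?_, ?_, (agrees_flower hG).2 ⟨c, fun e => ⟨h.left e, h.right e⟩⟩, ?_⟩
  · intro e
    rw [show (2 : WithTop ℕ∞) = 1 + 1 by norm_num, contDiffOn_succ_iff_derivWithin hu]
    refine ⟨fun x hx => (h.deriv e x hx).differentiableWithinAt, by simp, ?_⟩
    rw [show (1 : WithTop ℕ∞) = 0 + 1 by norm_num, contDiffOn_succ_iff_derivWithin hu]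
    refine ⟨?_, by simp, ?_⟩
    · intro x hx
      exact ((h.deriv₂ e x hx).congr (e1 e) (e1 e x hx)).differentiableWithinAt
    · rw [contDiffOn_zero]
      exact ((continuousOn_const.mul ((hd.cont e).mul (h.cont e))).neg).congr (e2 e)
  · intro e x hx
    rw [iteratedDerivWithin_succ]
    simp only [iteratedDerivWithin_one]
    rw [e2 e x hx]
    have := (hd.pos e).ne'
    field_simp
  · intro v
    rw [outwardDerivSum_flower hG, ← neg_eq_zero, ← Finset.sum_neg_distrib]
    refine (Finset.sum_congr rfl fun e _ => ?_).trans h.kirchhoff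
    rw [e1 e 0 (by simp), e1 e 1 (by simp)]
    simp only [smul_eq_mul]; ring

end flower

end QuantumGraph

namespace QuantumGraph

/-! ### The Green operator of a flower graph -/

/-- Continuous functions on an edge. -/
abbrev EdgeFun := C(Icc (0 : ℝ) 1, ℝ)

/-- The extension of a function on an edge by constants. -/
noncomputable def ext (u : EdgeFun) : ℝ → ℝ := IccExtend zero_le_one u

theorem continuous_ext (u : EdgeFun) : Continuous (ext u) := u.continuous.Icc_extend'

theorem ext_of_mem (u : EdgeFun) {x : ℝ} (hx : x ∈ Icc (0 : ℝ) 1) : ext u x = u ⟨x, hx⟩ :=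
  IccExtend_of_mem _ _ hx

theorem ext_add (u v : EdgeFun) (x : ℝ) : ext (u + v) x = ext u x + ext v x := rfl

theorem ext_sub (u v : EdgeFun) (x : ℝ) : ext (u - v) x = ext u x - ext v x := rfl

theorem ext_mul (u v : EdgeFun) (x : ℝ) : ext (u * v) x = ext u x * ext v x := rfl

theorem ext_smul (c : ℝ) (u : EdgeFun) (x : ℝ) : ext (c • u) x = c * ext u x := rfl

theorem ext_one (x : ℝ) : ext 1 x = 1 := rfl

theorem intervalIntegrable_ext (u : EdgeFun) (a b : ℝ) : IntervalIntegrable (ext u) volume a b :=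
  (continuous_ext u).intervalIntegrable a b

/-- The restriction of a function which is continuous on the closed edge. -/
def toEdge (f : ℝ → ℝ) (h : ContinuousOn f (Icc 0 1)) : EdgeFun :=
  ⟨(Icc (0 : ℝ) 1).domRestrict f, continuousOn_iff_continuous_domRestrict.1 h⟩

theorem ext_toEdge {f : ℝ → ℝ} (h : ContinuousOn f (Icc 0 1)) {x : ℝ} (hx : x ∈ Icc (0 : ℝ) 1) :
    ext (toEdge f h) x = f x := ext_of_mem _ hx

/-- The primitive vanishing at the initial point. -/
noncomputable def primitive : EdgeFun →ₗ[ℝ] EdgeFun where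
  toFun u := toEdge (fun x => ∫ t in (0 : ℝ)..x, ext u t)
    (fun x _ => ((continuous_ext u).integral_hasStrictDerivAt
      0 x).hasDerivAt.continuousAt.continuousWithinAt)
  map_add' u v := by
    ext x
    exact intervalIntegral.integral_add (intervalIntegrable_ext u _ _)
      (intervalIntegrable_ext v _ _)
  map_smul' c u := by
    ext x
    exact intervalIntegral.integral_const_mul c _

theorem ext_primitive (u : EdgeFun) {x : ℝ} (hx : x ∈ Icc (0 : ℝ) 1) :
    ext (primitive u) x = ∫ t in (0 : ℝ)..x, ext u t :=
  ext_of_mem _ hx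

theorem hasDerivWithinAt_primitive (u : EdgeFun) {x : ℝ} (hx : x ∈ Icc (0 : ℝ) 1) :
    HasDerivWithinAt (ext (primitive u)) (ext u x) (Icc 0 1) x :=
  (((continuous_ext u).integral_hasStrictDerivAt 0 x).hasDerivAt.hasDerivWithinAt).congr
    (fun _ hy => ext_primitive u hy) (ext_primitive u hx)

/-- Integration over an edge. -/
noncomputable def total : EdgeFun →ₗ[ℝ] ℝ where
  toFun u := ∫ t in (0 : ℝ)..1, ext u t
  map_add' u v := intervalIntegral.integral_add (intervalIntegrable_ext u _ _)
      (intervalIntegrable_ext v _ _)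
  map_smul' c _ := intervalIntegral.integral_const_mul c _

/-- The identity of an edge. -/
def coordinate : EdgeFun := toEdge (fun x => x) continuousOn_id

section operator
variable {E : Type*} (g : E → ℝ) (ρ : E → EdgeFun)

/-- The solution of `-w'' = g ρ u` on the edges with `w = 0` at the vertex. -/
noncomputable def dirichletGreen : (E → EdgeFun) →ₗ[ℝ] (E → EdgeFun) where
  toFun u e := g e • (ext (primitive (primitive (ρ e * u e))) 1 • coordinate -
    primitive (primitive (ρ e * u e)))
  map_add' u v := by
    funext e
    simp only [Pi.add_apply, mul_add, map_add, ext_add]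
    module
  map_smul' c u := by
    funext e
    simp only [Pi.smul_apply, mul_smul_comm, map_smul, ext_smul, RingHom.id_apply, mul_smul]
    module

/-- The derivative of `dirichletGreen`. -/
noncomputable def dirichletGreenDeriv (u : E → EdgeFun) (e : E) (x : ℝ) : ℝ :=
  g e * (ext (primitive (primitive (ρ e * u e))) 1 - ext (primitive (ρ e * u e)) x)

theorem dirichletGreen_deriv (u : E → EdgeFun) (e : E) {x : ℝ} (hx : x ∈ Icc (0 : ℝ) 1) :
    HasDerivWithinAt (ext (dirichletGreen g ρ u e)) (dirichletGreenDeriv g ρ u e x)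
      (Icc 0 1) x := by
  have h1 : HasDerivWithinAt (ext coordinate) 1 (Icc 0 1) x :=
    (hasDerivWithinAt_id x _).congr (fun y hy => ext_toEdge _ hy) (ext_toEdge _ hx)
  have h2 := ((h1.const_mul (ext (primitive (primitive (ρ e * u e))) 1)).sub
    (hasDerivWithinAt_primitive (primitive (ρ e * u e)) hx)).const_mul (g e)
  rw [mul_one] at h2
  exact h2

theorem dirichletGreen_deriv₂ (u : E → EdgeFun) (e : E) {x : ℝ} (hx : x ∈ Icc (0 : ℝ) 1) :
    HasDerivWithinAt (dirichletGreenDeriv g ρ u e) (-(g e * (ext (ρ e) x * ext (u e) x)))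
      (Icc 0 1) x := by
  have := ((hasDerivWithinAt_primitive (ρ e * u e) hx).const_sub
    (ext (primitive (primitive (ρ e * u e))) 1)).const_mul (g e)
  rw [ext_mul, mul_neg] at this
  exact this

theorem dirichletGreen_zero (u : E → EdgeFun) (e : E) : ext (dirichletGreen g ρ u e) 0 = 0 := by
  have h : ext (primitive (primitive (ρ e * u e))) 0 = 0 := by
    rw [ext_primitive _ (by simp)]; simp
  have h' : ext coordinate 0 = 0 := ext_toEdge _ (by simp)
  simp [dirichletGreen, ext_smul, ext_sub, h, h']

theorem dirichletGreen_one (u : E → EdgeFun) (e : E) : ext (dirichletGreen g ρ u e) 1 = 0 := by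
  have h' : ext coordinate 1 = 1 := ext_toEdge _ (by simp)
  simp [dirichletGreen, ext_smul, ext_sub, h']

theorem dirichletGreen_isTest (u : E → EdgeFun) :
    IsTest (fun e => ext (dirichletGreen g ρ u e)) (dirichletGreenDeriv g ρ u) 0 := by
  have hc : ∀ e, ContinuousOn (dirichletGreenDeriv g ρ u e) (Icc 0 1) :=
    fun e x hx => (dirichletGreen_deriv₂ g ρ u e hx).continuousWithinAt
  exact ⟨fun e => (continuous_ext _).continuousOn, fun e x hx => HasDerivWithinAt.to_right hx
    (dirichletGreen_deriv g ρ u e (Ioo_subset_Icc_self hx)),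
    fun e => intervalIntegrable_of_Icc (hc e),
    fun e => intervalIntegrable_of_Icc ((hc e).mul (hc e)),
    dirichletGreen_zero g ρ u, dirichletGreen_one g ρ u⟩

variable [Fintype E]

/-- The weighted inner product on continuous functions. -/
noncomputable def form : (E → EdgeFun) →ₗ[ℝ] (E → EdgeFun) →ₗ[ℝ] ℝ :=
  LinearMap.mk₂ ℝ (fun u v => ∑ e, Real.sqrt (g e) * total (ρ e * u e * v e))
    (fun u u' v => by
      simp only [Pi.add_apply, mul_add, add_mul, map_add, Finset.sum_add_distrib])
    (fun c u v => by
      simp only [Pi.smul_apply, mul_smul_comm, smul_mul_assoc, map_smul, Finset.smul_sum])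
    (fun u v v' => by
      simp only [Pi.add_apply, mul_add, map_add, Finset.sum_add_distrib])
    (fun c u v => by
      simp only [Pi.smul_apply, mul_smul_comm, map_smul, Finset.smul_sum])

theorem form_apply (u v : E → EdgeFun) :
    form g ρ u v = ∑ e, Real.sqrt (g e) * total (ρ e * u e * v e) := rfl

theorem form_eq_pair (u v : E → EdgeFun) :
    form g ρ u v = pair g (fun e => ext (ρ e)) (fun e => ext (u e)) (fun e => ext (v e)) := rfl

/-- The projection to functions with zero mean. -/
noncomputable def centre : (E → EdgeFun) →ₗ[ℝ] (E → EdgeFun) :=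
  LinearMap.id - ((form g ρ 1 1)⁻¹ • form g ρ 1).smulRight 1

theorem centre_apply (u : E → EdgeFun) :
    centre g ρ u = u - ((form g ρ 1 1)⁻¹ * form g ρ 1 u) • 1 := rfl

theorem form_symm (u v : E → EdgeFun) : form g ρ u v = form g ρ v u := by
  simp only [form_apply, mul_assoc, mul_comm (u _)]

theorem form_centre_left (u v : E → EdgeFun) :
    form g ρ (centre g ρ u) v = form g ρ u (centre g ρ v) := by
  simp only [centre_apply, map_sub, map_smul, smul_eq_mul, LinearMap.sub_apply,
    LinearMap.smul_apply]
  rw [form_symm g ρ u 1]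
  ring

variable {g ρ}

theorem centre_of_mean {u : E → EdgeFun} (h : form g ρ 1 u = 0) : centre g ρ u = u := by
  rw [centre_apply, h]; simp

variable (hg : ∀ e, 0 < g e) (hρ : ∀ e, ∀ x, 0 < ρ e x)
include hg hρ

theorem form_pos {u : E → EdgeFun} (hu : u ≠ 0) : 0 < form g ρ u u := by
  obtain ⟨e₀, he⟩ := Function.ne_iff.1 hu
  obtain ⟨x₀, hx⟩ := DFunLike.ne_iff.1 he
  rw [form_apply]
  have hpos : ∀ e x, 0 ≤ ext (ρ e * u e * u e) x := fun e x => by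
    rw [mul_assoc, ext_mul, ext_mul]
    exact mul_nonneg (hρ e _).le (mul_self_nonneg _)
  refine Finset.sum_pos' (fun e _ => mul_nonneg (Real.sqrt_nonneg _) ?_) ⟨e₀, Finset.mem_univ _,
    mul_pos (Real.sqrt_pos.2 (hg e₀)) ?_⟩
  · exact integral_nonneg_Icc fun x _ => hpos e x
  · refine intervalIntegral.integral_pos zero_lt_one (continuous_ext _).continuousOn
      (fun x _ => hpos e₀ x) ⟨x₀, x₀.2, ?_⟩
    rw [ext_of_mem _ x₀.2]
    have h1 : u e₀ x₀ ≠ 0 := hx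
    have h2 := mul_pos (hρ e₀ x₀) (mul_self_pos.2 h1)
    simpa [mul_assoc] using h2

theorem form_nonneg (u : E → EdgeFun) : 0 ≤ form g ρ u u := by
  rcases eq_or_ne u 0 with rfl | h
  · simp
  · exact (form_pos hg hρ h).le

variable [Nonempty E]

theorem form_one_pos : 0 < form g ρ 1 1 := by
  apply form_pos hg hρ
  exact one_ne_zero

theorem form_one_centre (u : E → EdgeFun) : form g ρ 1 (centre g ρ u) = 0 := by
  have := (form_one_pos hg hρ).ne'
  rw [centre_apply, map_sub, map_smul, smul_eq_mul]
  field_simp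
  ring

theorem form_centre_le (u : E → EdgeFun) :
    form g ρ (centre g ρ u) (centre g ρ u) ≤ form g ρ u u := by
  have hM := form_one_pos hg hρ
  have h1 := form_one_centre hg hρ u
  have h2 : form g ρ u u = form g ρ (centre g ρ u) (centre g ρ u) +
      ((form g ρ 1 1)⁻¹ * form g ρ 1 u) ^ 2 * form g ρ 1 1 := by
    have e : u = centre g ρ u + ((form g ρ 1 1)⁻¹ * form g ρ 1 u) • 1 := by
      rw [centre_apply]; module
    conv_lhs => rw [e]
    simp only [map_add, LinearMap.add_apply, map_smul, LinearMap.smul_apply, smul_eq_mul, h1,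
      form_symm g ρ (centre g ρ u) 1]
    ring
  have : 0 ≤ ((form g ρ 1 1)⁻¹ * form g ρ 1 u) ^ 2 * form g ρ 1 1 := by positivity
  linarith

omit hρ [Nonempty E] in
/-- Green's formula for the operator `dirichletGreen`. -/
theorem energy_dirichletGreen {u : E → EdgeFun} (hu : form g ρ 1 u = 0) {v δ : E → ℝ → ℝ} {c : ℝ}
    (hv : IsTest v δ c) :
    energy g (dirichletGreenDeriv g ρ u) δ =
      pair g (fun e => ext (ρ e)) (fun e => ext (u e)) v := by
  have hs : ∀ e, ContinuousOn (fun x => ext (ρ e) x * ext (u e) x) (Icc 0 1) :=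
    fun e => ((continuous_ext _).mul (continuous_ext _)).continuousOn
  -- A source of mean zero has zero total flux at the vertex, so the boundary term vanishes whatever
  -- the vertex value c of the test function.
  have h0 : ∑ e, Real.sqrt (g e) * ∫ x in (0 : ℝ)..1, ext (ρ e) x * ext (u e) x = 0 := by
    rw [form_eq_pair] at hu
    simpa [pair, ext_one] using hu
  rw [energy_eq_of_hasDeriv hg hs (fun e x hx => dirichletGreen_deriv₂ g ρ u e hx) hv,
    flux_eq hg hs (fun e x hx => dirichletGreen_deriv₂ g ρ u e hx), h0]
  simp [pair]

end operator

end QuantumGraph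

namespace QuantumGraph

/-! ### Existence of the first eigenvalue and its variational characterisation -/

/-- Bounded and equi-Lipschitz families are compact. -/
theorem isCompact_lipschitz (C : ℝ) :
    IsCompact {u : EdgeFun | (∀ x, |u x| ≤ C) ∧ ∀ x y, |u x - u y| ≤ C * |(x : ℝ) - y|} := by
  apply ArzelaAscoli.isCompact_of_equicontinuous
  -- In the topology of pointwise convergence the family is a closed subset of a product of compact
  -- intervals; the Lipschitz bound itself supplies the continuity of its members.
  · have himg : ContinuousMap.toFun ''
        {u : EdgeFun | (∀ x, |u x| ≤ C) ∧ ∀ x y, |u x - u y| ≤ C * |(x : ℝ) - y|} =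
        {h : Icc (0 : ℝ) 1 → ℝ | (∀ x, h x ∈ Icc (-C) C)} ∩
          {h | ∀ x y, |h x - h y| ≤ C * |(x : ℝ) - y|} := by
      ext h
      constructor
      · rintro ⟨u, ⟨h1, h2⟩, rfl⟩
        exact ⟨fun x => abs_le.1 (h1 x), h2⟩
      · rintro ⟨h1, h2⟩
        refine ⟨⟨h, ?_⟩, ⟨fun x => abs_le.2 (h1 x), h2⟩, rfl⟩
        rw [continuous_iff_continuousAt]
        intro y
        rw [ContinuousAt, tendsto_iff_norm_sub_tendsto_zero]
        refine squeeze_zero (fun _ => norm_nonneg _) (fun x => h2 x y) ?_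
        have : Continuous fun x : Icc (0 : ℝ) 1 => C * |(x : ℝ) - y| := by fun_prop
        simpa using this.tendsto y
    rw [himg]
    refine IsCompact.inter_right ?_ ?_
    · have : {h : Icc (0 : ℝ) 1 → ℝ | ∀ x, h x ∈ Icc (-C) C} = univ.pi fun _ => Icc (-C) C := by
        ext h; simp only [Set.mem_ofPred_eq, mem_univ_pi]
      rw [this]
      exact isCompact_univ_pi fun _ => isCompact_Icc
    · simp only [Set.ofPred_forall]
      refine isClosed_iInter fun x => isClosed_iInter fun y => ?_
      exact isClosed_le (by fun_prop) continuous_const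
  · refine Metric.equicontinuous_of_continuity_modulus (fun r => C * r) ?_ _ ?_
    · have : Continuous fun r : ℝ => C * r := by fun_prop
      simpa using this.tendsto 0
    · rintro x y ⟨u, hu⟩
      exact hu.2 x y

section
variable {E : Type*} [Fintype E] {g : E → ℝ}

theorem energy_comm (d d' : E → ℝ → ℝ) : energy g d d' = energy g d' d := by
  simp only [energy, mul_comm (d _ _)]

theorem energy_self_nonneg (d : E → ℝ → ℝ) : 0 ≤ energy g d d :=
  Finset.sum_nonneg fun _ _ => mul_nonneg (inv_nonneg.2 (Real.sqrt_nonneg _))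
    (integral_nonneg_Icc fun _ _ => mul_self_nonneg _)

/-- Positivity of the energy of a difference. -/
theorem energy_ge {d δ : E → ℝ → ℝ} (hd : ∀ e, ContinuousOn (d e) (Icc 0 1))
    (hi : ∀ e, IntervalIntegrable (δ e) volume 0 1)
    (hs : ∀ e, IntervalIntegrable (fun x => δ e x * δ e x) volume 0 1) (s : ℝ) :
    2 * s * energy g d δ - s ^ 2 * energy g d d ≤ energy g δ δ := by
  have key : ∀ e, 2 * s * (∫ x in (0 : ℝ)..1, d e x * δ e x) -
      s ^ 2 * (∫ x in (0 : ℝ)..1, d e x * d e x) ≤ ∫ x in (0 : ℝ)..1, δ e x * δ e x := by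
    intro e
    have i1 : IntervalIntegrable (fun x => d e x * δ e x) volume 0 1 :=
      (hi e).continuousOn_mul (by rw [uIcc_of_le zero_le_one]; exact hd e)
    have i2 : IntervalIntegrable (fun x => d e x * d e x) volume 0 1 :=
      intervalIntegrable_of_Icc ((hd e).mul (hd e))
    rw [← intervalIntegral.integral_const_mul, ← intervalIntegral.integral_const_mul,
      ← intervalIntegral.integral_sub (i1.const_mul _) (i2.const_mul _)]
    refine integral_mono_Icc ((i1.const_mul _).sub (i2.const_mul _)) (hs e) fun x _ => ?_
    nlinarith [mul_self_nonneg (δ e x - s * d e x)]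
  simp only [energy, Finset.mul_sum, ← Finset.sum_sub_distrib]
  refine Finset.sum_le_sum fun e _ => ?_
  have := mul_le_mul_of_nonneg_left (key e) (inv_nonneg.2 (Real.sqrt_nonneg (g e)))
  linarith

variable {ρ : E → EdgeFun}

omit [Fintype E] in
theorem dirichletGreenDeriv_cont (u : E → EdgeFun) (e : E) :
    ContinuousOn (dirichletGreenDeriv g ρ u e) (Icc 0 1) :=
  fun _ hx => (dirichletGreen_deriv₂ g ρ u e hx).continuousWithinAt

variable (hg : ∀ e, 0 < g e) (hρ : ∀ e, ∀ x, 0 < ρ e x)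
include hg hρ

/-- From |u| ≤ 1 + u² one gets ∫ ρ|u| ≤ ∫ ρ + ∫ ρu², and the last integral is at most the inverse
square root of g on this edge. -/
theorem abs_primitive_le {u : E → EdgeFun} (hu : form g ρ u u ≤ 1) (e : E) {x : ℝ}
    (hx : x ∈ Icc (0 : ℝ) 1) :
    |ext (primitive (ρ e * u e)) x| ≤ total (ρ e) + (Real.sqrt (g e))⁻¹ := by
  have hr : 0 < Real.sqrt (g e) := Real.sqrt_pos.2 (hg e)
  have hnn : ∀ e x, 0 ≤ ext (ρ e * u e * u e) x := fun e x => by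
    rw [mul_assoc, ext_mul, ext_mul]
    exact mul_nonneg (hρ e _).le (mul_self_nonneg _)
  have h1 : Real.sqrt (g e) * total (ρ e * u e * u e) ≤ 1 := by
    refine le_trans ?_ hu
    rw [form_apply]
    exact Finset.single_le_sum (f := fun e => Real.sqrt (g e) * total (ρ e * u e * u e))
      (fun e _ => mul_nonneg (Real.sqrt_nonneg _) (integral_nonneg_Icc fun x _ => hnn e x))
      (Finset.mem_univ e)
  have h2 : total (ρ e * u e * u e) ≤ (Real.sqrt (g e))⁻¹ := by
    rw [← one_div, le_div_iff₀ hr]; linarith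
  rw [ext_primitive _ hx]
  calc |∫ t in (0 : ℝ)..x, ext (ρ e * u e) t|
      ≤ ∫ t in (0 : ℝ)..x, |ext (ρ e * u e) t| :=
        intervalIntegral.abs_integral_le_integral_abs hx.1
    _ ≤ ∫ t in (0 : ℝ)..1, |ext (ρ e * u e) t| := by
        refine intervalIntegral.integral_mono_interval le_rfl hx.1 hx.2
          (Eventually.of_forall fun _ => abs_nonneg _) ?_
        exact (continuous_ext _).abs.intervalIntegrable _ _
    _ ≤ ∫ t in (0 : ℝ)..1, (ext (ρ e) t + ext (ρ e * u e * u e) t) := by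
        refine integral_mono_Icc ((continuous_ext _).abs.intervalIntegrable _ _)
          (((continuous_ext _).add (continuous_ext _)).intervalIntegrable _ _) fun t ht => ?_
        have h3 := hρ e ⟨t, ht⟩
        rw [← ext_of_mem _ ht] at h3
        rw [ext_mul, ext_mul, ext_mul, abs_mul, abs_of_pos h3]
        have h4 : |ext (u e) t| ≤ 1 + ext (u e) t * ext (u e) t := by
          rw [← abs_mul_abs_self (ext (u e) t)]
          nlinarith [mul_self_nonneg (|ext (u e) t| - 1), abs_nonneg (ext (u e) t)]
        nlinarith
    _ = total (ρ e) + total (ρ e * u e * u e) :=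
        intervalIntegral.integral_add (intervalIntegrable_ext _ _ _) (intervalIntegrable_ext _ _ _)
    _ ≤ _ := by linarith

/-- The derivative of the potential is g times a difference of two terms of size at most A, hence
the Lipschitz constant 2gA. As the potential vanishes at x = 0, the same constant bounds its values.
-/
theorem exists_compact :
    ∃ K : Set (E → EdgeFun), IsCompact K ∧
      ∀ u, form g ρ u u ≤ 1 → dirichletGreen g ρ u ∈ K := by
  set A : E → ℝ := fun e => total (ρ e) + (Real.sqrt (g e))⁻¹ with hA
  refine ⟨univ.pi fun e => {u : EdgeFun | (∀ x, |u x| ≤ 2 * g e * A e) ∧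
      ∀ x y, |u x - u y| ≤ 2 * g e * A e * |(x : ℝ) - y|},
    isCompact_univ_pi fun e => isCompact_lipschitz _, fun u hu => ?_⟩
  rw [mem_univ_pi]
  intro e
  have hb := fun x hx => abs_primitive_le hg hρ hu e (x := x) hx
  have hb2 : |ext (primitive (primitive (ρ e * u e))) 1| ≤ A e := by
    rw [ext_primitive _ (by simp)]
    have h := intervalIntegral.norm_integral_le_of_norm_le_const (a := 0) (b := 1) (C := A e)
      (f := ext (primitive (ρ e * u e))) (fun x hx => by
        rw [uIoc_of_le zero_le_one] at hx
        exact hb x (Ioc_subset_Icc_self hx))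
    simpa using h
  have hd : ∀ x ∈ Icc (0 : ℝ) 1, ‖dirichletGreenDeriv g ρ u e x‖ ≤ 2 * g e * A e := by
    intro x hx
    rw [Real.norm_eq_abs, dirichletGreenDeriv, abs_mul, abs_of_pos (hg e)]
    have h1 := abs_sub (ext (primitive (primitive (ρ e * u e))) 1) (ext (primitive (ρ e * u e)) x)
    have h2 := hb x hx
    have : |ext (primitive (primitive (ρ e * u e))) 1 - ext (primitive (ρ e * u e)) x|
      ≤ 2 * A e := by linarith
    nlinarith [hg e]
  have hL : ∀ x y : Icc (0 : ℝ) 1, |dirichletGreen g ρ u e x - dirichletGreen g ρ u e y| ≤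
      2 * g e * A e * |(x : ℝ) - y| := by
    intro x y
    have := Convex.norm_image_sub_le_of_norm_hasDerivWithin_le
      (fun x hx => dirichletGreen_deriv g ρ u e hx) hd (convex_Icc 0 1) y.2 x.2
    rwa [ext_of_mem _ x.2, ext_of_mem _ y.2] at this
  refine ⟨fun x => ?_, hL⟩
  have h0 := dirichletGreen_zero g ρ u e
  rw [ext_of_mem _ (by simp : (0 : ℝ) ∈ Icc (0 : ℝ) 1)] at h0
  have h1 := hL x ⟨0, by simp⟩
  rw [h0] at h1
  simp only [sub_zero, abs_of_nonneg x.2.1] at h1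
  have h2 : 0 ≤ 2 * g e * A e := le_trans (norm_nonneg _) (hd 0 (by simp))
  nlinarith [x.2.2]

omit hg in
theorem form_le_norm (u : E → EdgeFun) : form g ρ u u ≤ form g ρ 1 1 * ‖u‖ ^ 2 := by
  rw [form_apply, form_apply, Finset.sum_mul]
  refine Finset.sum_le_sum fun e _ => ?_
  rw [mul_assoc (Real.sqrt (g e))]
  refine mul_le_mul_of_nonneg_left ?_ (Real.sqrt_nonneg _)
  change ∫ t in (0 : ℝ)..1, ext (ρ e * u e * u e) t ≤
    (∫ t in (0 : ℝ)..1, ext (ρ e * 1 * 1) t) * ‖u‖ ^ 2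
  rw [← intervalIntegral.integral_mul_const]
  refine integral_mono_Icc (intervalIntegrable_ext _ _ _)
    ((intervalIntegrable_ext _ _ _).mul_const _) fun t ht => ?_
  have h3 := hρ e ⟨t, ht⟩
  rw [← ext_of_mem _ ht] at h3
  simp only [ext_mul, mul_one, mul_assoc]
  refine mul_le_mul_of_nonneg_left ?_ h3.le
  have h1 : |ext (u e) t| ≤ ‖u‖ := by
    rw [ext_of_mem _ ht]
    exact ((u e).norm_coe_le_norm ⟨t, ht⟩).trans (norm_le_pi_norm u e)
  rw [← sq, ← sq_abs]
  exact pow_le_pow_left₀ (abs_nonneg _) h1 2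

variable [Nonempty E]

/-- Centring, solving with zero vertex value and centring again gives the compact operator T = PKP.
Adding a constant affects neither the equation solved by K nor the Kirchhoff condition, which holds
for centred sources. So an eigenvector Tw = μw is an eigenfunction with eigenvalue 1/μ, and
maximality of μ is the variational inequality. -/
theorem exists_first_edgeFun :
    ∃ lam : ℝ, 0 < lam ∧
      (∃ f d c, IsEig g (fun e => ext (ρ e)) lam f d c ∧
        0 < pair g (fun e => ext (ρ e)) f f) ∧
      ∀ u δ c, IsTest u δ c → wmean g (fun e => ext (ρ e)) u = 0 →
        lam * pair g (fun e => ext (ρ e)) u u ≤ energy g δ δ := by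
  set B := form g ρ with hB
  set K := dirichletGreen g ρ with hK
  set P := centre g ρ with hP
  set T : (E → EdgeFun) →ₗ[ℝ] (E → EdgeFun) := P ∘ₗ K ∘ₗ P with hT
  have hM := form_one_pos hg hρ
  -- The form of T is the energy of the two potentials, which makes T symmetric and positive at
  -- once.
  have hTe : ∀ x y, B (T x) y =
      energy g (dirichletGreenDeriv g ρ (P y)) (dirichletGreenDeriv g ρ (P x)) := by
    intro x y
    rw [energy_dirichletGreen hg (form_one_centre hg hρ y) (dirichletGreen_isTest g ρ (P x)),
      ← form_eq_pair]
    change form g ρ (centre g ρ (K (P x))) y = _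
    rw [form_centre_left, form_symm]
  have hTsymm : ∀ x y, B (T x) y = B x (T y) := by
    intro x y
    rw [hTe, energy_comm, ← hTe, hB, form_symm]
  -- the variational inequality for each multiplier
  have hvar : ∀ u δ c, IsTest u δ c → wmean g (fun e => ext (ρ e)) u = 0 →
      ∃ x, B x x = pair g (fun e => ext (ρ e)) u u ∧
        ∀ s, 2 * s * B x x - s ^ 2 * B (T x) x ≤ energy g δ δ := by
    intro u δ c hu hm
    set x : E → EdgeFun := fun e => toEdge (u e) (hu.cont e) with hx
    have hxu : ∀ v : E → ℝ → ℝ, pair g (fun e => ext (ρ e)) (fun e => ext (x e)) v =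
        pair g (fun e => ext (ρ e)) u v := by
      intro v
      refine Finset.sum_congr rfl fun e _ => ?_
      rw [integral_congr_Icc fun t ht => ?_]
      simp only [hx, ext_toEdge (hu.cont e) ht]
    have hxu2 : B x x = pair g (fun e => ext (ρ e)) u u := by
      rw [hB, form_eq_pair, hxu]
      refine Finset.sum_congr rfl fun e _ => ?_
      rw [integral_congr_Icc fun t ht => ?_]
      simp only [hx, ext_toEdge (hu.cont e) ht]
    have hmx : form g ρ 1 x = 0 := by
      rw [form_symm, form_eq_pair, hxu]
      refine (Finset.sum_congr rfl fun e _ => ?_).trans hm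
      simp [ext_one]
    refine ⟨x, hxu2, fun s => ?_⟩
    have h1 := energy_ge (g := g) (dirichletGreenDeriv_cont (g := g) (ρ := ρ) x) hu.int hu.sq s
    rw [energy_dirichletGreen hg hmx hu, hxu, ← hxu2] at h1
    have h2 := hTe x x
    rw [hP, centre_of_mean hmx] at h2
    rwa [h2]
  obtain ⟨S, hS, hSmem⟩ := exists_compact hg hρ
  have hSP : ∀ x, B x x ≤ 1 → K (P x) ∈ S :=
    fun x hx => hSmem _ ((form_centre_le hg hρ x).trans hx)
  obtain ⟨R, hR⟩ := hS.isBounded.exists_norm_le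
  have hbdd : ∃ C, ∀ x, B x x ≤ 1 → B (T x) x ≤ C := by
    refine ⟨form g ρ 1 1 * R ^ 2 + 1, fun x hx => ?_⟩
    have h1 : B (T x) x = form g ρ (K (P x)) (P x) := form_centre_left g ρ _ _
    have h2 := form_nonneg hg hρ (K (P x) - P x)
    have h3 := form_le_norm (g := g) hρ (K (P x))
    have h4 : ‖K (P x)‖ ≤ R := hR _ (hSP x hx)
    have h5 := (form_centre_le hg hρ x).trans hx
    have h6 : form g ρ 1 1 * ‖K (P x)‖ ^ 2 ≤ form g ρ 1 1 * R ^ 2 := by gcongr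
    have h7 := form_nonneg hg hρ (K (P x))
    have h8 := form_nonneg hg hρ (P x)
    simp only [map_sub, LinearMap.sub_apply, form_symm g ρ (P x) (K (P x))] at h2
    rw [h1]
    change form g ρ (P x) (P x) ≤ 1 at h5
    linarith
  have hne : ∃ x, 0 < B (T x) x := by
    set h : E → EdgeFun := fun _ => toEdge (fun x => x * (1 - x)) (by fun_prop) with hh
    set a := ((form g ρ 1 1)⁻¹ * form g ρ 1 h) with ha
    have ht : IsTest (fun e => ext (P h e)) (fun _ x => 1 - 2 * x) (-a) := by
      have hx : ∀ e : E, ∀ x ∈ Icc (0 : ℝ) 1, ext (P h e) x = x * (1 - x) - a := by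
        intro e x hx
        rw [hP, centre_apply, Pi.sub_apply, ext_sub, Pi.smul_apply, ext_smul, Pi.one_apply,
          ext_one, ← ha, hh, ext_toEdge _ hx, mul_one]
      refine ⟨fun e => (continuous_ext _).continuousOn, fun e x hx' => ?_, fun e => ?_, fun e => ?_,
        fun e => ?_, fun e => ?_⟩
      · apply HasDerivWithinAt.to_right hx'
        refine HasDerivWithinAt.congr ?_ (hx e) (hx e x (Ioo_subset_Icc_self hx'))
        have := (((hasDerivAt_id x).mul ((hasDerivAt_id x).const_sub 1)).sub_const a)
        refine this.hasDerivWithinAt.congr_deriv ?_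
        simp; ring
      · exact Continuous.intervalIntegrable (by fun_prop) _ _
      · exact Continuous.intervalIntegrable (by fun_prop) _ _
      · rw [hx e 0 (by simp)]; ring
      · rw [hx e 1 (by simp)]; ring
    have hm : wmean g (fun e => ext (ρ e)) (fun e => ext (P h e)) = 0 := by
      have h0 := form_one_centre hg hρ h
      rw [form_symm, form_eq_pair] at h0
      refine (Finset.sum_congr rfl fun e _ => ?_).trans h0
      simp [ext_one, hP]
    obtain ⟨x, hx1, hx2⟩ := hvar _ _ _ ht hm
    have hPh : P h ≠ 0 := by
      intro h0
      have hx : ∀ e : E, ∀ x ∈ Icc (0 : ℝ) 1, x * (1 - x) - a = 0 := by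
        intro e x hx
        have : ext (P h e) x = 0 := by rw [h0]; rfl
        rw [← this, hP, centre_apply, Pi.sub_apply, ext_sub, Pi.smul_apply, ext_smul, Pi.one_apply,
          ext_one, ← ha, hh, ext_toEdge _ hx, mul_one]
      obtain ⟨e⟩ := ‹Nonempty E›
      have h1 := hx e 0 (by simp)
      have h2 := hx e (1 / 2) (by norm_num)
      norm_num at h1 h2
      linarith
    have hxpos : 0 < B x x := by
      rw [hx1, ← form_eq_pair]; exact form_pos hg hρ hPh
    -- If ⟨Tx, x⟩ ≤ 0, then 2s B(x,x) would stay below the fixed energy for every s ≥ 0; the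
    -- multiplier s below violates this.
    refine ⟨x, ?_⟩
    by_contra hcon
    push Not at hcon
    set en := energy g (fun (_ : E) x => 1 - 2 * x) (fun _ x => 1 - 2 * x) with hen
    have hen0 : 0 ≤ en := energy_self_nonneg _
    have h1 := hx2 ((en + 1) / B x x)
    have h2 : 2 * ((en + 1) / B x x) * B x x = 2 * (en + 1) := by field_simp
    rw [h2] at h1
    nlinarith [sq_nonneg ((en + 1) / B x x)]
  have hcpt : ∀ x : ℕ → (E → EdgeFun), (∀ n, B (x n) (x n) ≤ 1) → ∃ w, ∃ φ : ℕ → ℕ,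
      Tendsto φ atTop atTop ∧
      Tendsto (fun n => B (T (x (φ n)) - w) (T (x (φ n)) - w)) atTop (𝓝 0) := by
    intro x hx
    obtain ⟨w, _, φ, hφ, hlim⟩ := hS.tendsto_subseq fun n => hSP (x n) (hx n)
    refine ⟨P w, φ, hφ.tendsto_atTop, ?_⟩
    have h1 : Tendsto (fun n => form g ρ 1 1 * ‖K (P (x (φ n))) - w‖ ^ 2) atTop (𝓝 0) := by
      have := ((tendsto_iff_norm_sub_tendsto_zero.1 hlim).pow 2).const_mul (form g ρ 1 1)
      simpa using this
    refine squeeze_zero (fun n => form_nonneg hg hρ _) (fun n => ?_) h1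
    have : T (x (φ n)) - P w = P (K (P (x (φ n))) - w) := by rw [map_sub]; rfl
    rw [this]
    exact (form_centre_le hg hρ _).trans (form_le_norm hρ _)
  obtain ⟨μ, hμ, w, hw, hTw, hmax⟩ := exists_top_eigenvector B T (form_symm g ρ)
    (form_nonneg hg hρ) (fun x hx => by
      by_contra h; exact (form_pos hg hρ h).ne' hx) hTsymm
    (fun x => by rw [hTe]; exact energy_self_nonneg _) hne hbdd hcpt
  have hmw : form g ρ 1 w = 0 := by
    have h1 : form g ρ 1 (T w) = 0 := form_one_centre hg hρ _
    rw [hTw, map_smul, smul_eq_mul] at h1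
    exact (mul_eq_zero.1 h1).resolve_left hμ.ne'
  have hPw : P w = w := centre_of_mean hmw
  set b := (form g ρ 1 1)⁻¹ * form g ρ 1 (K w) with hb
  have hwK : ∀ e x, ext (w e) x = μ⁻¹ * (ext (K w e) x - b) := by
    intro e x
    have h1 : μ • w = K w - b • 1 := by
      rw [← hTw, hb]
      change centre g ρ (K (P w)) = _
      rw [hPw, centre_apply]
    have h2 := congrArg (fun z : E → EdgeFun => ext (z e) x) h1
    simp only [Pi.smul_apply, Pi.sub_apply, ext_smul, ext_sub, Pi.one_apply, ext_one] at h2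
    rw [eq_inv_mul_iff_mul_eq₀ hμ.ne', h2, mul_one]
  refine ⟨μ⁻¹, inv_pos.2 hμ, ⟨fun e => ext (w e), fun e x => μ⁻¹ * dirichletGreenDeriv g ρ w e x,
    μ⁻¹ * (0 - b), ⟨fun e x hx => ?_, fun e x hx => ?_, fun e => ?_, fun e => ?_, ?_⟩, ?_⟩, ?_⟩
  · refine HasDerivWithinAt.congr ?_ (fun y _ => hwK e y) (hwK e x)
    exact ((dirichletGreen_deriv g ρ w e hx).sub_const b).const_mul _
  · refine ((dirichletGreen_deriv₂ g ρ w e hx).const_mul μ⁻¹).congr_deriv ?_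
    ring
  · rw [hwK, hK, dirichletGreen_zero]
  · rw [hwK, hK, dirichletGreen_one]
  · have hs : ∀ e, ContinuousOn (fun x => ext (ρ e) x * ext (w e) x) (Icc 0 1) :=
      fun e => ((continuous_ext _).mul (continuous_ext _)).continuousOn
    have h1 := flux_eq hg hs fun e x hx => dirichletGreen_deriv₂ g ρ w e hx
    have h0 : ∑ e, Real.sqrt (g e) * ∫ x in (0 : ℝ)..1, ext (ρ e) x * ext (w e) x = 0 := by
      rw [form_eq_pair] at hmw
      simpa [pair, ext_one] using hmw
    rw [h0, neg_zero] at h1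
    calc _ = μ⁻¹ * ∑ e, (Real.sqrt (g e))⁻¹ *
          (dirichletGreenDeriv g ρ w e 1 - dirichletGreenDeriv g ρ w e 0) := by
          rw [Finset.mul_sum]; exact Finset.sum_congr rfl fun e _ => by ring
      _ = 0 := by rw [h1, mul_zero]
  · rw [← form_eq_pair]; exact form_pos hg hρ hw
  · intro u δ c hu hm
    obtain ⟨x, hx1, hx2⟩ := hvar u δ c hu hm
    -- The multiplier 1/μ is optimal: 2/μ - (1/μ²) μ = 1/μ.
    have h1 := hx2 μ⁻¹
    have h2 := hmax x
    rw [← hx1]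
    have h3 : μ⁻¹ ^ 2 * B (T x) x ≤ μ⁻¹ ^ 2 * (μ * B x x) := by gcongr
    have h4 : μ⁻¹ ^ 2 * (μ * B x x) = μ⁻¹ * B x x := by field_simp
    linarith

end

end QuantumGraph

/-! ### The first eigenvalue as a constrained minimum -/

namespace QuantumGraph

section
variable {E : Type*} [Fintype E] {g : E → ℝ} {ρ u v δ f d : E → ℝ → ℝ} {c lam μ : ℝ}

/-- `lam` is the first positive eigenvalue: it is attained, and it satisfies the variational
inequality. -/
structure IsFirst (g : E → ℝ) (ρ : E → ℝ → ℝ) (lam : ℝ) : Prop where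
  pos : 0 < lam
  exists_eig : ∃ f d c, IsEig g ρ lam f d c ∧ 0 < pair g ρ f f
  le : ∀ u δ c, IsTest u δ c → wmean g ρ u = 0 → lam * pair g ρ u u ≤ energy g δ δ

theorem exists_isFirst [Nonempty E] (h : IsData g ρ) : ∃ lam, IsFirst g ρ lam := by
  set ρ' : E → EdgeFun := fun e => toEdge (ρ e) (h.cont e) with hρ'
  have he : ∀ e, ∀ x ∈ Icc (0 : ℝ) 1, ext (ρ' e) x = ρ e x := fun e x hx => ext_toEdge _ hx
  have hp : ∀ e x, 0 < ρ' e x := fun e x => h.dens e x x.2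
  have hpair : ∀ u v, pair g (fun e => ext (ρ' e)) u v = pair g ρ u v := fun u v =>
    Finset.sum_congr rfl fun e _ => congrArg _
      (integral_congr_Icc fun x hx => by simp only [he e x hx])
  have hmean : ∀ u, wmean g (fun e => ext (ρ' e)) u = wmean g ρ u := fun u =>
    Finset.sum_congr rfl fun e _ => congrArg _
      (integral_congr_Icc fun x hx => by simp only [he e x hx])
  obtain ⟨lam, h0, ⟨f, d, c, hf, hff⟩, hle⟩ := exists_first_edgeFun h.pos hp
  simp only [hpair, hmean] at hff hle
  exact ⟨lam, h0, ⟨f, d, c, ⟨hf.deriv, fun e x hx => by rw [← he e x hx]; exact hf.deriv₂ e x hx,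
    hf.left, hf.right, hf.kirchhoff⟩, hff⟩, hle⟩

theorem pair_self_nonneg (h : IsData g ρ) (u : E → ℝ → ℝ) : 0 ≤ pair g ρ u u :=
  Finset.sum_nonneg fun e _ => mul_nonneg (Real.sqrt_nonneg _) (integral_nonneg_Icc fun x hx => by
    rw [mul_assoc]; exact mul_nonneg (h.dens e x hx).le (mul_self_nonneg _))

theorem pair_self_pos (h : IsData g ρ) (hu : ∀ e, ContinuousOn (u e) (Icc 0 1))
    {e₀ : E} {x₀ : ℝ} (hx : x₀ ∈ Icc (0 : ℝ) 1) (hne : u e₀ x₀ ≠ 0) : 0 < pair g ρ u u := by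
  have hnn : ∀ e, ∀ x ∈ Icc (0 : ℝ) 1, 0 ≤ ρ e x * u e x * u e x := fun e x hx => by
    rw [mul_assoc]; exact mul_nonneg (h.dens e x hx).le (mul_self_nonneg _)
  refine Finset.sum_pos' (fun e _ => mul_nonneg (Real.sqrt_nonneg _)
    (integral_nonneg_Icc (hnn e))) ⟨e₀, Finset.mem_univ _, mul_pos (Real.sqrt_pos.2 (h.pos e₀)) ?_⟩
  refine intervalIntegral.integral_pos zero_lt_one (((h.cont e₀).mul (hu e₀)).mul (hu e₀))
    (fun x hx => hnn e₀ x (Ioc_subset_Icc_self hx)) ⟨x₀, hx, ?_⟩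
  rw [mul_assoc]
  exact mul_pos (h.dens e₀ x₀ hx) (mul_self_pos.2 hne)

theorem totalMass_pos [Nonempty E] (h : IsData g ρ) : 0 < totalMass g ρ := by
  refine Finset.sum_pos (fun e _ => mul_pos (Real.sqrt_pos.2 (h.pos e)) ?_) Finset.univ_nonempty
  exact intervalIntegral.integral_pos zero_lt_one (h.cont e)
    (fun x hx => (h.dens e x (Ioc_subset_Icc_self hx)).le) ⟨0, by simp, h.dens e 0 (by simp)⟩

theorem wmean_sub_const (h : IsData g ρ) (hu : ∀ e, ContinuousOn (u e) (Icc 0 1)) (a : ℝ) :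
    wmean g ρ (fun e x => u e x - a) = wmean g ρ u - a * totalMass g ρ := by
  simp only [wmean, totalMass, Finset.mul_sum, ← Finset.sum_sub_distrib]
  refine Finset.sum_congr rfl fun e _ => ?_
  have i1 : IntervalIntegrable (fun x => ρ e x * u e x) volume 0 1 :=
    intervalIntegrable_of_Icc ((h.cont e).mul (hu e))
  have i2 := intervalIntegrable_of_Icc (h.cont e)
  have : ∫ x in (0 : ℝ)..1, ρ e x * (u e x - a) =
      (∫ x in (0 : ℝ)..1, ρ e x * u e x) - (∫ x in (0 : ℝ)..1, ρ e x) * a := by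
    rw [← intervalIntegral.integral_mul_const, ← intervalIntegral.integral_sub i1 (i2.mul_const a)]
    simp only [mul_sub]
  rw [this]; ring

theorem pair_sub_const (h : IsData g ρ) (hu : ∀ e, ContinuousOn (u e) (Icc 0 1)) (v : E → ℝ → ℝ)
    (hv : ∀ e, ContinuousOn (v e) (Icc 0 1)) (a : ℝ) :
    pair g ρ (fun e x => u e x - a) v = pair g ρ u v - a * wmean g ρ v := by
  simp only [wmean, pair, Finset.mul_sum, ← Finset.sum_sub_distrib]
  refine Finset.sum_congr rfl fun e _ => ?_
  have i1 : IntervalIntegrable (fun x => ρ e x * u e x * v e x) volume 0 1 :=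
    intervalIntegrable_of_Icc (((h.cont e).mul (hu e)).mul (hv e))
  have i2 : IntervalIntegrable (fun x => ρ e x * v e x) volume 0 1 :=
    intervalIntegrable_of_Icc ((h.cont e).mul (hv e))
  have : ∫ x in (0 : ℝ)..1, ρ e x * (u e x - a) * v e x =
      (∫ x in (0 : ℝ)..1, ρ e x * u e x * v e x) - (∫ x in (0 : ℝ)..1, ρ e x * v e x) * a := by
    rw [← intervalIntegral.integral_mul_const, ← intervalIntegral.integral_sub i1 (i2.mul_const a)]
    congr 1; ext x; ring
  rw [this]; ring

theorem pair_comm (u v : E → ℝ → ℝ) : pair g ρ u v = pair g ρ v u := by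
  simp only [pair, mul_right_comm _ (u _ _)]

theorem pair_sub_const_self (h : IsData g ρ) (hu : ∀ e, ContinuousOn (u e) (Icc 0 1)) (a : ℝ) :
    pair g ρ (fun e x => u e x - a) (fun e x => u e x - a) =
      pair g ρ u u - 2 * a * wmean g ρ u + a ^ 2 * totalMass g ρ := by
  have hv : ∀ e, ContinuousOn (fun x => u e x - a) (Icc 0 1) :=
    fun e => (hu e).sub continuousOn_const
  rw [pair_sub_const h hu _ hv, pair_comm, pair_sub_const h hu _ hu, wmean_sub_const h hu]
  ring

omit [Fintype E] in
theorem IsTest.sub_const (hu : IsTest u δ c) (a : ℝ) :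
    IsTest (fun e x => u e x - a) δ (c - a) :=
  ⟨fun e => (hu.cont e).sub continuousOn_const, fun e x hx => (hu.deriv e x hx).sub_const a,
    hu.int, hu.sq, fun e => by rw [hu.left], fun e => by rw [hu.right]⟩

/-- The variational inequality without a constraint on the mean. -/
theorem IsFirst.le_of_test [Nonempty E] (hF : IsFirst g ρ lam) (h : IsData g ρ)
    (hu : IsTest u δ c) :
    lam * (pair g ρ u u - wmean g ρ u ^ 2 / totalMass g ρ) ≤ energy g δ δ := by
  have hM := totalMass_pos h
  set a := wmean g ρ u / totalMass g ρ with ha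
  have h1 := hF.le _ _ _ (hu.sub_const a) (by
    rw [wmean_sub_const h hu.cont, ha, div_mul_cancel₀ _ hM.ne', sub_self])
  rw [pair_sub_const_self h hu.cont] at h1
  have h2 : wmean g ρ u = a * totalMass g ρ := by rw [ha, div_mul_cancel₀ _ hM.ne']
  have h3 : wmean g ρ u ^ 2 / totalMass g ρ = a * wmean g ρ u := by rw [ha]; ring
  rw [h3]
  have h4 : pair g ρ u u - 2 * a * wmean g ρ u + a ^ 2 * totalMass g ρ =
      pair g ρ u u - a * wmean g ρ u := by rw [h2]; ring
  rwa [h4] at h1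

/-- Below the first eigenvalue there are only constant eigenfunctions. -/
theorem IsFirst.eq_const [Nonempty E] (hF : IsFirst g ρ lam) (h : IsData g ρ)
    (hf : IsEig g ρ μ f d c) (hμ : μ < lam) : ∀ e, ∀ x ∈ Icc (0 : ℝ) 1, f e x = c := by
  have hM := totalMass_pos h
  set a := wmean g ρ f / totalMass g ρ with ha
  have hm : wmean g ρ (fun e x => f e x - a) = 0 := by
    rw [wmean_sub_const h hf.cont, ha, div_mul_cancel₀ _ hM.ne', sub_self]
  have ht := hf.isTest.sub_const a
  have h1 := hF.le _ _ _ ht hm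
  -- Pairing f with the mean-zero function f - a does not see the constant a, so the energy is μ
  -- times the square norm of f - a. With μ below the minimum λ, this norm must vanish.
  have h2 := hf.energy_eq h ht
  have h3 := pair_sub_const h hf.cont _ ht.cont a
  rw [hm, mul_zero, sub_zero] at h3
  rw [← h3] at h2
  have hall : ∀ e, ∀ x ∈ Icc (0 : ℝ) 1, f e x = a := by
    intro e x hx
    by_contra hne
    have h4 := pair_self_pos h ht.cont hx (sub_ne_zero.2 hne)
    rw [h2] at h1
    nlinarith
  intro e x hx
  rw [hall e x hx, ← hall e 0 (by simp), hf.left]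

/-- Below λ all eigenfunctions are constant, negative μ included, so two independent ones do not
exist. At λ the constant 1 and a mean-zero eigenfunction are independent. The index k = 1 asks for k
+ 1 = 2 functions. -/
theorem IsFirst.eigenvalue_eq {V : Type*} {G : Multigraph V E} [Nonempty E] (hG : G.IsFlower)
    (hF : IsFirst g ρ lam) (h : IsData g ρ) : eigenvalue G 1 g ρ = lam := by
  have hlb : ∀ t, HasEigenvaluesUpTo G g ρ (1 + 1) t → lam ≤ t := by
    rintro t ⟨f, hlin, hf⟩
    by_contra hlt
    push Not at hlt
    have hc : ∀ i, ∃ c : ℝ, ∀ e, ∀ x ∈ Icc (0 : ℝ) 1, f i e x = c := by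
      intro i
      obtain ⟨μ, hμ, hm⟩ := hf i
      obtain ⟨c, hi⟩ := hm.isEig hG h.pos
      exact ⟨c, hF.eq_const h hi (hμ.trans_lt hlt)⟩
    choose c hc using hc
    have hon : ∀ i, onEdges (f i) = fun _ => c i := by
      intro i; ext p; exact hc i p.1 p.2 p.2.2
    have h0 : c 0 ≠ 0 := by
      intro h0
      apply hlin.ne_zero 0
      rw [hon, h0]; rfl
    -- Two constants c₀, c₁ satisfy the relation c₁·c₀ - c₀·c₁ = 0.
    have := Fintype.linearIndependent_iff.1 hlin ![c 1, -c 0] (by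
      rw [Fin.sum_univ_two]
      ext p
      simp [hon]
      ring) 1
    simp [h0] at this
  have hmem : HasEigenvaluesUpTo G g ρ (1 + 1) lam := by
    obtain ⟨f, d, c, hf, hff⟩ := hF.exists_eig
    have h1 : IsEig g ρ 0 (fun _ _ => 1) (fun _ _ => 0) 1 :=
      ⟨fun e x _ => hasDerivWithinAt_const _ _ _, fun e x _ => by
        simpa using hasDerivWithinAt_const x (Icc (0 : ℝ) 1) (0 : ℝ), fun _ => rfl, fun _ => rfl,
        by simp⟩
    refine ⟨![fun _ _ => 1, f], ?_, ?_⟩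
    · have hm := hf.mean_eq_zero h hF.pos.ne'
      rw [Fintype.linearIndependent_iff]
      intro w hw
      rw [Fin.sum_univ_two] at hw
      have hpt : ∀ e, ∀ x ∈ Icc (0 : ℝ) 1, w 0 + w 1 * f e x = 0 := by
        intro e x hx
        have := congrFun hw (e, ⟨x, hx⟩)
        simpa [onEdges] using this
      -- The pointwise relation is integrated against ρf; the mean of f is zero, so only the
      -- coefficient of f survives.
      have h2 : w 0 * wmean g ρ f + w 1 * pair g ρ f f = 0 := by
        rw [wmean, pair, Finset.mul_sum, Finset.mul_sum, ← Finset.sum_add_distrib]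
        refine Finset.sum_eq_zero fun e _ => ?_
        have i1 : IntervalIntegrable (fun x => ρ e x * f e x) volume 0 1 :=
          intervalIntegrable_of_Icc ((h.cont e).mul (hf.cont e))
        have i2 : IntervalIntegrable (fun x => ρ e x * f e x * f e x) volume 0 1 :=
          intervalIntegrable_of_Icc (((h.cont e).mul (hf.cont e)).mul (hf.cont e))
        rw [mul_left_comm, mul_left_comm (w 1), ← mul_add, ← intervalIntegral.integral_const_mul,
          ← intervalIntegral.integral_const_mul,
          ← intervalIntegral.integral_add (i1.const_mul _) (i2.const_mul _),
          integral_congr_Icc (h := fun _ => 0), intervalIntegral.integral_zero, mul_zero]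
        intro x hx
        have := hpt e x hx
        linear_combination (ρ e x * f e x) * this
      rw [hm, mul_zero, zero_add] at h2
      have h3 : w 1 = 0 := (mul_eq_zero.1 h2).resolve_right hff.ne'
      obtain ⟨e⟩ := ‹Nonempty E›
      have h4 := hpt e 0 (by simp)
      rw [h3, zero_mul, add_zero] at h4
      intro i
      fin_cases i
      · exact h4
      · exact h3
    · intro i
      fin_cases i
      · exact ⟨0, hF.pos.le, h1.memEigenspace hG h⟩
      · exact ⟨lam, le_rfl, hf.memEigenspace hG h⟩
  exact le_antisymm (csInf_le ⟨lam, fun t ht => hlb t ht⟩ hmem)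
    (le_csInf ⟨lam, hmem⟩ fun t ht => hlb t ht)

end

end QuantumGraph

/-! ### Densities concentrated at the vertex -/

namespace QuantumGraph

/-- The derivative of a test function controls its deviation from the value at the vertex. -/
theorem IsTest.sq_sub_le {E : Type*} {u δ : E → ℝ → ℝ} {c : ℝ} (h : IsTest u δ c) (e : E) {x : ℝ}
    (hx : x ∈ Icc (0 : ℝ) 1) : (u e x - c) ^ 2 ≤ x * ∫ t in (0 : ℝ)..1, δ e t * δ e t := by
  rcases hx.1.eq_or_lt with rfl | h0
  · rw [h.left]; simp
  have hsub : uIcc 0 x ⊆ uIcc (0 : ℝ) 1 := by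
    rw [uIcc_of_le hx.1, uIcc_of_le zero_le_one]; exact Icc_subset_Icc_right hx.2
  have i1 : IntervalIntegrable (δ e) volume 0 x := (h.int e).mono_set hsub
  have i2 : IntervalIntegrable (fun t => δ e t * δ e t) volume 0 x := (h.sq e).mono_set hsub
  have hy : ∫ t in (0 : ℝ)..x, δ e t = u e x - c := by
    rw [intervalIntegral.integral_eq_sub_of_hasDeriv_right_of_le hx.1
      ((h.cont e).mono (Icc_subset_Icc_right hx.2))
      (fun t ht => h.deriv e t ⟨ht.1, ht.2.trans_le hx.2⟩) i1, h.left]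
  set y := u e x - c with hyd
  -- Cauchy-Schwarz on [0, x], obtained by integrating the square of δ minus its average y/x.
  have h1 : 0 ≤ ∫ t in (0 : ℝ)..x, (δ e t * δ e t - (2 * y / x) * δ e t + (y / x) ^ 2) :=
    intervalIntegral.integral_nonneg hx.1 fun t _ => by
      have : δ e t * δ e t - (2 * y / x) * δ e t + (y / x) ^ 2 = (δ e t - y / x) ^ 2 := by ring
      rw [this]; positivity
  rw [intervalIntegral.integral_add (i2.sub (i1.const_mul _)) (by simp),
    intervalIntegral.integral_sub i2 (i1.const_mul _), intervalIntegral.integral_const_mul, hy,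
    intervalIntegral.integral_const, sub_zero, smul_eq_mul] at h1
  have h2 : ∫ t in (0 : ℝ)..x, δ e t * δ e t ≤ ∫ t in (0 : ℝ)..1, δ e t * δ e t :=
    intervalIntegral.integral_mono_interval le_rfl hx.1 hx.2
      (Eventually.of_forall fun _ => mul_self_nonneg _) (h.sq e)
  have h3 : x * ((∫ t in (0 : ℝ)..x, δ e t * δ e t) - 2 * y / x * y + x * (y / x) ^ 2) =
      x * (∫ t in (0 : ℝ)..x, δ e t * δ e t) - y ^ 2 := by field_simp; ring
  have h4 := mul_nonneg h0.le h1
  rw [h3] at h4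
  have h5 := mul_le_mul_of_nonneg_left h2 h0.le
  linarith

/-- A polynomial weight which concentrates at the initial point of an edge. -/
def bump (N : ℕ) (x : ℝ) : ℝ := (N + 1) * (1 - x) ^ N

theorem bump_contDiff (N : ℕ) : ContDiff ℝ ∞ (bump N) := by unfold bump; fun_prop

theorem bump_continuous (N : ℕ) : Continuous (bump N) := (bump_contDiff N).continuous

theorem bump_nonneg (N : ℕ) {x : ℝ} (hx : x ∈ Icc (0 : ℝ) 1) : 0 ≤ bump N x :=
  mul_nonneg (by positivity) (pow_nonneg (by linarith [hx.2]) _)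

theorem integral_bump (N : ℕ) : ∫ x in (0 : ℝ)..1, bump N x = 1 := by
  have h : ∀ x ∈ uIcc (0 : ℝ) 1, HasDerivAt (fun x : ℝ => -(1 - x) ^ (N + 1)) (bump N x) x := by
    intro x _
    refine ((((hasDerivAt_id x).const_sub 1).pow (N + 1)).neg).congr_deriv ?_
    simp [bump]
  rw [intervalIntegral.integral_eq_sub_of_hasDerivAt h ((bump_continuous N).intervalIntegrable _ _)]
  simp

theorem integral_bump_mul (N : ℕ) : ∫ x in (0 : ℝ)..1, bump N x * x = 1 / ((N : ℝ) + 2) := by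
  have hN : (N : ℝ) + 2 ≠ 0 := by positivity
  have h : ∀ x ∈ uIcc (0 : ℝ) 1, HasDerivAt (fun x : ℝ => -(x * (1 - x) ^ (N + 1)) -
      (1 - x) ^ (N + 2) / ((N : ℝ) + 2)) (bump N x * x) x := by
    intro x _
    have h1 := ((hasDerivAt_id x).const_sub 1).pow (N + 1)
    have h2 := ((hasDerivAt_id x).const_sub 1).pow (N + 2)
    refine ((((hasDerivAt_id x).mul h1).neg).sub (h2.div_const ((N : ℝ) + 2))).congr_deriv ?_
    simp only [bump, id, Nat.add_sub_cancel, Nat.cast_add, Nat.cast_one, Nat.cast_ofNat,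
      Pi.pow_apply]
    field_simp
    have : (1 - x) ^ (N + 2 - 1) = (1 - x) ^ N * (1 - x) := by
      rw [show N + 2 - 1 = N + 1 by omega, pow_succ]
    rw [this]
    ring
  rw [intervalIntegral.integral_eq_sub_of_hasDerivAt h
    (((bump_continuous N).mul continuous_id).intervalIntegrable _ _)]
  simp

section
variable {V E : Type*} [Fintype E] {G : Multigraph V E}

/-- Densities concentrated at the vertex have a large first eigenvalue. -/
theorem le_naturalEigenvalue_bump [Nonempty E] (hG : G.IsFlower) (N : ℕ) :
    IsMetricDensity (fun _ : E => (1 : ℝ)) (fun _ x => 1 / ((N : ℝ) + 2) + bump N x) ∧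
    ((N : ℝ) + 2) / 2 ≤ naturalEigenvalue G 1 (fun _ : E => (1 : ℝ))
      (fun _ x => 1 / ((N : ℝ) + 2) + bump N x) := by
  -- The added constant keeps the density positive where the bump vanishes. It equals the first
  -- moment of the bump, so the two parts contribute equally to the bound 2/(N + 2).
  set ρ : E → ℝ → ℝ := fun _ x => 1 / ((N : ℝ) + 2) + bump N x with hρ
  have hN : 0 < (N : ℝ) + 2 := by positivity
  have hmd : IsMetricDensity (fun _ : E => (1 : ℝ)) ρ :=
    ⟨fun _ => one_pos, fun _ => (contDiff_const.add (bump_contDiff N)).contDiffOn, fun _ x hx =>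
      add_pos_of_pos_of_nonneg (by positivity) (bump_nonneg N hx)⟩
  refine ⟨hmd, ?_⟩
  have hd := hmd.isData
  obtain ⟨lam, hF⟩ := exists_isFirst hd
  have hlam : ((N : ℝ) + 2) / 2 ≤ lam := by
    obtain ⟨f, d, c, hf, hff⟩ := hF.exists_eig
    have h1 := hf.energy_eq hd hf.isTest
    -- As f has mean zero, subtracting the vertex value c only increases its norm, while f - c is
    -- controlled by the energy.
    have h2 := pair_sub_const_self hd hf.cont c
    rw [hf.mean_eq_zero hd hF.pos.ne', mul_zero, sub_zero] at h2
    have h3 : pair (fun _ => 1) ρ (fun e x => f e x - c) (fun e x => f e x - c) ≤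
        2 / ((N : ℝ) + 2) * energy (fun _ => 1) d d := by
      simp only [pair, energy, Finset.mul_sum, Real.sqrt_one, one_mul, inv_one]
      refine Finset.sum_le_sum fun e _ => ?_
      set D := ∫ t in (0 : ℝ)..1, d e t * d e t with hD
      have hD0 : 0 ≤ D := integral_nonneg_Icc fun _ _ => mul_self_nonneg _
      have hfc : ContinuousOn (fun x => f e x - c) (Icc 0 1) :=
        (hf.cont e).sub continuousOn_const
      have hb : IntervalIntegrable (fun x => bump N x * x) volume 0 1 :=
        ((bump_continuous N).mul continuous_id).intervalIntegrable _ _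
      calc ∫ x in (0 : ℝ)..1, ρ e x * (f e x - c) * (f e x - c)
          ≤ ∫ x in (0 : ℝ)..1, (1 / ((N : ℝ) + 2) * D + bump N x * x * D) := by
            refine integral_mono_Icc (intervalIntegrable_of_Icc (((hd.cont e).mul hfc).mul hfc))
              ((Continuous.intervalIntegrable (by fun_prop) _ _).add (hb.mul_const D)) fun x hx => ?_
            have h4 := hf.isTest.sq_sub_le e hx
            have h5 := mul_le_mul_of_nonneg_left h4 (hd.dens e x hx).le
            have h6 : 1 / ((N : ℝ) + 2) * (x * D) ≤ 1 / ((N : ℝ) + 2) * D := by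
              have : x * D ≤ D := by nlinarith [hx.2]
              gcongr
            have h7 : ρ e x * (x * D) = 1 / ((N : ℝ) + 2) * (x * D) + bump N x * x * D := by
              rw [hρ]; ring
            rw [h7] at h5
            linarith [show ρ e x * (f e x - c) * (f e x - c) = ρ e x * (f e x - c) ^ 2 by ring]
        _ = 2 / ((N : ℝ) + 2) * D := by
            rw [intervalIntegral.integral_add (by simp) (hb.mul_const D),
              intervalIntegral.integral_mul_const D (fun x => bump N x * x), integral_bump_mul]
            simp; ring
    have h4 : 0 ≤ c ^ 2 * totalMass (fun _ => 1) ρ := by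
      have := totalMass_pos hd
      positivity
    rw [h1] at h3
    have h5 : pair (fun _ => 1) ρ f f ≤ 2 / ((N : ℝ) + 2) * (lam * pair (fun _ => 1) ρ f f) := by
      linarith
    have h6 : 1 ≤ 2 / ((N : ℝ) + 2) * lam := by
      by_contra hcon
      push Not at hcon
      nlinarith
    rw [div_mul_eq_mul_div, le_div_iff₀ hN] at h6
    linarith
  rw [naturalEigenvalue, hF.eigenvalue_eq hG hd]
  have hcard : (1 : ℝ) ≤ Fintype.card E := by exact_mod_cast Fintype.card_pos
  have hL : 1 ≤ totalLength (fun _ : E => (1 : ℝ)) := by simpa [totalLength] using hcard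
  have hM : 1 ≤ totalMass (fun _ : E => (1 : ℝ)) ρ := by
    have hi : ∫ x in (0 : ℝ)..1, (1 / ((N : ℝ) + 2) + bump N x) = 1 / ((N : ℝ) + 2) + 1 := by
      rw [intervalIntegral.integral_add (by simp) ((bump_continuous N).intervalIntegrable _ _),
        integral_bump]
      simp
    have hε : 0 < 1 / ((N : ℝ) + 2) := by positivity
    simp only [totalMass, hρ, hi, Real.sqrt_one, one_mul, Finset.sum_const, Finset.card_univ,
      nsmul_eq_mul]
    nlinarith
  have hlam0 : 0 < lam := hF.pos
  calc ((N : ℝ) + 2) / 2 ≤ lam * 1 * 1 := by linarith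
    _ ≤ lam * totalLength (fun _ : E => (1 : ℝ)) * totalMass (fun _ : E => (1 : ℝ)) ρ := by
      gcongr

theorem not_isMaximiser_natural [Nonempty E] (hG : G.IsFlower) (g : E → ℝ) (ρ : E → ℝ → ℝ) :
    ¬ IsMaximiser (naturalEigenvalue G 1) g ρ := by
  rintro ⟨_, hmax⟩
  obtain ⟨N, hN⟩ := exists_nat_gt (2 * naturalEigenvalue G 1 g ρ)
  obtain ⟨h1, h2⟩ := le_naturalEigenvalue_bump (E := E) hG N
  have := hmax _ _ h1
  linarith

/-! ### Regular metrics -/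

/-- On a regular flower with at least two loops, `λ₁ g ≤ π²`. -/
theorem IsFirst.mul_le_pi_sq (hE : 2 ≤ Fintype.card E) {a lam : ℝ} (ha : 0 < a)
    (hF : IsFirst (fun _ : E => a) (fun _ _ => 1) lam) : lam * a ≤ Real.pi ^ 2 := by
  classical
  obtain ⟨e₁, e₂, hne⟩ := Fintype.exists_pair_of_one_lt_card (α := E) (by omega)
  set s : E → ℝ := fun e => if e = e₁ then 1 else if e = e₂ then -1 else 0 with hs
  have hsum : ∑ e, s e = 0 := by
    have : ∀ e, s e = (if e = e₁ then 1 else 0) + (if e = e₂ then -1 else 0) := by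
      intro e
      by_cases h1 : e = e₁
      · simp [hs, h1, hne]
      · simp [hs, h1]
    simp [this, Finset.sum_add_distrib]
  have hsq : 0 < ∑ e, s e ^ 2 :=
    Finset.sum_pos' (fun e _ => sq_nonneg _) ⟨e₁, Finset.mem_univ _, by simp [hs]⟩
  have hr : 0 < Real.sqrt a := Real.sqrt_pos.2 ha
  set A := ∫ x in (0 : ℝ)..1, Real.sin (Real.pi * x) ^ 2 with hA
  have hi1 : IntervalIntegrable (fun x => Real.sin (Real.pi * x) ^ 2) volume 0 1 :=
    Continuous.intervalIntegrable (by fun_prop) _ _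
  have hi2 : IntervalIntegrable (fun x => Real.cos (Real.pi * x) ^ 2) volume 0 1 :=
    Continuous.intervalIntegrable (by fun_prop) _ _
  have hlin : ∀ x : ℝ, HasDerivAt (fun x : ℝ => Real.pi * x) Real.pi x := fun x => by
    simpa using (hasDerivAt_id x).const_mul Real.pi
  -- cos² - sin² is up to the factor π the derivative of sin·cos, which vanishes at both ends. The
  -- common value A cancels from the Rayleigh quotient.
  have hcos : ∫ x in (0 : ℝ)..1, Real.cos (Real.pi * x) ^ 2 = A := by
    have h1 : ∫ x in (0 : ℝ)..1, (Real.cos (Real.pi * x) ^ 2 - Real.sin (Real.pi * x) ^ 2) * Real.pi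
        = 0 := by
      rw [intervalIntegral.integral_eq_sub_of_hasDerivAt
        (f := fun x => Real.sin (Real.pi * x) * Real.cos (Real.pi * x)) (fun x _ => ?_)
        (Continuous.intervalIntegrable (by fun_prop) _ _)]
      · simp
      · exact ((hlin x).sin.mul (hlin x).cos).congr_deriv (by ring)
    rw [intervalIntegral.integral_mul_const, intervalIntegral.integral_sub hi2 hi1] at h1
    have := (mul_eq_zero.1 h1).resolve_right Real.pi_pos.ne'
    linarith
  have hApos : 0 < A := by
    refine intervalIntegral.integral_pos zero_lt_one (by fun_prop) (fun x _ => sq_nonneg _)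
      ⟨1 / 2, by norm_num, ?_⟩
    rw [show Real.pi * (1 / 2) = Real.pi / 2 by ring]
    simp
  have ht : IsTest (fun e x => s e * Real.sin (Real.pi * x))
      (fun e x => s e * (Real.cos (Real.pi * x) * Real.pi)) 0 := by
    refine ⟨fun e => by fun_prop, fun e x _ => ?_, fun e => ?_, fun e => ?_, fun e => by simp,
      fun e => by simp⟩
    · exact ((hlin x).sin.const_mul _).hasDerivWithinAt
    · exact Continuous.intervalIntegrable (by fun_prop) _ _
    · exact Continuous.intervalIntegrable (by fun_prop) _ _
  have h := hF.le _ _ _ ht (by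
    simp only [wmean, one_mul, intervalIntegral.integral_const_mul]
    rw [← Finset.mul_sum, ← Finset.sum_mul, hsum]; simp)
  have e1 : pair (fun _ : E => a) (fun _ _ => 1) (fun e x => s e * Real.sin (Real.pi * x))
      (fun e x => s e * Real.sin (Real.pi * x)) = Real.sqrt a * A * ∑ e, s e ^ 2 := by
    rw [pair, Finset.mul_sum]
    refine Finset.sum_congr rfl fun e _ => ?_
    rw [hA]
    simp only [← intervalIntegral.integral_const_mul, ← intervalIntegral.integral_mul_const]
    exact integral_congr_Icc fun x _ => by ring
  have e2 : energy (fun _ : E => a) (fun e x => s e * (Real.cos (Real.pi * x) * Real.pi))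
      (fun e x => s e * (Real.cos (Real.pi * x) * Real.pi)) =
      (Real.sqrt a)⁻¹ * A * Real.pi ^ 2 * ∑ e, s e ^ 2 := by
    rw [energy, Finset.mul_sum]
    refine Finset.sum_congr rfl fun e _ => ?_
    rw [← hcos]
    simp only [← intervalIntegral.integral_const_mul, ← intervalIntegral.integral_mul_const]
    exact integral_congr_Icc fun x _ => by ring
  rw [e1, e2] at h
  have h2 : lam * Real.sqrt a ≤ (Real.sqrt a)⁻¹ * Real.pi ^ 2 := by
    have : lam * Real.sqrt a * (A * ∑ e, s e ^ 2) ≤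
        (Real.sqrt a)⁻¹ * Real.pi ^ 2 * (A * ∑ e, s e ^ 2) := by linarith
    exact le_of_mul_le_mul_right this (mul_pos hApos hsq)
  have h3 := mul_le_mul_of_nonneg_right h2 hr.le
  rw [mul_assoc, Real.mul_self_sqrt ha.le] at h3
  calc lam * a ≤ _ := h3
    _ = _ := by field_simp

/-- Eigenfunctions of a regular flower with `0 < μ g ≤ π²` vanish at the vertex. -/
theorem IsEig.vertex_eq_zero [Nonempty E] {a μ c : ℝ} {f d : E → ℝ → ℝ} (ha : 0 < a)
    (hf : IsEig (fun _ : E => a) (fun _ _ => 1) μ f d c) (hμ : 0 < μ)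
    (hle : μ * a ≤ Real.pi ^ 2) : c = 0 := by
  set k := Real.sqrt (μ * a) with hk
  have hk2 : k * k = μ * a := Real.mul_self_sqrt (by positivity)
  have hk0 : 0 < k := Real.sqrt_pos.2 (by positivity)
  have hkpi : k ≤ Real.pi := by
    rw [hk, Real.sqrt_le_left Real.pi_pos.le]; exact hle
  -- The Wronskian of f with cos(k(x - 1/2)) is constant; its values at the two ends are compared.
  -- Summing over the loops, the Kirchhoff condition removes the first term, and sin(k/2) > 0
  -- because 0 < k ≤ π.
  have hW : ∀ e, (d e 1 - d e 0) * Real.cos (k / 2) + 2 * c * k * Real.sin (k / 2) = 0 := by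
    intro e
    have hder : ∀ x ∈ Icc (0 : ℝ) 1, HasDerivWithinAt
        (fun x => d e x * Real.cos (k * (x - 1 / 2)) + f e x * (k * Real.sin (k * (x - 1 / 2))))
        0 (Icc 0 1) x := by
      intro x hx
      have hl : HasDerivAt (fun x : ℝ => k * (x - 1 / 2)) k x := by
        simpa only [mul_one] using ((hasDerivAt_id' x).sub_const (1 / 2 : ℝ)).const_mul k
      refine (((hf.deriv₂ e x hx).mul hl.cos.hasDerivWithinAt).add
        ((hf.deriv e x hx).mul (hl.sin.const_mul k).hasDerivWithinAt)).congr_deriv ?_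
      linear_combination (f e x * Real.cos (k * (x - 1 / 2))) * hk2
    have := Convex.norm_image_sub_le_of_norm_hasDerivWithin_le hder (C := 0) (by simp)
      (convex_Icc 0 1) (x := 0) (y := 1) (by simp) (by simp)
    simp only [zero_mul, norm_le_zero_iff] at this
    rw [hf.left, hf.right, show k * (1 - 1 / 2) = k / 2 by ring,
      show k * (0 - 1 / 2) = -(k / 2) by ring, Real.cos_neg, Real.sin_neg] at this
    linarith
  have h1 := Finset.sum_congr rfl fun e (_ : e ∈ Finset.univ) => hW e
  have hr : (Real.sqrt a)⁻¹ ≠ 0 := inv_ne_zero (Real.sqrt_pos.2 ha).ne'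
  have h2 := hf.kirchhoff
  rw [← Finset.mul_sum] at h2
  have h3 := (mul_eq_zero.1 h2).resolve_left hr
  rw [Finset.sum_add_distrib, ← Finset.sum_mul, h3] at h1
  have hsin : 0 < Real.sin (k / 2) :=
    Real.sin_pos_of_pos_of_lt_pi (by positivity) (by linarith [Real.pi_pos])
  have hcard : (Fintype.card E : ℝ) ≠ 0 := by exact_mod_cast Fintype.card_ne_zero
  simpa [hk0.ne', hsin.ne', hcard] using h1

/-- All coordinate functions vanish at the vertex, so F sends it to the centre of the sphere,
contradicting R > 0. -/
theorem not_isometricMinimalImmersion (hG : G.IsFlower) (hE : 2 ≤ Fintype.card E) {g : E → ℝ}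
    (hg : IsRegularMetric g) {n : ℕ} {R : ℝ} {F : E → ℝ → EuclideanSpace ℝ (Fin n)} (hR : 0 < R)
    (hF : IsIsometricMinimalImmersion G g n R F)
    (hmem : ∀ i : Fin n, MemEigenspace G g (fun _ _ => 1) (eigenvalue G 1 g (fun _ _ => 1))
      (fun e x => F e x i)) : False := by
  have : Nonempty E := Fintype.card_pos_iff.1 (by omega)
  obtain ⟨a, ha, hga⟩ := hg
  obtain rfl : g = fun _ => a := funext hga
  have hd : IsData (fun _ : E => a) (fun _ _ => 1) :=
    ⟨fun _ => ha, fun _ => continuousOn_const, fun _ _ _ => one_pos⟩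
  obtain ⟨lam, hlam⟩ := exists_isFirst hd
  rw [hlam.eigenvalue_eq hG hd] at hmem
  have e : E := Classical.arbitrary E
  have h0 : F e 0 = 0 := by
    ext i
    obtain ⟨c, hc⟩ := (hmem i).isEig hG hd.pos
    have h1 := hc.left e
    rw [hc.vertex_eq_zero ha hlam.pos (hlam.mul_le_pi_sq hE ha)] at h1
    simpa using h1
  have h1 := hF.mem_sphere e 0 (by simp)
  rw [h0] at h1
  simp only [mem_sphere_iff_norm, sub_zero, norm_zero] at h1
  linarith

end

end QuantumGraph

namespace QuantumGraph

/-! ### Perturbation of the density -/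

/-- A function whose one-sided difference quotients at `0` both have the same strict sign admits
no one-sided first-order bound. -/
theorem not_first_order_bound {φ : ℝ → ℝ} {A S s η C C' : ℝ} (hA : 0 < A) (h : η * S < s)
    (hpos : ∀ᶠ t in 𝓝[>] (0 : ℝ), A * ((1 - η * t - C * t ^ 2) * (S + t * s)) ≤ φ t)
    (hneg : ∀ᶠ t in 𝓝[<] (0 : ℝ), φ t * (1 + t * η - C' * t ^ 2) ≤ A * (S + t * s)) :
    ¬ ((∃ r : ℝ → ℝ, r =o[𝓝 0] (fun t => t) ∧ ∀ᶠ t in 𝓝 0, φ t ≤ A * S + r t) ∨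
      (∃ r : ℝ → ℝ, r =o[𝓝 0] (fun t => t) ∧ ∀ᶠ t in 𝓝 0, A * S + r t ≤ φ t)) := by
  have hid : ∀ l ≤ 𝓝 (0 : ℝ), Tendsto (fun t : ℝ => t) l (𝓝 0) := fun l hl => hl
  rintro (⟨r, hr, hle⟩ | ⟨r, hr, hle⟩)
  · have h1 : Tendsto (fun t => r t / t) (𝓝[>] 0) (𝓝 0) :=
      hr.tendsto_div_nhds_zero.mono_left nhdsWithin_le_nhds
    have ht := hid (𝓝[>] 0) nhdsWithin_le_nhds
    -- The right difference quotient of the lower bound; its limit A(s - ηS) is positive, whereas an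
    -- upper bound by o(t) would make it nonpositive.
    have h2 : Tendsto (fun t : ℝ => A * (s - η * S + t * (-(C * S) - η * s - C * s * t)))
        (𝓝[>] 0) (𝓝 (A * (s - η * S + 0 * (-(C * S) - η * s - C * s * 0)))) :=
      ((ht.mul ((ht.const_mul (C * s)).const_sub (-(C * S) - η * s))).const_add _).const_mul A
    have h3 := le_of_tendsto_of_tendsto h2 h1 (by
      filter_upwards [hpos, nhdsWithin_le_nhds hle, self_mem_nhdsWithin] with t h4 h5 h6
      have h6' : 0 < t := h6
      rw [le_div_iff₀ h6']
      nlinarith)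
    nlinarith
  · have h1 : Tendsto (fun t => r t / t) (𝓝[<] 0) (𝓝 0) :=
      hr.tendsto_div_nhds_zero.mono_left nhdsWithin_le_nhds
    have ht := hid (𝓝[<] 0) nhdsWithin_le_nhds
    have h7 : Tendsto (fun t : ℝ => 1 + t * η - C' * t ^ 2) (𝓝[<] 0)
        (𝓝 (1 + 0 * η - C' * 0 ^ 2)) :=
      ((ht.mul_const η).const_add 1).sub ((ht.pow 2).const_mul C')
    -- On the left the factor 1 + tη - C't² stays on the side of φ, avoiding a quotient. Dividing by
    -- t < 0 reverses the inequality and would give A(Sη - s) ≥ 0.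
    have h2 : Tendsto (fun t : ℝ => A * (S * η - S * C' * t - s) +
        r t / t * (1 + t * η - C' * t ^ 2)) (𝓝[<] 0)
        (𝓝 (A * (S * η - S * C' * 0 - s) + 0 * (1 + 0 * η - C' * 0 ^ 2))) :=
      ((((ht.const_mul (S * C')).const_sub (S * η)).sub_const s).const_mul A).add (h1.mul h7)
    have h8 : ∀ᶠ t in 𝓝[<] (0 : ℝ), 0 < 1 + t * η - C' * t ^ 2 :=
      h7.eventually (lt_mem_nhds (by norm_num))
    have h3 := ge_of_tendsto h2 (b := 0) (by
      filter_upwards [hneg, nhdsWithin_le_nhds hle, self_mem_nhdsWithin, h8] with t h4 h5 h6 h8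
      have h6' : t < 0 := h6
      have h9 := mul_le_mul_of_nonneg_right h5 h8.le
      have h10 : (A * (S * η - S * C' * t - s) + r t / t * (1 + t * η - C' * t ^ 2)) * t =
          A * (S * η - S * C' * t - s) * t + r t * (1 + t * η - C' * t ^ 2) := by
        have := h6'.ne
        field_simp
      have h11 : (A * (S * η - S * C' * t - s) + r t / t * (1 + t * η - C' * t ^ 2)) * t ≤ 0 := by
        rw [h10]; nlinarith
      by_contra hcon
      push Not at hcon
      nlinarith [mul_pos_of_neg_of_neg hcon h6'])
    nlinarith

section
variable {E : Type*} [Fintype E] {g : E → ℝ} {ρ σ u v f d : E → ℝ → ℝ} {c lam K t : ℝ}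

/-- The linear perturbation of the density `ρ` in the direction `σ`. -/
def perturb (ρ σ : E → ℝ → ℝ) (t : ℝ) (e : E) (x : ℝ) : ℝ := ρ e x + t * σ e x

omit [Fintype E] in
theorem perturb_zero : perturb ρ σ 0 = ρ := by
  funext e x; simp [perturb]

/-- The perturbation direction is dominated by the density. -/
def Dominated (ρ σ : E → ℝ → ℝ) (K : ℝ) : Prop :=
  ∀ e, ∀ x ∈ Icc (0 : ℝ) 1, |σ e x| ≤ K * ρ e x

theorem exists_dominated (h : IsData g ρ) (hσ : ∀ e, ContinuousOn (σ e) (Icc 0 1)) :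
    ∃ K, 0 < K ∧ Dominated ρ σ K := by
  have : ∀ e, ∃ k, 0 ≤ k ∧ ∀ x ∈ Icc (0 : ℝ) 1, |σ e x| ≤ k * ρ e x := by
    intro e
    obtain ⟨k, hk⟩ := isCompact_Icc.exists_bound_of_continuousOn
      ((hσ e).div (h.cont e) fun x hx => (h.dens e x hx).ne')
    refine ⟨k, (norm_nonneg _).trans (hk 0 (by simp)), fun x hx => ?_⟩
    have h1 := hk x hx
    rw [Pi.div_apply, Real.norm_eq_abs, abs_div, abs_of_pos (h.dens e x hx),
      div_le_iff₀ (h.dens e x hx)] at h1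
    exact h1
  choose k hk0 hk using this
  refine ⟨∑ e, k e + 1, by have := Finset.sum_nonneg fun e (_ : e ∈ Finset.univ) => hk0 e; linarith,
    fun e x hx => (hk e x hx).trans ?_⟩
  have h1 := Finset.single_le_sum (f := k) (fun e _ => hk0 e) (Finset.mem_univ e)
  exact mul_le_mul_of_nonneg_right (by linarith) (h.dens e x hx).le

omit [Fintype E] in
theorem Dominated.half_le (hK : Dominated ρ σ K) (h : IsData g ρ) (ht : |t| * K ≤ 1 / 2) (e : E)
    {x : ℝ} (hx : x ∈ Icc (0 : ℝ) 1) : 1 / 2 * ρ e x ≤ perturb ρ σ t e x := by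
  have h1 := mul_le_mul_of_nonneg_left (hK e x hx) (abs_nonneg t)
  rw [← abs_mul] at h1
  have h2 := mul_le_mul_of_nonneg_right ht (h.dens e x hx).le
  have := neg_abs_le (t * σ e x)
  simp only [perturb]
  linarith

omit [Fintype E] in
theorem Dominated.le_two (hK : Dominated ρ σ K) (h : IsData g ρ) (ht : |t| * K ≤ 1 / 2) (e : E)
    {x : ℝ} (hx : x ∈ Icc (0 : ℝ) 1) : perturb ρ σ t e x ≤ 2 * ρ e x := by
  have h1 := mul_le_mul_of_nonneg_left (hK e x hx) (abs_nonneg t)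
  rw [← abs_mul] at h1
  have h2 := mul_le_mul_of_nonneg_right ht (h.dens e x hx).le
  have := le_abs_self (t * σ e x)
  have := h.dens e x hx
  simp only [perturb]
  linarith

omit [Fintype E] in
theorem Dominated.isData (hK : Dominated ρ σ K) (h : IsData g ρ)
    (hσ : ∀ e, ContinuousOn (σ e) (Icc 0 1)) (ht : |t| * K ≤ 1 / 2) :
    IsData g (perturb ρ σ t) :=
  ⟨h.pos, fun e => (h.cont e).add (continuousOn_const.mul (hσ e)), fun e x hx => by
    have := hK.half_le h ht e hx
    have := h.dens e x hx
    linarith⟩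

theorem pair_perturb (h : IsData g ρ) (hσ : ∀ e, ContinuousOn (σ e) (Icc 0 1))
    (hu : ∀ e, ContinuousOn (u e) (Icc 0 1)) (hv : ∀ e, ContinuousOn (v e) (Icc 0 1)) (t : ℝ) :
    pair g (perturb ρ σ t) u v = pair g ρ u v + t * pair g σ u v := by
  simp only [pair, Finset.mul_sum, ← Finset.sum_add_distrib]
  refine Finset.sum_congr rfl fun e _ => ?_
  have i1 : IntervalIntegrable (fun x => ρ e x * u e x * v e x) volume 0 1 :=
    intervalIntegrable_of_Icc (((h.cont e).mul (hu e)).mul (hv e))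
  have i2 : IntervalIntegrable (fun x => σ e x * u e x * v e x) volume 0 1 :=
    intervalIntegrable_of_Icc (((hσ e).mul (hu e)).mul (hv e))
  rw [mul_left_comm t, ← intervalIntegral.integral_const_mul (r := t), ← mul_add,
    ← intervalIntegral.integral_add i1 (i2.const_mul t)]
  refine congrArg _ (integral_congr_Icc fun x _ => ?_)
  simp only [perturb]; ring

theorem wmean_perturb (h : IsData g ρ) (hσ : ∀ e, ContinuousOn (σ e) (Icc 0 1))
    (hu : ∀ e, ContinuousOn (u e) (Icc 0 1)) (t : ℝ) :
    wmean g (perturb ρ σ t) u = wmean g ρ u + t * wmean g σ u := by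
  have := pair_perturb h hσ hu (fun _ => continuousOn_const (c := (1 : ℝ))) t
  simpa only [pair, wmean, mul_one] using this

omit [Fintype E] in
theorem integral_perturb (h : IsData g ρ) (hσ : ∀ e, ContinuousOn (σ e) (Icc 0 1)) (t : ℝ) (e : E) :
    ∫ x in (0 : ℝ)..1, perturb ρ σ t e x =
      (∫ x in (0 : ℝ)..1, ρ e x) + t * ∫ x in (0 : ℝ)..1, σ e x := by
  rw [← intervalIntegral.integral_const_mul, ← intervalIntegral.integral_add
    (intervalIntegrable_of_Icc (h.cont e)) ((intervalIntegrable_of_Icc (hσ e)).const_mul t)]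
  rfl

theorem Dominated.totalMass_le (hK : Dominated ρ σ K) (h : IsData g ρ)
    (hσ : ∀ e, ContinuousOn (σ e) (Icc 0 1)) (ht : |t| * K ≤ 1 / 2) :
    1 / 2 * totalMass g ρ ≤ totalMass g (perturb ρ σ t) ∧
      totalMass g (perturb ρ σ t) ≤ 2 * totalMass g ρ := by
  have hi := fun e => intervalIntegrable_of_Icc (h.cont e)
  have hi' := fun e => intervalIntegrable_of_Icc ((hK.isData h hσ ht).cont e)
  simp only [totalMass, Finset.mul_sum, mul_left_comm _ (Real.sqrt _),
    ← intervalIntegral.integral_const_mul (r := (1 / 2 : ℝ)),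
    ← intervalIntegral.integral_const_mul (r := (2 : ℝ))]
  constructor
  · exact Finset.sum_le_sum fun e _ => mul_le_mul_of_nonneg_left (integral_mono_Icc
      ((hi e).const_mul _) (hi' e) fun x hx => hK.half_le h ht e hx) (Real.sqrt_nonneg _)
  · exact Finset.sum_le_sum fun e _ => mul_le_mul_of_nonneg_left (integral_mono_Icc
      (hi' e) ((hi e).const_mul _) fun x hx => hK.le_two h ht e hx) (Real.sqrt_nonneg _)

theorem Dominated.pair_le (hK : Dominated ρ σ K) (h : IsData g ρ)
    (hσ : ∀ e, ContinuousOn (σ e) (Icc 0 1)) (ht : |t| * K ≤ 1 / 2)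
    (hu : ∀ e, ContinuousOn (u e) (Icc 0 1)) :
    1 / 2 * pair g ρ u u ≤ pair g (perturb ρ σ t) u u ∧
      pair g (perturb ρ σ t) u u ≤ 2 * pair g ρ u u := by
  have hi : ∀ e, IntervalIntegrable (fun x => ρ e x * u e x * u e x) volume 0 1 :=
    fun e => intervalIntegrable_of_Icc (((h.cont e).mul (hu e)).mul (hu e))
  have hi' : ∀ e, IntervalIntegrable (fun x => perturb ρ σ t e x * u e x * u e x) volume 0 1 :=
    fun e => intervalIntegrable_of_Icc ((((hK.isData h hσ ht).cont e).mul (hu e)).mul (hu e))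
  simp only [pair, Finset.mul_sum, mul_left_comm _ (Real.sqrt _),
    ← intervalIntegral.integral_const_mul (r := (1 / 2 : ℝ)),
    ← intervalIntegral.integral_const_mul (r := (2 : ℝ))]
  constructor
  · exact Finset.sum_le_sum fun e _ => mul_le_mul_of_nonneg_left (integral_mono_Icc
      ((hi e).const_mul _) (hi' e) fun x hx => by
        nlinarith [hK.half_le h ht e hx, mul_self_nonneg (u e x)]) (Real.sqrt_nonneg _)
  · exact Finset.sum_le_sum fun e _ => mul_le_mul_of_nonneg_left (integral_mono_Icc
      (hi' e) ((hi e).const_mul _) fun x hx => by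
        nlinarith [hK.le_two h ht e hx, mul_self_nonneg (u e x)]) (Real.sqrt_nonneg _)

/-- The Cauchy-Schwarz inequality for the mean in a dominated direction. -/
theorem Dominated.wmean_sq_le [Nonempty E] (hK : Dominated ρ σ K) (h : IsData g ρ)
    (hσ : ∀ e, ContinuousOn (σ e) (Icc 0 1)) (hu : ∀ e, ContinuousOn (u e) (Icc 0 1)) :
    wmean g σ u ^ 2 ≤ K ^ 2 * (totalMass g ρ * pair g ρ u u) := by
  have hM := totalMass_pos h
  have hua : ∀ e, ContinuousOn (fun x => |u e x|) (Icc 0 1) := fun e => (hu e).abs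
  -- Cauchy-Schwarz for |u| against the constant 1, read off from the nonnegative norm of |u| minus
  -- its mean.
  have h1 := pair_sub_const_self h hua (wmean g ρ (fun e x => |u e x|) / totalMass g ρ)
  have h2 := pair_self_nonneg h
    (fun e x => |u e x| - wmean g ρ (fun e x => |u e x|) / totalMass g ρ)
  have h3 : pair g ρ (fun e x => |u e x|) (fun e x => |u e x|) = pair g ρ u u := by
    simp only [pair, mul_assoc, abs_mul_abs_self]
  set m := wmean g ρ (fun e x => |u e x|) with hm
  rw [h1, h3] at h2
  have h4 : m ^ 2 ≤ totalMass g ρ * pair g ρ u u := by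
    have h5 := mul_nonneg hM.le h2
    have h6 : totalMass g ρ * (pair g ρ u u - 2 * (m / totalMass g ρ) * m +
        (m / totalMass g ρ) ^ 2 * totalMass g ρ) = totalMass g ρ * pair g ρ u u - m ^ 2 := by
      field_simp; ring
    linarith
  have h5 : |wmean g σ u| ≤ K * m := by
    rw [hm, wmean, wmean, Finset.mul_sum]
    refine (Finset.abs_sum_le_sum_abs _ _).trans (Finset.sum_le_sum fun e _ => ?_)
    rw [abs_mul, abs_of_nonneg (Real.sqrt_nonneg _), mul_left_comm]
    refine mul_le_mul_of_nonneg_left ?_ (Real.sqrt_nonneg _)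
    rw [← intervalIntegral.integral_const_mul]
    refine (intervalIntegral.abs_integral_le_integral_abs zero_le_one).trans ?_
    refine integral_mono_Icc (intervalIntegrable_of_Icc ((hσ e).mul (hu e)).abs)
      (intervalIntegrable_of_Icc (continuousOn_const.mul ((h.cont e).mul (hua e)))) fun x hx => ?_
    rw [abs_mul, ← mul_assoc]
    exact mul_le_mul_of_nonneg_right (hK e x hx) (abs_nonneg _)
  calc wmean g σ u ^ 2 = |wmean g σ u| ^ 2 := (sq_abs _).symm
    _ ≤ (K * m) ^ 2 := pow_le_pow_left₀ (abs_nonneg _) h5 2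
    _ = K ^ 2 * m ^ 2 := by ring
    _ ≤ _ := by gcongr

/-- Comparison of the first eigenvalues of comparable densities. -/
theorem IsFirst.le_of_pair_le [Nonempty E] {ρ' : E → ℝ → ℝ} {lam' k : ℝ} (hF : IsFirst g ρ lam)
    (hF' : IsFirst g ρ' lam') (h : IsData g ρ) (h' : IsData g ρ')
    (hp : ∀ u, (∀ e, ContinuousOn (u e) (Icc 0 1)) → pair g ρ u u ≤ k * pair g ρ' u u) :
    lam' ≤ k * lam := by
  obtain ⟨f, d, c, hf, hff⟩ := hF.exists_eig
  have hM' := totalMass_pos h'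
  -- The eigenfunction for ρ is recentred for ρ'. Its energy is unchanged and its ρ-norm only grows,
  -- since its ρ-mean is zero.
  set a := wmean g ρ' f / totalMass g ρ' with ha
  have ht := hf.isTest.sub_const a
  have h1 := hF'.le _ _ _ ht (by
    rw [wmean_sub_const h' hf.cont, ha, div_mul_cancel₀ _ hM'.ne', sub_self])
  rw [hf.energy_eq h hf.isTest] at h1
  have h2 := hp _ ht.cont
  have h3 := pair_sub_const_self h hf.cont a
  rw [hf.mean_eq_zero h hF.pos.ne'] at h3
  have h4 : 0 ≤ a ^ 2 * totalMass g ρ := mul_nonneg (sq_nonneg _) (totalMass_pos h).le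
  have h5 : pair g ρ f f ≤ k * pair g ρ' (fun e x => f e x - a) (fun e x => f e x - a) := by
    linarith
  set N' := pair g ρ' (fun e x => f e x - a) (fun e x => f e x - a) with hN'
  have hN'0 : 0 ≤ N' := pair_self_nonneg h' _
  have hN'pos : 0 < N' := by
    rcases hN'0.eq_or_lt with h0 | h0
    · rw [← h0, mul_zero] at h5; linarith
    · exact h0
  have h6 := mul_le_mul_of_nonneg_left h5 hF.pos.le
  have h7 : lam' * N' ≤ k * lam * N' := by linarith
  exact le_of_mul_le_mul_right h7 hN'pos

omit [Fintype E] in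
theorem perturb_isSmoothFamily (h : IsMetricDensity g ρ) (hσ : ∀ e, ContDiff ℝ ∞ (σ e))
    (hK0 : 0 < K) (hK : Dominated ρ σ K) :
    IsSmoothFamilyThrough g ρ (1 / (2 * K)) (fun _ => g) (perturb ρ σ) := by
  refine ⟨by positivity, fun t ht => ?_, fun e => contDiffOn_const, fun e => ?_, rfl,
    fun e x _ => by rw [perturb_zero]⟩
  · have ht' : |t| * K ≤ 1 / 2 := by
      have h1 := (abs_lt.2 ht).le
      calc |t| * K ≤ 1 / (2 * K) * K := by gcongr
        _ = 1 / 2 := by field_simp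
    exact ⟨h.metric_pos, fun e => (h.density_smooth e).add
      (contDiffOn_const.mul (hσ e).contDiffOn),
      (hK.isData h.isData (fun e => (hσ e).continuous.continuousOn) ht').dens⟩
  · refine ContDiffOn.add ?_ ?_
    · exact (h.density_smooth e).comp contDiffOn_snd fun p hp => hp.2
    · exact contDiffOn_fst.mul ((hσ e).comp contDiff_snd).contDiffOn

variable {V : Type*} {G : Multigraph V E}

/-- If a perturbation of the density increases the normalising factor faster than it can decrease
the first eigenvalue, the pair is not extremal. -/
theorem not_isExtremalPair_of_perturb [Nonempty E] (hG : G.IsFlower) {α η t₀ : ℝ}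
    (hσ : ∀ e, ContDiff ℝ ∞ (σ e)) (ht₀ : 0 < t₀)
    (hη : η * ∑ e, g e ^ α * ∫ x in (0 : ℝ)..1, ρ e x < ∑ e, g e ^ α * ∫ x in (0 : ℝ)..1, σ e x)
    (hQ : ∀ t lam f d c, 0 ≤ t → t < t₀ → IsFirst g (perturb ρ σ t) lam →
      IsEig g (perturb ρ σ t) lam f d c → pair g σ f f ≤ η * pair g (perturb ρ σ t) f f) :
    ¬ IsExtremalPair (alphaEigenvalue G α 1) g ρ := by
  rintro ⟨hmd, hext⟩
  have h := hmd.isData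
  have hσc : ∀ e, ContinuousOn (σ e) (Icc 0 1) := fun e => (hσ e).continuous.continuousOn
  obtain ⟨K, hK0, hK⟩ := exists_dominated h hσc
  have hfam := perturb_isSmoothFamily hmd hσ hK0 hK
  obtain ⟨lam₀, hF₀⟩ := exists_isFirst h
  set S := ∑ e, g e ^ α * ∫ x in (0 : ℝ)..1, ρ e x with hS
  set s := ∑ e, g e ^ α * ∫ x in (0 : ℝ)..1, σ e x with hs
  set C₀ := ∑ e, g e ^ (1 - α) with hC₀
  have hC₀pos : 0 < C₀ :=
    Finset.sum_pos (fun e _ => Real.rpow_pos_of_pos (h.pos e) _) Finset.univ_nonempty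
  have hSt : ∀ t, ∑ e, g e ^ α * ∫ x in (0 : ℝ)..1, perturb ρ σ t e x = S + t * s := by
    intro t
    rw [hS, hs, Finset.mul_sum, ← Finset.sum_add_distrib]
    refine Finset.sum_congr rfl fun e _ => ?_
    rw [integral_perturb h hσc]; ring
  have hΦ : ∀ t lam, |t| * K ≤ 1 / 2 → IsFirst g (perturb ρ σ t) lam →
      alphaEigenvalue G α 1 g (perturb ρ σ t) = lam * C₀ * (S + t * s) := by
    intro t lam ht hF
    rw [alphaEigenvalue, hF.eigenvalue_eq hG (hK.isData h hσc ht), hSt]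
  have hΦ₀ : alphaEigenvalue G α 1 g ρ = lam₀ * C₀ * S := by
    rw [alphaEigenvalue, hF₀.eigenvalue_eq hG h]
  have hsmall : ∀ t, |t| < 1 / (2 * K) → |t| * K ≤ 1 / 2 := by
    intro t ht
    calc |t| * K ≤ 1 / (2 * K) * K := by gcongr
      _ = 1 / 2 := by field_simp
  have hStpos : ∀ t, |t| * K ≤ 1 / 2 → 0 < S + t * s := by
    intro t ht
    rw [← hSt]
    have hd := hK.isData h hσc ht
    exact Finset.sum_pos (fun e _ => mul_pos (Real.rpow_pos_of_pos (h.pos e) _)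
      (intervalIntegral.integral_pos zero_lt_one (hd.cont e)
        (fun x hx => (hd.dens e x (Ioc_subset_Icc_self hx)).le)
        ⟨0, by simp, hd.dens e 0 (by simp)⟩)) Finset.univ_nonempty
  have hM := totalMass_pos h
  have hnear : ∀ ε, 0 < ε → ∀ᶠ t in 𝓝 (0 : ℝ), |t| < ε := fun ε hε => by
    have := Metric.ball_mem_nhds (0 : ℝ) hε
    filter_upwards [this] with t ht
    simpa using ht
  have hext' := hext _ _ _ hfam
  rw [hΦ₀] at hext'
  obtain ⟨f, d, c, hf, hff⟩ := hF₀.exists_eig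
  refine not_first_order_bound (C := 8 * K ^ 2)
    (C' := 2 * wmean g σ f ^ 2 / (totalMass g ρ * pair g ρ f f))
    (mul_pos hF₀.pos hC₀pos) hη ?_ ?_ hext'
  · filter_upwards [nhdsWithin_le_nhds (hnear (1 / (2 * K)) (by positivity)),
      nhdsWithin_le_nhds (hnear t₀ ht₀), self_mem_nhdsWithin] with t h1 h2 h3
    have h3' : 0 < t := h3
    have htK := hsmall t h1
    have hd := hK.isData h hσc htK
    obtain ⟨lam, hF⟩ := exists_isFirst hd
    obtain ⟨f, d, c, hf, hff⟩ := hF.exists_eig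
    have h4 := hQ t lam f d c h3'.le (by rwa [abs_of_pos h3'] at h2) hF hf
    -- For t > 0 the eigenfunction of the perturbed density tests the original problem. Its ρ-mean
    -- is -t times its σ-mean, so the correction for the mean is of order t². The constant 8K² is
    -- (2K)² from domination by the perturbed density times 2 from the total masses.
    have h5 := hF₀.le_of_test h hf.isTest
    rw [hf.energy_eq hd hf.isTest] at h5
    have h6 := pair_perturb (t := t) h hσc hf.cont hf.cont
    have h7 := wmean_perturb (t := t) h hσc hf.cont
    rw [hf.mean_eq_zero hd hF.pos.ne'] at h7
    have hK' : Dominated (perturb ρ σ t) σ (2 * K) := fun e x hx => by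
      have := hK e x hx
      have := hK.half_le h htK e hx
      nlinarith
    have h8 := hK'.wmean_sq_le hd hσc hf.cont
    have h9 := (hK.totalMass_le h hσc htK).2
    set N := pair g (perturb ρ σ t) f f with hN
    set w := wmean g σ f with hw
    have h10 : wmean g ρ f ^ 2 / totalMass g ρ ≤ 8 * K ^ 2 * t ^ 2 * N := by
      have e1 : wmean g ρ f = -(t * w) := by linarith
      rw [div_le_iff₀ hM, e1]
      have h11 : (2 * K) ^ 2 * (totalMass g (perturb ρ σ t) * N) ≤
          (2 * K) ^ 2 * (2 * totalMass g ρ * N) := by gcongr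
      have h12 := mul_le_mul_of_nonneg_left (h8.trans h11) (sq_nonneg t)
      nlinarith
    have h13 : N * (1 - η * t - 8 * K ^ 2 * t ^ 2) ≤
        pair g ρ f f - wmean g ρ f ^ 2 / totalMass g ρ := by
      have := mul_le_mul_of_nonneg_left h4 h3'.le
      linarith
    have h14 := (mul_le_mul_of_nonneg_left h13 hF₀.pos.le).trans h5
    have h15 : lam₀ * (1 - η * t - 8 * K ^ 2 * t ^ 2) ≤ lam := by
      have : lam₀ * (1 - η * t - 8 * K ^ 2 * t ^ 2) * N ≤ lam * N := by linarith
      exact le_of_mul_le_mul_right this hff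
    rw [hΦ t lam htK hF]
    have h16 := mul_le_mul_of_nonneg_right h15 (mul_pos hC₀pos (hStpos t htK)).le
    linarith
  · filter_upwards [nhdsWithin_le_nhds (hnear (1 / (2 * K)) (by positivity)),
      self_mem_nhdsWithin] with t h1 h3
    have h3' : t < 0 := h3
    have htK := hsmall t h1
    have hd := hK.isData h hσc htK
    obtain ⟨lam, hF⟩ := exists_isFirst hd
    have h4 := hQ 0 lam₀ f d c le_rfl ht₀ (by rwa [perturb_zero]) (by rwa [perturb_zero])
    rw [perturb_zero] at h4
    -- For t < 0 the roles are exchanged: one fixed eigenfunction of ρ tests the perturbed problem.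
    -- Multiplying the bound `h4` by t < 0 yields a lower bound for the perturbed norm.
    have h5 := hF.le_of_test hd hf.isTest
    rw [hf.energy_eq h hf.isTest, pair_perturb h hσc hf.cont hf.cont,
      wmean_perturb h hσc hf.cont, hf.mean_eq_zero h hF₀.pos.ne', zero_add] at h5
    have h9 := (hK.totalMass_le h hσc htK).1
    set N := pair g ρ f f with hN
    set w := wmean g σ f with hw
    have hMt := totalMass_pos hd
    have h10 : (t * w) ^ 2 / totalMass g (perturb ρ σ t) ≤
        2 * w ^ 2 / (totalMass g ρ * N) * t ^ 2 * N := by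
      have e1 : 2 * w ^ 2 / (totalMass g ρ * N) * t ^ 2 * N =
        (t * w) ^ 2 / (1 / 2 * totalMass g ρ) := by field_simp
      rw [e1]
      gcongr
    have h13 : N * (1 + t * η - 2 * w ^ 2 / (totalMass g ρ * N) * t ^ 2) ≤
        N + t * pair g σ f f - (t * w) ^ 2 / totalMass g (perturb ρ σ t) := by
      nlinarith
    have h14 := (mul_le_mul_of_nonneg_left h13 hF.pos.le).trans h5
    have h15 : lam * (1 + t * η - 2 * w ^ 2 / (totalMass g ρ * N) * t ^ 2) ≤ lam₀ := by
      have : lam * (1 + t * η - 2 * w ^ 2 / (totalMass g ρ * N) * t ^ 2) * N ≤ lam₀ * N := by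
        linarith
      exact le_of_mul_le_mul_right this hff
    rw [hΦ t lam htK hF]
    have h16 := mul_le_mul_of_nonneg_right h15 (mul_pos hC₀pos (hStpos t htK)).le
    linarith

end

end QuantumGraph

namespace QuantumGraph

/-! ### Dirichlet subsolutions on an edge -/

/-- The first Dirichlet eigenvalue of an edge with density `ρ` is smaller than `r`. -/
def IsSupercritical (ρ : ℝ → ℝ) (r : ℝ) : Prop :=
  ∃ φ δ : ℝ → ℝ, IsTest (fun _ : Unit => φ) (fun _ => δ) 0 ∧
    ∫ x in (0 : ℝ)..1, δ x * δ x < r * ∫ x in (0 : ℝ)..1, ρ x * φ x * φ x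

theorem IsSupercritical.mono {ρ ρ' : ℝ → ℝ} {r r' : ℝ} (hρ : ContinuousOn ρ (Icc 0 1))
    (hρ' : ContinuousOn ρ' (Icc 0 1)) (h0 : ∀ x ∈ Icc (0 : ℝ) 1, 0 ≤ ρ x)
    (hle : ∀ x ∈ Icc (0 : ℝ) 1, ρ x ≤ ρ' x) (hr0 : 0 ≤ r') (hr : r ≤ r')
    (h : IsSupercritical ρ r) : IsSupercritical ρ' r' := by
  obtain ⟨φ, δ, ht, hlt⟩ := h
  refine ⟨φ, δ, ht, hlt.trans_le ?_⟩
  have hφ : ContinuousOn φ (Icc 0 1) := ht.cont ()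
  have h1 : 0 ≤ ∫ x in (0 : ℝ)..1, ρ x * φ x * φ x := integral_nonneg_Icc fun x hx => by
    rw [mul_assoc]; exact mul_nonneg (h0 x hx) (mul_self_nonneg _)
  have h2 : ∫ x in (0 : ℝ)..1, ρ x * φ x * φ x ≤ ∫ x in (0 : ℝ)..1, ρ' x * φ x * φ x :=
    integral_mono_Icc (intervalIntegrable_of_Icc ((hρ.mul hφ).mul hφ))
      (intervalIntegrable_of_Icc ((hρ'.mul hφ).mul hφ)) fun x hx => by
        rw [mul_assoc, mul_assoc]
        exact mul_le_mul_of_nonneg_right (hle x hx) (mul_self_nonneg _)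
  exact mul_le_mul hr h2 h1 hr0

/-- The supercritical ranges of two densities are nested. -/
theorem isSupercritical_total {ρ ρ' : ℝ → ℝ} (hρ : ContinuousOn ρ (Icc 0 1))
    (hρ' : ContinuousOn ρ' (Icc 0 1)) (h0 : ∀ x ∈ Icc (0 : ℝ) 1, 0 ≤ ρ x)
    (h0' : ∀ x ∈ Icc (0 : ℝ) 1, 0 ≤ ρ' x) :
    (∀ r, 0 ≤ r → IsSupercritical ρ r → IsSupercritical ρ' r) ∨
      (∀ r, 0 ≤ r → IsSupercritical ρ' r → IsSupercritical ρ r) := by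
  by_cases h : ∀ r, 0 ≤ r → IsSupercritical ρ r → IsSupercritical ρ' r
  · exact Or.inl h
  · push Not at h
    obtain ⟨r₁, hr₁, h1, h2⟩ := h
    refine Or.inr fun r hr hs => ?_
    rcases le_total r₁ r with hle | hle
    · exact h1.mono hρ hρ h0 (fun _ _ => le_rfl) hr hle
    · exact absurd (hs.mono hρ' hρ' h0' (fun _ _ => le_rfl) hr₁ hle) h2

section
variable {E : Type*} [Fintype E]

/-- At the first eigenvalue at most one edge is supercritical. -/
theorem IsFirst.not_isSupercritical {a lam : ℝ} {ρ : E → ℝ → ℝ} (ha : 0 < a)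
    (hF : IsFirst (fun _ : E => a) ρ lam)
    {e e' : E} (hne : e ≠ e') (h1 : IsSupercritical (ρ e) (lam * a))
    (h2 : IsSupercritical (ρ e') (lam * a)) : False := by
  classical
  obtain ⟨φ, δ, hφ, h1⟩ := h1
  obtain ⟨ψ, ε, hψ, h2⟩ := h2
  set mφ := ∫ x in (0 : ℝ)..1, ρ e x * φ x with hmφ
  set mψ := ∫ x in (0 : ℝ)..1, ρ e' x * ψ x with hmψ
  -- A nontrivial combination of the two Dirichlet functions has mean zero. Being supported on
  -- disjoint edges they do not interact, so its Rayleigh quotient is below the minimum.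
  obtain ⟨A, B, hAB, hne0⟩ : ∃ A B : ℝ, A * mφ + B * mψ = 0 ∧ 0 < A ^ 2 + B ^ 2 := by
    by_cases h0 : mφ = 0
    · exact ⟨1, 0, by rw [h0]; ring, by norm_num⟩
    · exact ⟨-mψ, mφ, by ring, by positivity⟩
  set u : E → ℝ → ℝ := fun k x => if k = e then A * φ x else if k = e' then B * ψ x else 0 with hu
  set v : E → ℝ → ℝ := fun k x => if k = e then A * δ x else if k = e' then B * ε x else 0 with hv
  have hue : u e = fun x => A * φ x := by simp [hu]
  have hue' : u e' = fun x => B * ψ x := by simp [hu, hne.symm]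
  have huk : ∀ k, k ≠ e ∧ k ≠ e' → u k = fun _ => 0 := fun k hk => by simp [hu, hk.1, hk.2]
  have hve : v e = fun x => A * δ x := by simp [hv]
  have hve' : v e' = fun x => B * ε x := by simp [hv, hne.symm]
  have hvk : ∀ k, k ≠ e ∧ k ≠ e' → v k = fun _ => 0 := fun k hk => by simp [hv, hk.1, hk.2]
  have hcases : ∀ k, k = e ∨ k = e' ∨ (k ≠ e ∧ k ≠ e') := fun k => by tauto
  have ht : IsTest u v 0 := by
    constructor
    · intro k
      rcases hcases k with rfl | rfl | hk
      · rw [hue]; exact continuousOn_const.mul (hφ.cont ())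
      · rw [hue']; exact continuousOn_const.mul (hψ.cont ())
      · rw [huk k hk]; exact continuousOn_const
    · intro k x hx
      rcases hcases k with rfl | rfl | hk
      · rw [hue, hve]; exact (hφ.deriv () x hx).const_mul A
      · rw [hue', hve']; exact (hψ.deriv () x hx).const_mul B
      · rw [huk k hk, hvk k hk]; exact hasDerivWithinAt_const _ _ _
    · intro k
      rcases hcases k with rfl | rfl | hk
      · rw [hve]; exact (hφ.int ()).const_mul A
      · rw [hve']; exact (hψ.int ()).const_mul B
      · rw [hvk k hk]; simp
    · intro k
      rcases hcases k with rfl | rfl | hk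
      · rw [hve]; simpa only [mul_mul_mul_comm] using (hφ.sq ()).const_mul (A * A)
      · rw [hve']; simpa only [mul_mul_mul_comm] using (hψ.sq ()).const_mul (B * B)
      · rw [hvk k hk]; simp
    · intro k
      rcases hcases k with rfl | rfl | hk
      · rw [hue]; simp only [hφ.left (), mul_zero]
      · rw [hue']; simp only [hψ.left (), mul_zero]
      · rw [huk k hk]
    · intro k
      rcases hcases k with rfl | rfl | hk
      · rw [hue]; simp only [hφ.right (), mul_zero]
      · rw [hue']; simp only [hψ.right (), mul_zero]
      · rw [huk k hk]
  have hm : wmean (fun _ : E => a) ρ u = 0 := by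
    rw [wmean, Fintype.sum_eq_add e e' hne (fun k hk => by rw [huk k hk]; simp), hue, hue']
    simp only [mul_left_comm _ A, mul_left_comm _ B, intervalIntegral.integral_const_mul]
    rw [← hmφ, ← hmψ]
    linear_combination Real.sqrt a * hAB
  have hp : pair (fun _ : E => a) ρ u u = Real.sqrt a *
      (A ^ 2 * (∫ x in (0 : ℝ)..1, ρ e x * φ x * φ x) +
        B ^ 2 * ∫ x in (0 : ℝ)..1, ρ e' x * ψ x * ψ x) := by
    rw [pair, Fintype.sum_eq_add e e' hne (fun k hk => by rw [huk k hk]; simp), hue, hue', mul_add]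
    simp only [← intervalIntegral.integral_const_mul]
    congr 1 <;> exact integral_congr_Icc fun x _ => by ring
  have hen : energy (fun _ : E => a) v v = (Real.sqrt a)⁻¹ *
      (A ^ 2 * (∫ x in (0 : ℝ)..1, δ x * δ x) + B ^ 2 * ∫ x in (0 : ℝ)..1, ε x * ε x) := by
    rw [energy, Fintype.sum_eq_add e e' hne (fun k hk => by rw [hvk k hk]; simp), hve, hve',
      mul_add]
    simp only [← intervalIntegral.integral_const_mul]
    congr 1 <;> exact integral_congr_Icc fun x _ => by ring
  have h := hF.le u v 0 ht hm
  rw [hp, hen] at h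
  set X := ∫ x in (0 : ℝ)..1, ρ e x * φ x * φ x
  set Y := ∫ x in (0 : ℝ)..1, ρ e' x * ψ x * ψ x
  set P := ∫ x in (0 : ℝ)..1, δ x * δ x
  set Q := ∫ x in (0 : ℝ)..1, ε x * ε x
  have hr : 0 < Real.sqrt a := Real.sqrt_pos.2 ha
  have h3 := mul_le_mul_of_nonneg_left h hr.le
  have h4 : Real.sqrt a * ((Real.sqrt a)⁻¹ * (A ^ 2 * P + B ^ 2 * Q)) = A ^ 2 * P + B ^ 2 * Q := by
    field_simp
  have h5 : Real.sqrt a * (lam * (Real.sqrt a * (A ^ 2 * X + B ^ 2 * Y))) =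
      lam * a * (A ^ 2 * X + B ^ 2 * Y) := by
    rw [← Real.mul_self_sqrt ha.le]
    rw [Real.sqrt_mul_self hr.le]; ring
  rw [h4, h5] at h3
  rcases (sq_nonneg A).eq_or_lt with hA | hA
  · have hB : 0 < B ^ 2 := by rw [← hA] at hne0; linarith
    rw [← hA] at h3
    nlinarith [mul_lt_mul_of_pos_left h2 hB]
  · nlinarith [mul_lt_mul_of_pos_left h1 hA, mul_le_mul_of_nonneg_left h2.le (sq_nonneg B)]

end

/-! ### Nodal intervals -/

theorem exists_last_zero {f : ℝ → ℝ} {p q : ℝ} (hpq : p < q) (hf : ContinuousOn f (Icc p q))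
    (hp : 0 < f p) (hq : f q < 0) : ∃ a ∈ Ioo p q, f a = 0 ∧ ∀ x ∈ Ioc a q, f x < 0 := by
  have hc : IsCompact {x ∈ Icc p q | 0 ≤ f x} := by
    have := hf.preimage_isClosed_of_isClosed isClosed_Icc (isClosed_Ici (a := (0 : ℝ)))
    exact isCompact_Icc.of_isClosed_subset this inter_subset_left
  obtain ⟨a, ⟨⟨ha, hfa⟩, hmax⟩⟩ := hc.exists_isGreatest ⟨p, ⟨left_mem_Icc.2 hpq.le, hp.le⟩⟩
  have haq : a < q := by
    rcases ha.2.eq_or_lt with h | h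
    · rw [h] at hfa; linarith
    · exact h
  have hneg : ∀ x ∈ Ioc a q, f x < 0 := by
    intro x hx
    by_contra hcon
    push Not at hcon
    exact absurd (hmax ⟨⟨ha.1.trans hx.1.le, hx.2⟩, hcon⟩) (not_le.2 hx.1)
  have hfa0 : f a = 0 := by
    rcases hfa.eq_or_lt with h | h
    · exact h.symm
    · obtain ⟨x, hx, hx0⟩ := intermediate_value_Icc' haq.le (hf.mono (Icc_subset_Icc_left ha.1))
        ⟨hq.le, h.le⟩
      have hxa : a < x := by
        rcases hx.1.eq_or_lt with h' | h'
        · rw [← h'] at hx0; linarith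
        · exact h'
      have := hneg x ⟨hxa, hx.2⟩
      linarith
  refine ⟨a, ⟨?_, haq⟩, hfa0, hneg⟩
  rcases ha.1.eq_or_lt with h | h
  · rw [← h] at hfa0; linarith
  · exact h

theorem exists_first_zero {f : ℝ → ℝ} {p q : ℝ} (hpq : p < q) (hf : ContinuousOn f (Icc p q))
    (hp : f p < 0) (hq : 0 < f q) : ∃ b ∈ Ioo p q, f b = 0 ∧ ∀ x ∈ Ico p b, f x < 0 := by
  obtain ⟨a, ha, ha0, hneg⟩ := exists_last_zero (f := fun x => f (-x)) (p := -q) (q := -p)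
    (neg_lt_neg hpq) (hf.comp continuousOn_neg fun x hx => ⟨by linarith [hx.2], by linarith [hx.1]⟩)
    (by simpa using hq) (by simpa using hp)
  refine ⟨-a, ⟨by linarith [ha.2], by linarith [ha.1]⟩, ha0, fun x hx => ?_⟩
  have := hneg (-x) ⟨by linarith [hx.2], by linarith [hx.1]⟩
  simpa using this

theorem integral_indicator_Ico {a b : ℝ} (ha : 0 < a) (hab : a ≤ b) (hb : b < 1) (F : ℝ → ℝ) :
    ∫ x in (0 : ℝ)..1, (Ico a b).indicator F x = ∫ x in a..b, F x := by
  rw [intervalIntegral.integral_of_le zero_le_one, intervalIntegral.integral_of_le hab,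
    setIntegral_indicator measurableSet_Ico, integral_Ioc_eq_integral_Ioo,
    ← integral_Ico_eq_integral_Ioo]
  congr 2
  ext x
  simp only [mem_inter_iff, mem_Ioc, mem_Ico]
  constructor
  · exact fun h => h.2
  · exact fun h => ⟨⟨by linarith, by linarith⟩, h⟩

theorem intervalIntegrable_indicator_Ico {a b : ℝ} {F : ℝ → ℝ}
    (hF : IntervalIntegrable F volume 0 1) :
    IntervalIntegrable ((Ico a b).indicator F) volume 0 1 := by
  rw [intervalIntegrable_iff] at hF ⊢
  exact hF.indicator measurableSet_Ico

/-- Evaluates the square of a truncated function plus a small multiple of a smooth one: the pure and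
mixed terms of the truncated part live on [a, b], the rest on the whole edge. -/
theorem integral_indicator_add {a b : ℝ} (ha : 0 < a) (hab : a ≤ b) (hb : b < 1) {A B C : ℝ → ℝ}
    (hA : ContinuousOn A (Icc 0 1)) (hB : ContinuousOn B (Icc 0 1)) (hC : ContinuousOn C (Icc 0 1))
    (t w : ℝ) :
    IntervalIntegrable (fun x => (Ico a b).indicator (fun x => A x + t * B x) x + w * C x)
      volume 0 1 ∧
    ∫ x in (0 : ℝ)..1, ((Ico a b).indicator (fun x => A x + t * B x) x + w * C x) =
      (∫ x in a..b, A x) + t * (∫ x in a..b, B x) + w * ∫ x in (0 : ℝ)..1, C x := by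
  have i1 : IntervalIntegrable ((Ico a b).indicator (fun x => A x + t * B x)) volume 0 1 :=
    intervalIntegrable_indicator_Ico (intervalIntegrable_of_Icc
      (hA.add (continuousOn_const.mul hB)))
  have i2 : IntervalIntegrable (fun x => w * C x) volume 0 1 :=
    (intervalIntegrable_of_Icc hC).const_mul w
  have hsub : Icc a b ⊆ Icc (0 : ℝ) 1 := Icc_subset_Icc ha.le hb.le
  have hint : ∀ {F : ℝ → ℝ}, ContinuousOn F (Icc 0 1) → IntervalIntegrable F volume a b :=
    fun hF => ContinuousOn.intervalIntegrable (by rw [uIcc_of_le hab]; exact hF.mono hsub)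
  refine ⟨i1.add i2, ?_⟩
  rw [intervalIntegral.integral_add i1 i2, integral_indicator_Ico ha hab hb,
    intervalIntegral.integral_add (hint hA) ((hint hB).const_mul t),
    intervalIntegral.integral_const_mul, intervalIntegral.integral_const_mul]

/-! ### Solutions of the equation on a single edge -/

section edge
variable {f d ρ : ℝ → ℝ} {r c : ℝ}

/-- The Euler-Lagrange equation forces a nodal interval inside an edge to be supercritical. -/
theorem isSupercritical_of_neg (hr : 0 < r) (hρ : ContinuousOn ρ (Icc 0 1))
    (hρ0 : ∀ x ∈ Icc (0 : ℝ) 1, 0 < ρ x)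
    (hf : ∀ x ∈ Icc (0 : ℝ) 1, HasDerivWithinAt f (d x) (Icc 0 1) x)
    (hd : ∀ x ∈ Icc (0 : ℝ) 1, HasDerivWithinAt d (-(r * (ρ x * f x))) (Icc 0 1) x)
    (h0 : 0 < f 0) (h1 : 0 < f 1) {x₀ : ℝ} (hx₀ : x₀ ∈ Icc (0 : ℝ) 1) (hneg : f x₀ < 0) :
    IsSupercritical ρ r := by
  have hfc : ContinuousOn f (Icc 0 1) := fun x hx => (hf x hx).continuousWithinAt
  have hdc : ContinuousOn d (Icc 0 1) := fun x hx => (hd x hx).continuousWithinAt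
  have hx0 : 0 < x₀ := hx₀.1.lt_of_ne (by rintro rfl; linarith)
  have hx1 : x₀ < 1 := hx₀.2.lt_of_ne (by rintro rfl; linarith)
  obtain ⟨a, ha, hfa, hna⟩ :=
    exists_last_zero hx0 (hfc.mono (Icc_subset_Icc_right hx1.le)) h0 hneg
  obtain ⟨b, hb, hfb, hnb⟩ :=
    exists_first_zero hx1 (hfc.mono (Icc_subset_Icc_left hx0.le)) hneg h1
  have hab : a < b := ha.2.trans hb.1
  have hsub : Icc a b ⊆ Icc (0 : ℝ) 1 := Icc_subset_Icc ha.1.le hb.2.le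
  have hfneg : ∀ x ∈ Ioo a b, f x < 0 := by
    intro x hx
    rcases le_total x x₀ with h | h
    · exact hna x ⟨hx.1, h⟩
    · exact hnb x ⟨h, hx.2⟩
  have hfat : ∀ x ∈ Ioo a b, HasDerivAt f (d x) x := fun x hx =>
    (hf x (hsub (Ioo_subset_Icc_self hx))).hasDerivAt
      (Icc_mem_nhds (ha.1.trans hx.1) (hx.2.trans hb.2))
  have hdat : ∀ x ∈ Ioo a b, HasDerivAt d (-(r * (ρ x * f x))) x := fun x hx =>
    (hd x (hsub (Ioo_subset_Icc_self hx))).hasDerivAt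
      (Icc_mem_nhds (ha.1.trans hx.1) (hx.2.trans hb.2))
  -- Where f < 0 the equation makes f strictly convex. With Rolle's theorem this gives nonzero
  -- slopes, f'(a) < 0 < f'(b), at the ends of the nodal interval.
  have hmono : StrictMonoOn d (Icc a b) := by
    refine strictMonoOn_of_deriv_pos (convex_Icc a b) (hdc.mono hsub) fun x hx => ?_
    rw [interior_Icc] at hx
    rw [(hdat x hx).deriv]
    have := mul_pos hr (mul_pos (hρ0 x (hsub (Ioo_subset_Icc_self hx)))
      (neg_pos.2 (hfneg x hx)))
    linarith
  obtain ⟨ξ, hξ, hdξ⟩ := exists_hasDerivAt_eq_zero hab (hfc.mono hsub) (hfa.trans hfb.symm) hfat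
  have hda : d a < 0 := by
    rw [← hdξ]; exact hmono (left_mem_Icc.2 hab.le) (Ioo_subset_Icc_self hξ) hξ.1
  have hdb : 0 < d b := by
    rw [← hdξ]; exact hmono (Ioo_subset_Icc_self hξ) (right_mem_Icc.2 hab.le) hξ.2
  -- the truncated eigenfunction and its perturbation
  set h : ℝ → ℝ := fun x => x * (1 - x) with hh
  set h' : ℝ → ℝ := fun x => 1 - 2 * x with hh'
  have hhd : ∀ x, HasDerivAt h (h' x) x := fun x =>
    ((hasDerivAt_id' x).mul ((hasDerivAt_id' x).const_sub 1)).congr_deriv (by simp [hh']; ring)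
  have hhc : Continuous h := by fun_prop
  have hhc' : Continuous h' := by fun_prop
  have hhO : ContinuousOn h (Icc 0 1) := hhc.continuousOn
  have hhO' : ContinuousOn h' (Icc 0 1) := hhc'.continuousOn
  -- The truncated eigenfunction alone has Rayleigh quotient exactly r. The contribution of its two
  -- corners to the first variation along h is 2p > 0, so a small negative multiple of h gives
  -- strict inequality.
  set p := d b * h b - d a * h a with hp
  have hppos : 0 < p := by
    have h2 : 0 < h a := mul_pos ha.1 (by linarith [hb.2])
    have h3 : 0 < h b := mul_pos (by linarith [ha.1]) (by linarith [hb.2])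
    nlinarith [mul_pos hdb h3, mul_pos (neg_pos.2 hda) h2]
  set q := (∫ x in (0 : ℝ)..1, h' x * h' x) - r * ∫ x in (0 : ℝ)..1, ρ x * h x * h x with hq
  -- Small enough for the linear term 2sp to dominate s²q, whatever the sign of q.
  set s := -(p / (|q| + 1)) with hs
  have hρab : ContinuousOn ρ (Icc a b) := hρ.mono hsub
  have hfab : ContinuousOn f (Icc a b) := hfc.mono hsub
  have hdab : ContinuousOn d (Icc a b) := hdc.mono hsub
  have hibp : ∀ u u' : ℝ → ℝ, ContinuousOn u (Icc a b) → ContinuousOn u' (Icc a b) →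
      (∀ x ∈ Ioo a b, HasDerivAt u (u' x) x) →
      ∫ x in a..b, d x * u' x = d b * u b - d a * u a + r * ∫ x in a..b, ρ x * f x * u x := by
    intro u u' hu hu' hder
    rw [integral_mul_right_deriv hab.le (fun x hx => (hd x (hsub hx)).mono hsub)
      (continuousOn_const.mul (hρab.mul hfab)).neg hu
      (fun x hx => (hder x hx).hasDerivWithinAt)
      (ContinuousOn.intervalIntegrable (by rwa [uIcc_of_le hab.le])),
      ← intervalIntegral.integral_const_mul, sub_eq_add_neg _ (intervalIntegral _ _ _ _),
      ← intervalIntegral.integral_neg]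
    congr 2; funext x; ring
  have e1 := hibp f d hfab hdab hfat
  have e2 := hibp h h' hhc.continuousOn hhc'.continuousOn (fun x _ => hhd x)
  rw [hfa, hfb, mul_zero, mul_zero, sub_zero, zero_add] at e1
  -- The half-open interval is what makes the truncated d the right derivative at both corners: d a
  -- at a, and 0 at b.
  refine ⟨fun x => (Ico a b).indicator f x + s * h x,
    fun x => (Ico a b).indicator d x + s * h' x, ⟨fun _ => ?_, fun _ x hx => ?_, fun _ => ?_,
      fun _ => ?_, fun _ => ?_, fun _ => ?_⟩, ?_⟩
  · refine ContinuousOn.add ?_ (by fun_prop)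
    -- Since f vanishes at a and b, truncating f is the same as composing it with the clamp onto [a,
    -- b], which shows continuity.
    have hcl : ∀ x, max a (min b x) ∈ Icc (0 : ℝ) 1 := fun x =>
      ⟨ha.1.le.trans (le_max_left _ _), max_le (hab.le.trans hb.2.le)
        ((min_le_left _ _).trans hb.2.le)⟩
    have hcc : ContinuousOn (fun x => f (max a (min b x))) (Icc 0 1) :=
      hfc.comp (by fun_prop) fun x _ => hcl x
    refine hcc.congr fun x _ => ?_
    change (Ico a b).indicator f x = f (max a (min b x))
    by_cases hx : x ∈ Ico a b
    · rw [indicator_of_mem hx, min_eq_right hx.2.le, max_eq_right hx.1]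
    · rw [indicator_of_notMem hx]
      rcases lt_or_ge x a with hxa | hxa
      · rw [min_eq_right (hxa.trans hab).le, max_eq_left hxa.le, hfa]
      · have hxb : b ≤ x := by
          by_contra hcon; push Not at hcon; exact hx ⟨hxa, hcon⟩
        rw [min_eq_left hxb, max_eq_right hab.le, hfb]
  · refine HasDerivWithinAt.add ?_ ((hhd x).hasDerivWithinAt.const_mul s)
    rcases lt_or_ge x a with hxa | hxa
    · have hx' : x ∉ Ico a b := fun h => absurd h.1 (not_le.2 hxa)
      rw [indicator_of_notMem hx']
      refine ((hasDerivAt_const x (0 : ℝ)).congr_of_eventuallyEq ?_).hasDerivWithinAt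
      filter_upwards [Iio_mem_nhds hxa] with y hy
      exact indicator_of_notMem (fun h => absurd h.1 (not_le.2 hy)) f
    rcases lt_or_ge x b with hxb | hxb
    · have hx' : x ∈ Ico a b := ⟨hxa, hxb⟩
      rw [indicator_of_mem hx']
      refine ((HasDerivWithinAt.to_right hx
        (hf x (Ioo_subset_Icc_self hx))).congr_of_eventuallyEq ?_ (indicator_of_mem hx' f))
      filter_upwards [nhdsWithin_le_nhds (Iio_mem_nhds hxb), self_mem_nhdsWithin] with y hy hy'
      have hy'' : y ∈ Ico a b := ⟨hxa.trans (le_of_lt hy'), hy⟩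
      exact indicator_of_mem hy'' f
    · have hx' : x ∉ Ico a b := fun h => absurd h.2 (not_lt.2 hxb)
      rw [indicator_of_notMem hx']
      refine (hasDerivWithinAt_const x _ (0 : ℝ)).congr (fun y hy => ?_)
        (indicator_of_notMem hx' f)
      exact indicator_of_notMem (fun h => absurd h.2 (not_lt.2 (hxb.trans (le_of_lt hy)))) f
  · exact (intervalIntegrable_indicator_Ico (intervalIntegrable_of_Icc hdc)).add
      ((hhc'.intervalIntegrable _ _).const_mul s)
  · have : (fun x => ((Ico a b).indicator d x + s * h' x) * ((Ico a b).indicator d x + s * h' x)) =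
        fun x => (Ico a b).indicator (fun x => d x * d x + 2 * s * (d x * h' x)) x +
          s ^ 2 * (h' x * h' x) := by
      funext x
      by_cases hx : x ∈ Ico a b
      · simp only [indicator_of_mem hx]; ring
      · simp only [indicator_of_notMem hx]; ring
    rw [this]
    exact (integral_indicator_add ha.1 hab.le hb.2 (hdc.mul hdc) (hdc.mul hhO')
      (hhO'.mul hhO') _ _).1
  · have : (0 : ℝ) ∉ Ico a b := fun h => absurd h.1 (not_le.2 ha.1)
    simp [indicator_of_notMem this, hh]
  · have : (1 : ℝ) ∉ Ico a b := fun h => absurd h.2 (not_lt.2 hb.2.le)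
    simp [indicator_of_notMem this, hh]
  · have t1 : ∫ x in (0 : ℝ)..1, ((Ico a b).indicator d x + s * h' x) *
        ((Ico a b).indicator d x + s * h' x) = (∫ x in a..b, d x * d x) +
          2 * s * (∫ x in a..b, d x * h' x) + s ^ 2 * ∫ x in (0 : ℝ)..1, h' x * h' x := by
      have : ∀ x ∈ Icc (0 : ℝ) 1, ((Ico a b).indicator d x + s * h' x) *
          ((Ico a b).indicator d x + s * h' x) =
          (Ico a b).indicator (fun x => d x * d x + 2 * s * (d x * h' x)) x +
          s ^ 2 * (h' x * h' x) := by
        intro x _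
        by_cases hx : x ∈ Ico a b
        · simp only [indicator_of_mem hx]; ring
        · simp only [indicator_of_notMem hx]; ring
      rw [integral_congr_Icc this]
      exact (integral_indicator_add ha.1 hab.le hb.2 (hdc.mul hdc) (hdc.mul hhO')
        (hhO'.mul hhO') _ _).2
    have t2 : ∫ x in (0 : ℝ)..1, ρ x * ((Ico a b).indicator f x + s * h x) *
        ((Ico a b).indicator f x + s * h x) = (∫ x in a..b, ρ x * f x * f x) +
          2 * s * (∫ x in a..b, ρ x * f x * h x) + s ^ 2 * ∫ x in (0 : ℝ)..1, ρ x * h x * h x := by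
      have : ∀ x ∈ Icc (0 : ℝ) 1, ρ x * ((Ico a b).indicator f x + s * h x) *
          ((Ico a b).indicator f x + s * h x) =
          (Ico a b).indicator (fun x => ρ x * f x * f x + 2 * s * (ρ x * f x * h x)) x +
          s ^ 2 * (ρ x * h x * h x) := by
        intro x _
        by_cases hx : x ∈ Ico a b
        · simp only [indicator_of_mem hx]; ring
        · simp only [indicator_of_notMem hx]; ring
      rw [integral_congr_Icc this]
      exact (integral_indicator_add ha.1 hab.le hb.2 ((hρ.mul hfc).mul hfc)
        ((hρ.mul hfc).mul hhO) ((hρ.mul hhO).mul hhO) _ _).2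
    rw [t1, t2, e1, e2]
    have hk : 0 < |q| + 1 := by positivity
    have hsk : s * (|q| + 1) = -p := by rw [hs]; field_simp
    have h2 : 2 * s * p + s ^ 2 * q < 0 := by
      have h3 : (2 * s * p + s ^ 2 * q) * (|q| + 1) ^ 2 =
          -(2 * p ^ 2 * (|q| + 1)) + p ^ 2 * q := by
        have : (2 * s * p + s ^ 2 * q) * (|q| + 1) ^ 2 =
          2 * p * (s * (|q| + 1)) * (|q| + 1) + (s * (|q| + 1)) ^ 2 * q := by ring
        rw [this, hsk]; ring
      have h4 : -(2 * p ^ 2 * (|q| + 1)) + p ^ 2 * q < 0 := by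
        have hp2 : 0 < p ^ 2 := by positivity
        nlinarith [le_abs_self q, abs_nonneg q]
      by_contra hcon
      push Not at hcon
      have := mul_nonneg hcon (sq_nonneg (|q| + 1))
      linarith
    rw [hq, hp] at h2
    linarith

/-- Nonnegative solutions with equal boundary values are larger in mean square. -/
theorem integral_sq_ge {κ : ℝ} (hρ : ContinuousOn ρ (Icc 0 1))
    (hκ0 : 0 ≤ κ) (hκ : ∀ x ∈ Icc (0 : ℝ) 1, κ ≤ r * ρ x)
    (hf : ∀ x ∈ Icc (0 : ℝ) 1, HasDerivWithinAt f (d x) (Icc 0 1) x)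
    (hd : ∀ x ∈ Icc (0 : ℝ) 1, HasDerivWithinAt d (-(r * (ρ x * f x))) (Icc 0 1) x)
    (hc : 0 ≤ c) (h0 : f 0 = c) (h1 : f 1 = c) (hnn : ∀ x ∈ Icc (0 : ℝ) 1, 0 ≤ f x) :
    (1 + κ / 6) * c ^ 2 ≤ ∫ x in (0 : ℝ)..1, f x * f x := by
  have hfc : ContinuousOn f (Icc 0 1) := fun x hx => (hf x hx).continuousWithinAt
  have hdc : ContinuousOn d (Icc 0 1) := fun x hx => (hd x hx).continuousWithinAt
  have hfat : ∀ x ∈ Ioo (0 : ℝ) 1, HasDerivAt f (d x) x := fun x hx =>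
    (hf x (Ioo_subset_Icc_self hx)).hasDerivAt (Icc_mem_nhds hx.1 hx.2)
  have hdat : ∀ x ∈ Ioo (0 : ℝ) 1, HasDerivAt d (-(r * (ρ x * f x))) x := fun x hx =>
    (hd x (Ioo_subset_Icc_self hx)).hasDerivAt (Icc_mem_nhds hx.1 hx.2)
  have hrρ : ∀ x ∈ Icc (0 : ℝ) 1, 0 ≤ r * ρ x := fun x hx => hκ0.trans (hκ x hx)
  have hanti : AntitoneOn d (Icc 0 1) := by
    refine antitoneOn_of_deriv_nonpos (convex_Icc 0 1) hdc ?_ ?_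
    · rw [interior_Icc]
      exact fun x hx => (hdat x hx).differentiableAt.differentiableWithinAt
    · intro x hx
      rw [interior_Icc] at hx
      rw [(hdat x hx).deriv, ← mul_assoc]
      have hx' := Ioo_subset_Icc_self hx
      linarith [mul_nonneg (hrρ x hx') (hnn x hx')]
  have hconc : ConcaveOn ℝ (Icc 0 1) f := by
    refine AntitoneOn.concaveOn_of_deriv (convex_Icc 0 1) hfc ?_ ?_
    · rw [interior_Icc]
      exact fun x hx => (hfat x hx).differentiableAt.differentiableWithinAt
    · rw [interior_Icc]
      intro x hx y hy hxy
      rw [(hfat x hx).deriv, (hfat y hy).deriv]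
      exact hanti (Ioo_subset_Icc_self hx) (Ioo_subset_Icc_self hy) hxy
  have hge : ∀ x ∈ Icc (0 : ℝ) 1, c ≤ f x := by
    intro x hx
    have := hconc.2 (left_mem_Icc.2 zero_le_one) (right_mem_Icc.2 zero_le_one)
      (sub_nonneg.2 hx.2) hx.1 (by ring)
    simp only [smul_eq_mul, mul_zero, mul_one, zero_add, h0, h1] at this
    linarith
  have i1 : IntervalIntegrable f volume 0 1 := intervalIntegrable_of_Icc hfc
  have hw : ContinuousOn (fun x : ℝ => x * (1 - x) / 2) (Icc 0 1) := by fun_prop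
  have i2 : IntervalIntegrable (fun x => x * (1 - x) / 2 * (r * ρ x * f x)) volume 0 1 :=
    intervalIntegrable_of_Icc (hw.mul ((continuousOn_const.mul hρ).mul hfc))
  -- The weight x(1 - x)/2 solves -w'' = 1 with zero boundary values. Two integrations by parts give
  -- the mean of f as c plus a term that is positive when c > 0 and κ > 0.
  have hmean : (∫ x in (0 : ℝ)..1, f x) - ∫ x in (0 : ℝ)..1, x * (1 - x) / 2 * (r * ρ x * f x) = c := by
    rw [← intervalIntegral.integral_sub i1 i2]
    have hw' : ContinuousOn (fun x : ℝ => x - 1 / 2) (Icc 0 1) := by fun_prop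
    rw [intervalIntegral.integral_eq_sub_of_hasDerivAt_of_le zero_le_one
      (f := fun x => x * (1 - x) / 2 * d x + (x - 1 / 2) * f x)
      ((hw.mul hdc).add (hw'.mul hfc)) (fun x hx => ?_) (i1.sub i2)]
    · simp only [h0, h1]; ring
    · have hp := (((hasDerivAt_id' x).mul ((hasDerivAt_id' x).const_sub 1)).div_const 2)
      refine ((hp.mul (hdat x hx)).add
        (((hasDerivAt_id' x).sub_const (1 / 2)).mul (hfat x hx))).congr_deriv ?_
      simp only [Pi.mul_apply]
      ring
  have hsix : ∫ x in (0 : ℝ)..1, x * (1 - x) / 2 = 1 / 12 := by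
    have hder : ∀ x ∈ uIcc (0 : ℝ) 1, HasDerivAt (fun x : ℝ => x ^ 2 / 4 - x ^ 3 / 6)
        (x * (1 - x) / 2) x := by
      intro x _
      refine (((hasDerivAt_pow 2 x).div_const 4).sub ((hasDerivAt_pow 3 x).div_const 6)).congr_deriv
        ?_
      norm_num; ring
    rw [intervalIntegral.integral_eq_sub_of_hasDerivAt hder
      (Continuous.intervalIntegrable (by fun_prop) _ _)]
    norm_num
  have hlow : κ * c * (1 / 12) ≤ ∫ x in (0 : ℝ)..1, x * (1 - x) / 2 * (r * ρ x * f x) := by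
    rw [← hsix, ← intervalIntegral.integral_const_mul]
    refine integral_mono_Icc (Continuous.intervalIntegrable (by fun_prop) _ _) i2 fun x hx => ?_
    rw [mul_comm]
    refine mul_le_mul_of_nonneg_left ?_ (by nlinarith [hx.1, hx.2])
    exact mul_le_mul (hκ x hx) (hge x hx) hc (hrρ x hx)
  -- From (f - c)² ≥ 0. The excess κ/12 of the mean, where 1/12 is the integral of the weight, is
  -- thereby doubled to κ/6.
  have hsq : 2 * c * (∫ x in (0 : ℝ)..1, f x) - c ^ 2 ≤ ∫ x in (0 : ℝ)..1, f x * f x := by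
    have h2 : ∫ x in (0 : ℝ)..1, (2 * c * f x - c ^ 2) =
        2 * c * (∫ x in (0 : ℝ)..1, f x) - c ^ 2 := by
      rw [intervalIntegral.integral_sub (i1.const_mul _) (by simp),
        intervalIntegral.integral_const_mul]
      simp
    rw [← h2]
    refine integral_mono_Icc ((i1.const_mul _).sub (by simp))
      (intervalIntegrable_of_Icc (hfc.mul hfc)) fun x _ => ?_
    nlinarith [sq_nonneg (f x - c)]
  have h3 : c + κ * c * (1 / 12) ≤ ∫ x in (0 : ℝ)..1, f x := by linarith
  have h4 := mul_le_mul_of_nonneg_left h3 hc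
  nlinarith

end edge

end QuantumGraph

namespace QuantumGraph

/-! ### Non-existence of extremal pairs -/

section
variable {E : Type*} {u δ : E → ℝ → ℝ} {c θ : ℝ}

/-- Young's inequality u² ≤ (1 + θ)c² + (1 + 1/θ)(u - c)² together with (u - c)² ≤ x ∫ δ². The bump
has mass 1 and first moment 1/(N + 2), so it evaluates u² at the vertex up to an error governed by
the energy. -/
theorem IsTest.integral_bump_le (h : IsTest u δ c) (hθ : 0 < θ) (N : ℕ) (e : E) :
    ∫ x in (0 : ℝ)..1, bump N x * u e x * u e x ≤
      (1 + θ) * c ^ 2 + (1 + 1 / θ) * (∫ x in (0 : ℝ)..1, δ e x * δ e x) / ((N : ℝ) + 2) := by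
  set D := ∫ x in (0 : ℝ)..1, δ e x * δ e x with hD
  have ib : IntervalIntegrable (bump N) volume 0 1 := (bump_continuous N).intervalIntegrable _ _
  have ibx : IntervalIntegrable (fun x => bump N x * x) volume 0 1 :=
    ((bump_continuous N).mul continuous_id).intervalIntegrable _ _
  have hval : ∫ x in (0 : ℝ)..1, ((1 + θ) * c ^ 2 * bump N x + (1 + 1 / θ) * D * (bump N x * x)) =
      (1 + θ) * c ^ 2 + (1 + 1 / θ) * D / ((N : ℝ) + 2) := by
    rw [intervalIntegral.integral_add (ib.const_mul _) (ibx.const_mul _),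
      intervalIntegral.integral_const_mul, intervalIntegral.integral_const_mul, integral_bump,
      integral_bump_mul]
    ring
  rw [← hval]
  refine integral_mono_Icc (intervalIntegrable_of_Icc
    (((bump_continuous N).continuousOn.mul (h.cont e)).mul (h.cont e)))
    ((ib.const_mul _).add (ibx.const_mul _)) fun x hx => ?_
  have h1 := h.sq_sub_le e hx
  have h2 : u e x ^ 2 ≤ (1 + θ) * c ^ 2 + (1 + 1 / θ) * (u e x - c) ^ 2 := by
    have h3 : (1 + θ) * c ^ 2 + (1 + 1 / θ) * (u e x - c) ^ 2 - u e x ^ 2 =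
        (θ * c - (u e x - c)) ^ 2 / θ := by field_simp; ring
    have : 0 ≤ (θ * c - (u e x - c)) ^ 2 / θ := by positivity
    linarith
  have h4 : (1 + 1 / θ) * (u e x - c) ^ 2 ≤ (1 + 1 / θ) * (x * D) := by gcongr
  have h5 := mul_le_mul_of_nonneg_left (h2.trans (add_le_add_right h4 _)) (bump_nonneg N hx)
  linarith

theorem IsTest.le_integral_bump (h : IsTest u δ c) (hθ : 0 < θ) (N : ℕ) (e : E) :
    (1 - θ) * c ^ 2 - 1 / θ * (∫ x in (0 : ℝ)..1, δ e x * δ e x) / ((N : ℝ) + 2) ≤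
      ∫ x in (0 : ℝ)..1, bump N x * u e x * u e x := by
  set D := ∫ x in (0 : ℝ)..1, δ e x * δ e x with hD
  have ib : IntervalIntegrable (bump N) volume 0 1 := (bump_continuous N).intervalIntegrable _ _
  have ibx : IntervalIntegrable (fun x => bump N x * x) volume 0 1 :=
    ((bump_continuous N).mul continuous_id).intervalIntegrable _ _
  have hval : ∫ x in (0 : ℝ)..1, ((1 - θ) * c ^ 2 * bump N x - 1 / θ * D * (bump N x * x)) =
      (1 - θ) * c ^ 2 - 1 / θ * D / ((N : ℝ) + 2) := by
    rw [intervalIntegral.integral_sub (ib.const_mul _) (ibx.const_mul _),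
      intervalIntegral.integral_const_mul, intervalIntegral.integral_const_mul, integral_bump,
      integral_bump_mul]
    ring
  rw [← hval]
  refine integral_mono_Icc ((ib.const_mul _).sub (ibx.const_mul _)) (intervalIntegrable_of_Icc
    (((bump_continuous N).continuousOn.mul (h.cont e)).mul (h.cont e))) fun x hx => ?_
  have h1 := h.sq_sub_le e hx
  have h2 : (1 - θ) * c ^ 2 - 1 / θ * (u e x - c) ^ 2 ≤ u e x ^ 2 := by
    have h3 : u e x ^ 2 - ((1 - θ) * c ^ 2 - 1 / θ * (u e x - c) ^ 2) =
        (θ * c + (u e x - c)) ^ 2 / θ + (u e x - c) ^ 2 := by field_simp; ring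
    have : 0 ≤ (θ * c + (u e x - c)) ^ 2 / θ + (u e x - c) ^ 2 := by positivity
    linarith
  have h4 : 1 / θ * (u e x - c) ^ 2 ≤ 1 / θ * (x * D) := by gcongr
  have h5 := mul_le_mul_of_nonneg_left ((sub_le_sub_left h4 _).trans h2) (bump_nonneg N hx)
  linarith

/-- Integrates c² ≤ 2u² + 2(u - c)²; the vertex value is controlled by the data of a single edge. -/
theorem IsTest.sq_le_integral (h : IsTest u δ c) (e : E) :
    c ^ 2 ≤ 2 * (∫ x in (0 : ℝ)..1, u e x * u e x) +
      2 * ∫ x in (0 : ℝ)..1, δ e x * δ e x := by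
  set D := ∫ x in (0 : ℝ)..1, δ e x * δ e x with hD
  have hD0 : 0 ≤ D := integral_nonneg_Icc fun _ _ => mul_self_nonneg _
  have i1 : IntervalIntegrable (fun x => u e x * u e x) volume 0 1 :=
    intervalIntegrable_of_Icc ((h.cont e).mul (h.cont e))
  have hval : ∫ x in (0 : ℝ)..1, (2 * (u e x * u e x) + 2 * D) =
      2 * (∫ x in (0 : ℝ)..1, u e x * u e x) + 2 * D := by
    rw [intervalIntegral.integral_add (i1.const_mul 2) (by simp),
      intervalIntegral.integral_const_mul]
    simp
  have hc : ∫ _ in (0 : ℝ)..1, c ^ 2 = c ^ 2 := by simp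
  rw [← hval, ← hc]
  refine integral_mono_Icc (by simp) ((i1.const_mul 2).add (by simp)) fun x hx => ?_
  have h1 := h.sq_sub_le e hx
  have h2 : x * D ≤ D := by nlinarith [hx.2]
  nlinarith [sq_nonneg (2 * u e x - c)]

variable [Fintype E] {g : E → ℝ} {ρ : E → ℝ → ℝ} {lam₀ : ℝ}

/-- Uniform bounds for the first eigenfunctions of all small perturbations. -/
theorem IsFirst.exists_bound [Nonempty E] (hF₀ : IsFirst g ρ lam₀) (h : IsData g ρ) :
    ∃ C, 0 < C ∧ ∀ (σ f d : E → ℝ → ℝ) (K t lam c : ℝ), (∀ e, ContinuousOn (σ e) (Icc 0 1)) →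
      Dominated ρ σ K → |t| * K ≤ 1 / 2 → IsFirst g (perturb ρ σ t) lam →
      IsEig g (perturb ρ σ t) lam f d c →
      (∀ e, ∫ x in (0 : ℝ)..1, d e x * d e x ≤ C * pair g (perturb ρ σ t) f f) ∧
      c ^ 2 ≤ C * pair g (perturb ρ σ t) f f ∧ lam₀ / 2 ≤ lam := by
  obtain ⟨e₀⟩ := ‹Nonempty E›
  have hne : Nonempty E := ⟨e₀⟩
  obtain ⟨x₀, hx₀, hmin⟩ := isCompact_Icc.exists_isMinOn (nonempty_Icc.2 zero_le_one) (h.cont e₀)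
  set κ := ρ e₀ x₀ with hκ
  have hκ0 : 0 < κ := h.dens e₀ x₀ hx₀
  have hr : ∀ e, 0 < Real.sqrt (g e) := fun e => Real.sqrt_pos.2 (h.pos e)
  set R := ∑ e, Real.sqrt (g e) with hR
  have hR0 : 0 < R := Finset.sum_pos (fun e _ => hr e) Finset.univ_nonempty
  have hlam₀ := hF₀.pos
  -- The constant is fixed before σ, so that the concentration N of the bump in σ may be chosen
  -- depending on it. The first term covers twice the integral of the squared derivative, the second
  -- twice the square integral on one edge, where the perturbed density is at least κ/2.
  refine ⟨2 * (R * (2 * lam₀)) + 4 / (κ * Real.sqrt (g e₀)),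
    by have := hr e₀; positivity, ?_⟩
  intro σ f d K t lam c hσ hK ht hF hf
  have hd := hK.isData h hσ ht
  set N := pair g (perturb ρ σ t) f f with hN
  have hN0 : 0 ≤ N := pair_self_nonneg hd f
  have hle : lam ≤ 2 * lam₀ := hF₀.le_of_pair_le hF h hd fun u hu => by
    have := (hK.pair_le h hσ ht hu).1; linarith
  have hge : lam₀ ≤ 2 * lam := hF.le_of_pair_le hF₀ hd h fun u hu => (hK.pair_le h hσ ht hu).2
  have hD : ∀ e, ∫ x in (0 : ℝ)..1, d e x * d e x ≤ R * (2 * lam₀) * N := by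
    intro e
    have h1 := Finset.single_le_sum
      (f := fun e => (Real.sqrt (g e))⁻¹ * ∫ x in (0 : ℝ)..1, d e x * d e x)
      (fun e _ => mul_nonneg (inv_nonneg.2 (hr e).le)
        (integral_nonneg_Icc fun _ _ => mul_self_nonneg _)) (Finset.mem_univ e)
    have h2 : energy g d d = lam * N := hf.energy_eq hd hf.isTest
    have h3 : (Real.sqrt (g e))⁻¹ * ∫ x in (0 : ℝ)..1, d e x * d e x ≤ lam * N := h1.trans h2.le
    rw [inv_mul_le_iff₀ (hr e)] at h3
    have h4 : Real.sqrt (g e) ≤ R :=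
      Finset.single_le_sum (f := fun e => Real.sqrt (g e)) (fun e _ => (hr e).le)
        (Finset.mem_univ e)
    calc _ ≤ _ := h3
      _ ≤ R * (2 * lam₀ * N) := by
        have := hF.pos
        gcongr
      _ = _ := by ring
  have hextra : 0 ≤ 4 / (κ * Real.sqrt (g e₀)) * N := by
    have := hr e₀; positivity
  have hRN : 0 ≤ R * (2 * lam₀) * N := by positivity
  refine ⟨fun e => (hD e).trans (by linarith), ?_, by linarith⟩
  have h1 := hf.isTest.sq_le_integral e₀
  have h2 : κ / 2 * ∫ x in (0 : ℝ)..1, f e₀ x * f e₀ x ≤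
      ∫ x in (0 : ℝ)..1, perturb ρ σ t e₀ x * f e₀ x * f e₀ x := by
    rw [← intervalIntegral.integral_const_mul]
    refine integral_mono_Icc (intervalIntegrable_of_Icc
      (continuousOn_const.mul ((hf.cont e₀).mul (hf.cont e₀)))) (intervalIntegrable_of_Icc
      (((hd.cont e₀).mul (hf.cont e₀)).mul (hf.cont e₀))) fun x hx => ?_
    rw [mul_assoc]
    refine mul_le_mul_of_nonneg_right ?_ (mul_self_nonneg _)
    have h3 := hK.half_le h ht e₀ hx
    have h4 : κ ≤ ρ e₀ x := hmin hx
    linarith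
  have h3 := Finset.single_le_sum
    (f := fun e => Real.sqrt (g e) * ∫ x in (0 : ℝ)..1, perturb ρ σ t e x * f e x * f e x)
    (fun e _ => mul_nonneg (hr e).le (integral_nonneg_Icc fun x hx => by
      rw [mul_assoc]; exact mul_nonneg (hd.dens e x hx).le (mul_self_nonneg _)))
    (Finset.mem_univ e₀)
  have h4 : Real.sqrt (g e₀) * (κ / 2 * ∫ x in (0 : ℝ)..1, f e₀ x * f e₀ x) ≤ N :=
    (mul_le_mul_of_nonneg_left h2 (hr e₀).le).trans h3
  have h5 : 2 * ∫ x in (0 : ℝ)..1, f e₀ x * f e₀ x ≤ 4 / (κ * Real.sqrt (g e₀)) * N := by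
    have hk : 0 < κ * Real.sqrt (g e₀) := mul_pos hκ0 (hr e₀)
    rw [div_mul_eq_mul_div, le_div_iff₀ hk]
    linarith
  have h6 := hD e₀
  linarith

variable {V : Type*} {G : Multigraph V E}

theorem normalisation_pos [Nonempty E] (h : IsData g ρ) (α : ℝ) :
    0 < ∑ e, g e ^ α * ∫ x in (0 : ℝ)..1, ρ e x :=
  Finset.sum_pos (fun e _ => mul_pos (Real.rpow_pos_of_pos (h.pos e) _)
    (intervalIntegral.integral_pos zero_lt_one (h.cont e)
      (fun x hx => (h.dens e x (Ioc_subset_Icc_self hx)).le)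
      ⟨0, by simp, h.dens e 0 (by simp)⟩)) Finset.univ_nonempty

/-- A pair is not extremal if its metric is not regular in the weight `g ^ (α - 1/2)`. -/
theorem not_isExtremalPair_of_lt (hG : G.IsFlower) {α : ℝ} {e e' : E}
    (hlt : g e' ^ α * (Real.sqrt (g e'))⁻¹ < g e ^ α * (Real.sqrt (g e))⁻¹) :
    ¬ IsExtremalPair (alphaEigenvalue G α 1) g ρ := by
  classical
  intro hext
  have hmd := hext.1
  have h := hmd.isData
  have : Nonempty E := ⟨e⟩
  have hne : e ≠ e' := by rintro rfl; exact lt_irrefl _ hlt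
  obtain ⟨lam₀, hF₀⟩ := exists_isFirst h
  obtain ⟨C, hC, hbound⟩ := hF₀.exists_bound h
  have hS := normalisation_pos h α
  set S := ∑ e, g e ^ α * ∫ x in (0 : ℝ)..1, ρ e x with hSdef
  set s := g e ^ α * (Real.sqrt (g e))⁻¹ - g e' ^ α * (Real.sqrt (g e'))⁻¹ with hs
  have hs0 : 0 < s := sub_pos.2 hlt
  -- Half of the relative growth rate s/S of the normalising factor. The error is split evenly: θ
  -- makes 2θc² at most (η/2)M, with M the square norm of f, and N makes the derivative terms at
  -- most (η/2)M.
  set η := s / (2 * S) with hη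
  have hη0 : 0 < η := by positivity
  set θ := η / (4 * C) with hθ
  have hθ0 : 0 < θ := by positivity
  obtain ⟨N, hN⟩ := exists_nat_gt ((1 + 2 / θ) * C / (η / 2))
  have hN2 : (1 + 2 / θ) * C / ((N : ℝ) + 2) ≤ η / 2 := by
    rw [div_le_iff₀ (by positivity)]
    rw [div_lt_iff₀ (by positivity)] at hN
    linarith
  -- The inverse lengths cancel the length factors in the square norm, so its change is the
  -- difference of two integrals both close to c². The normalising factor carries g^α instead and
  -- changes by s.
  set σ : E → ℝ → ℝ := fun k x => (if k = e then (Real.sqrt (g e))⁻¹ else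
    if k = e' then -(Real.sqrt (g e'))⁻¹ else 0) * bump N x with hσ
  have hσe : ∀ x, σ e x = (Real.sqrt (g e))⁻¹ * bump N x := fun x => by simp [hσ]
  have hσe' : ∀ x, σ e' x = -(Real.sqrt (g e'))⁻¹ * bump N x := fun x => by simp [hσ, hne.symm]
  have hσk : ∀ k, k ≠ e ∧ k ≠ e' → ∀ x, σ k x = 0 := fun k hk x => by simp [hσ, hk.1, hk.2]
  have hσs : ∀ k, ContDiff ℝ ∞ (σ k) := fun k => contDiff_const.mul (bump_contDiff N)
  have hσc : ∀ k, ContinuousOn (σ k) (Icc 0 1) := fun k => (hσs k).continuous.continuousOn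
  obtain ⟨K, hK0, hK⟩ := exists_dominated h hσc
  refine not_isExtremalPair_of_perturb hG (η := η) (t₀ := 1 / (2 * K)) hσs (by positivity) ?_ ?_
    hext
  · have h1 : ∑ e, g e ^ α * ∫ x in (0 : ℝ)..1, σ e x = s := by
      rw [Fintype.sum_eq_add e e' hne (fun k hk => by simp [hσk k hk])]
      simp only [hσe, hσe', intervalIntegral.integral_const_mul, integral_bump, hs]
      ring
    rw [h1, ← hSdef, hη]
    have : s / (2 * S) * S = s / 2 := by field_simp
    linarith
  · intro t lam f d c ht0 ht hF hf
    have htK : |t| * K ≤ 1 / 2 := by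
      rw [abs_of_nonneg ht0]
      calc t * K ≤ 1 / (2 * K) * K := by gcongr
        _ = 1 / 2 := by field_simp
    obtain ⟨hD, hc, _⟩ := hbound σ f d K t lam c hσc hK htK hF hf
    have h1 : pair g σ f f = (∫ x in (0 : ℝ)..1, bump N x * f e x * f e x) -
        ∫ x in (0 : ℝ)..1, bump N x * f e' x * f e' x := by
      have hr : Real.sqrt (g e) ≠ 0 := (Real.sqrt_pos.2 (h.pos e)).ne'
      have hr' : Real.sqrt (g e') ≠ 0 := (Real.sqrt_pos.2 (h.pos e')).ne'
      rw [pair, Fintype.sum_eq_add e e' hne (fun k hk => by simp [hσk k hk])]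
      simp only [hσe, hσe', mul_assoc, intervalIntegral.integral_const_mul]
      field_simp
      ring
    have h2 := hf.isTest.integral_bump_le hθ0 N e
    have h3 := hf.isTest.le_integral_bump hθ0 N e'
    rw [h1]
    set M := pair g (perturb ρ σ t) f f with hM
    have hM0 : 0 ≤ M := pair_self_nonneg (hK.isData h hσc htK) f
    have h4 : (1 + 1 / θ) * (∫ x in (0 : ℝ)..1, d e x * d e x) / ((N : ℝ) + 2) ≤
        (1 + 1 / θ) * (C * M) / ((N : ℝ) + 2) := by
      have := hD e
      gcongr
    have h5 : 1 / θ * (∫ x in (0 : ℝ)..1, d e' x * d e' x) / ((N : ℝ) + 2) ≤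
        1 / θ * (C * M) / ((N : ℝ) + 2) := by
      have := hD e'
      gcongr
    have h6 := mul_le_mul_of_nonneg_right hN2 hM0
    have h7 : (1 + 1 / θ) * (C * M) / ((N : ℝ) + 2) + 1 / θ * (C * M) / ((N : ℝ) + 2) =
        (1 + 2 / θ) * C / ((N : ℝ) + 2) * M := by ring
    have h8 : 2 * θ * c ^ 2 ≤ 2 * θ * (C * M) := by gcongr
    have h9 : 2 * θ * (C * M) = η / 2 * M := by rw [hθ]; field_simp; ring
    linarith

theorem IsEig.neg {lam : ℝ} {f d : E → ℝ → ℝ} (hf : IsEig g ρ lam f d c) :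
    IsEig g ρ lam (fun e x => -f e x) (fun e x => -d e x) (-c) := by
  refine ⟨fun e x hx => (hf.deriv e x hx).neg, fun e x hx =>
    ((hf.deriv₂ e x hx).neg).congr_deriv (by ring), fun e => by rw [hf.left],
    fun e => by rw [hf.right], ?_⟩
  rw [← neg_eq_zero, ← Finset.sum_neg_distrib]
  refine (Finset.sum_congr rfl fun e _ => ?_).trans hf.kirchhoff
  ring

/-- First eigenfunctions are large in mean square on the edges which are not supercritical. -/
theorem IsEig.le_integral_sq {lam κ : ℝ} {f d : E → ℝ → ℝ} (hf : IsEig g ρ lam f d c)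
    (h : IsData g ρ) (hlam : 0 < lam) (hκ0 : 0 ≤ κ) (e : E)
    (hκ : ∀ x ∈ Icc (0 : ℝ) 1, κ ≤ lam * g e * ρ e x) (hns : ¬ IsSupercritical (ρ e) (lam * g e)) :
    (1 + κ / 6) * c ^ 2 ≤ ∫ x in (0 : ℝ)..1, f e x * f e x := by
  have hr : 0 < lam * g e := mul_pos hlam (h.pos e)
  have main : ∀ (f d : E → ℝ → ℝ) (c : ℝ), IsEig g ρ lam f d c → 0 < c →
      (1 + κ / 6) * c ^ 2 ≤ ∫ x in (0 : ℝ)..1, f e x * f e x := by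
    intro f d c hf hc
    refine integral_sq_ge (h.cont e) hκ0 hκ (hf.deriv e) (hf.deriv₂ e) hc.le (hf.left e)
      (hf.right e) fun x hx => ?_
    by_contra hneg
    push Not at hneg
    exact hns (isSupercritical_of_neg hr (h.cont e) (h.dens e) (hf.deriv e) (hf.deriv₂ e)
      (by rw [hf.left]; exact hc) (by rw [hf.right]; exact hc) hx hneg)
  rcases lt_trichotomy c 0 with hc | hc | hc
  · simpa using main _ _ _ hf.neg (neg_pos.2 hc)
  · rw [hc]
    simpa using integral_nonneg_Icc (f := fun x => f e x * f e x) fun _ _ => mul_self_nonneg _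
  · exact main f d c hf hc

/-- No pair with a regular metric is extremal: the case of two edges whose first Dirichlet
eigenvalues are ordered. -/
theorem not_isExtremalPair_of_supercritical (hG : G.IsFlower) {α a : ℝ} (ha : 0 < a) {e e' : E}
    (hne : e ≠ e')
    (hsc : ∀ r, 0 ≤ r → IsSupercritical (ρ e) r → IsSupercritical (ρ e') r) :
    ¬ IsExtremalPair (alphaEigenvalue G α 1) (fun _ => a) ρ := by
  classical
  intro hext
  have hmd := hext.1
  have h := hmd.isData
  have : Nonempty E := ⟨e⟩
  obtain ⟨lam₀, hF₀⟩ := exists_isFirst h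
  have hlam₀ := hF₀.pos
  obtain ⟨C, hC, hbound⟩ := hF₀.exists_bound h
  have hS := normalisation_pos h α
  set S := ∑ e, (fun _ => a) e ^ α * ∫ x in (0 : ℝ)..1, ρ e x with hSdef
  obtain ⟨x₀, hx₀, hmin⟩ := isCompact_Icc.exists_isMinOn (nonempty_Icc.2 zero_le_one) (h.cont e)
  -- A lower bound for λaρ on e valid for all small t: the eigenvalue is at least half of λ₀ and the
  -- density at least half of ρ.
  set κ := lam₀ / 2 * a * (1 / 2 * ρ e x₀) with hκ
  have hκ0 : 0 < κ := by have := h.dens e x₀ hx₀; positivity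
  set z := κ / 6 with hz
  have hz0 : 0 < z := by positivity
  -- β > 1 lets the normalising factor grow. With the Young parameter θ the bump on e' costs β(1 +
  -- θ)c² = (1 + z)c², exactly what the square integral of f over e provides.
  set β := 1 + z / 3 with hβ
  have hβ0 : 0 < β := by positivity
  set θ := 2 * z / 3 / β with hθ
  have hθ0 : 0 < θ := by positivity
  have hβθ : β * (1 + θ) = 1 + z := by
    rw [hθ, mul_add, mul_div_cancel₀ _ hβ0.ne', hβ]; ring
  have hr : 0 < Real.sqrt a := Real.sqrt_pos.2 ha
  set s := a ^ α * (Real.sqrt a)⁻¹ * (z / 3) with hs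
  have hs0 : 0 < s := by have := Real.rpow_pos_of_pos ha α; positivity
  set η := s / (2 * S) with hη
  have hη0 : 0 < η := by positivity
  obtain ⟨N, hN⟩ := exists_nat_gt (β * (1 + 1 / θ) * C / η)
  have hN2 : β * (1 + 1 / θ) * C / ((N : ℝ) + 2) ≤ η := by
    rw [div_le_iff₀ (by positivity)]
    rw [div_lt_iff₀ (by positivity)] at hN
    linarith
  set σ : E → ℝ → ℝ := fun k x => if k = e then -(Real.sqrt a)⁻¹ else
    (if k = e' then β * (Real.sqrt a)⁻¹ else 0) * bump N x with hσ
  have hσe : ∀ x, σ e x = -(Real.sqrt a)⁻¹ := fun x => by simp [hσ]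
  have hσe' : ∀ x, σ e' x = β * (Real.sqrt a)⁻¹ * bump N x := fun x => by simp [hσ, hne.symm]
  have hσk : ∀ k, k ≠ e ∧ k ≠ e' → ∀ x, σ k x = 0 := fun k hk x => by simp [hσ, hk.1, hk.2]
  have hσs : ∀ k, ContDiff ℝ ∞ (σ k) := fun k => by
    by_cases hk : k = e
    · simp only [hσ, hk, if_true]; exact contDiff_const
    · simp only [hσ, hk, if_false]; exact contDiff_const.mul (bump_contDiff N)
  have hσc : ∀ k, ContinuousOn (σ k) (Icc 0 1) := fun k => (hσs k).continuous.continuousOn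
  obtain ⟨K, hK0, hK⟩ := exists_dominated h hσc
  refine not_isExtremalPair_of_perturb hG (η := η) (t₀ := 1 / (2 * K)) hσs (by positivity) ?_ ?_
    hext
  · have h1 : ∑ e, (fun _ => a) e ^ α * ∫ x in (0 : ℝ)..1, σ e x = s := by
      rw [Fintype.sum_eq_add e e' hne (fun k hk => by simp [hσk k hk])]
      simp only [hσe, hσe', intervalIntegral.integral_const_mul, integral_bump,
        intervalIntegral.integral_const, smul_eq_mul, hs, hβ]
      ring
    rw [h1, ← hSdef, hη]
    have : s / (2 * S) * S = s / 2 := by field_simp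
    linarith
  · intro t lam f d c ht0 ht hF hf
    have htK : |t| * K ≤ 1 / 2 := by
      rw [abs_of_nonneg ht0]
      calc t * K ≤ 1 / (2 * K) * K := by gcongr
        _ = 1 / 2 := by field_simp
    obtain ⟨hD, _, hlam⟩ := hbound σ f d K t lam c hσc hK htK hF hf
    have hd := hK.isData h hσc htK
    have h1 : pair (fun _ => a) σ f f = β * (∫ x in (0 : ℝ)..1, bump N x * f e' x * f e' x) -
        ∫ x in (0 : ℝ)..1, f e x * f e x := by
      rw [pair, Fintype.sum_eq_add e e' hne (fun k hk => by simp [hσk k hk])]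
      simp only [hσe, hσe', mul_assoc, intervalIntegral.integral_const_mul]
      field_simp
      ring
    have hlam0 := hF.pos
    -- The perturbation lowers the density on e and raises it on e'. If e were supercritical after
    -- it, then e was so before, hence e' by assumption, and e' still would be; two supercritical
    -- edges are impossible.
    have hns : ¬ IsSupercritical (perturb ρ σ t e) (lam * a) := by
      intro hsup
      have hr0 : 0 ≤ lam * a := by positivity
      have h2 : IsSupercritical (ρ e) (lam * a) :=
        hsup.mono (hd.cont e) (h.cont e) (fun x hx => (hd.dens e x hx).le) (fun x _ => by
          simp only [perturb, hσe]
          have : 0 ≤ t * (Real.sqrt a)⁻¹ := by positivity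
          linarith) hr0 le_rfl
      have h3 : IsSupercritical (perturb ρ σ t e') (lam * a) :=
        (hsc _ hr0 h2).mono (h.cont e') (hd.cont e') (fun x hx => (h.dens e' x hx).le)
          (fun x hx => by
            simp only [perturb, hσe']
            have : 0 ≤ t * (β * (Real.sqrt a)⁻¹ * bump N x) := by
              have := bump_nonneg N hx
              positivity
            linarith) hr0 le_rfl
      exact hF.not_isSupercritical ha hne hsup h3
    have h2 := hf.le_integral_sq (κ := κ) hd hlam0 hκ0.le e (fun x hx => by
      have h3 := hK.half_le h htK e hx
      have h4 : ρ e x₀ ≤ ρ e x := hmin hx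
      have h5 := h.dens e x₀ hx₀
      calc κ ≤ lam * a * (1 / 2 * ρ e x₀) := by rw [hκ]; gcongr
        _ ≤ lam * a * perturb ρ σ t e x := by gcongr; linarith) hns
    have h3 := mul_le_mul_of_nonneg_left (hf.isTest.integral_bump_le hθ0 N e') hβ0.le
    rw [h1]
    set M := pair (fun _ => a) (perturb ρ σ t) f f with hM
    have hM0 : 0 ≤ M := pair_self_nonneg hd f
    have h4 : β * ((1 + 1 / θ) * (∫ x in (0 : ℝ)..1, d e' x * d e' x) / ((N : ℝ) + 2)) ≤
        β * ((1 + 1 / θ) * (C * M) / ((N : ℝ) + 2)) := by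
      have := hD e'
      gcongr
    have h5 := mul_le_mul_of_nonneg_right hN2 hM0
    have h6 : β * ((1 + 1 / θ) * (C * M) / ((N : ℝ) + 2)) =
        β * (1 + 1 / θ) * C / ((N : ℝ) + 2) * M := by ring
    have h7 : β * ((1 + θ) * c ^ 2) = (1 + z) * c ^ 2 := by rw [← hβθ]; ring
    rw [← hz] at h2
    linarith

/-- A flower with at least two loops has no extremal pairs unless `α = 1 / 2`. -/
theorem not_isExtremalPair (hG : G.IsFlower) (hE : 2 ≤ Fintype.card E) {α : ℝ}
    (hα : α ≠ 1 / 2) : ¬ IsExtremalPair (alphaEigenvalue G α 1) g ρ := by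
  intro hext
  have h := hext.1.isData
  obtain ⟨e₁, e₂, hne⟩ := Fintype.exists_pair_of_one_lt_card (α := E) (by omega)
  by_cases hreg : ∀ e, g e = g e₁
  · have hg : g = fun _ => g e₁ := funext hreg
    rw [hg] at hext
    rcases isSupercritical_total (h.cont e₁) (h.cont e₂) (fun x hx => (h.dens e₁ x hx).le)
      (fun x hx => (h.dens e₂ x hx).le) with hsc | hsc
    · exact not_isExtremalPair_of_supercritical hG (h.pos e₁) hne hsc hext
    · exact not_isExtremalPair_of_supercritical hG (h.pos e₁) hne.symm hsc hext
  · push Not at hreg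
    obtain ⟨e, he⟩ := hreg
    -- The gain of the normalising factor per unit of square norm on a loop is g^(α - 1/2), an
    -- injective function of g since the exponent is not zero.
    have hw : ∀ e, g e ^ α * (Real.sqrt (g e))⁻¹ = g e ^ (α - 1 / 2) := fun e => by
      rw [Real.sqrt_eq_rpow, ← Real.rpow_neg (h.pos e).le, ← Real.rpow_add (h.pos e)]
      rfl
    have hdiff : g e ^ (α - 1 / 2) ≠ g e₁ ^ (α - 1 / 2) := fun heq =>
      he (Real.rpow_left_injOn (sub_ne_zero.2 hα) (h.pos e).le (h.pos e₁).le heq)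
    rw [← hw, ← hw] at hdiff
    rcases hdiff.lt_or_gt with hlt | hlt
    · exact not_isExtremalPair_of_lt hG hlt hext
    · exact not_isExtremalPair_of_lt hG hlt hext

end

theorem IsMaximiser.isExtremalPair {E : Type*} {Φ : (E → ℝ) → (E → ℝ → ℝ) → ℝ} {g : E → ℝ}
    {ρ : E → ℝ → ℝ} (h : IsMaximiser Φ g ρ) : IsExtremalPair Φ g ρ := by
  refine ⟨h.1, fun δ gt ρt hfam => Or.inl ⟨fun _ => 0, isLittleO_zero _ _, ?_⟩⟩
  filter_upwards [Ioo_mem_nhds (neg_lt_zero.2 hfam.pos) hfam.pos] with t ht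
  rw [add_zero]
  exact h.2 _ _ (hfam.mem t ht)

theorem IsMinimiser.isExtremalPair {E : Type*} {Φ : (E → ℝ) → (E → ℝ → ℝ) → ℝ} {g : E → ℝ}
    {ρ : E → ℝ → ℝ} (h : IsMinimiser Φ g ρ) : IsExtremalPair Φ g ρ := by
  refine ⟨h.1, fun δ gt ρt hfam => Or.inr ⟨fun _ => 0, isLittleO_zero _ _, ?_⟩⟩
  filter_upwards [Ioo_mem_nhds (neg_lt_zero.2 hfam.pos) hfam.pos] with t ht
  rw [add_zero]
  exact h.2 _ _ (hfam.mem t ht)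

end QuantumGraph

/-- A flower graph with at least two loops: the naturally normalised first eigenvalue has no
maximiser; for `α ∉ {1/2, 1}` the `α`-normalised first eigenvalue has no extremal pair, hence no
maximiser and no minimiser; and for no regular metric there is an isometric minimal immersion into
a sphere by first eigenfunctions (with density `1`). -/
theorem mainTheorem11 {V E : Type*} [Fintype E] (G : QuantumGraph.Multigraph V E)
    (hG : G.IsFlower) (hE : 2 ≤ Fintype.card E) :
    (¬ ∃ (g : E → ℝ) (ρ : E → ℝ → ℝ),
      QuantumGraph.IsMaximiser (QuantumGraph.naturalEigenvalue G 1) g ρ) ∧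
    (∀ α : ℝ, α ≠ 1 / 2 → α ≠ 1 →
      (¬ ∃ (g : E → ℝ) (ρ : E → ℝ → ℝ),
        QuantumGraph.IsExtremalPair (QuantumGraph.alphaEigenvalue G α 1) g ρ) ∧
      (¬ ∃ (g : E → ℝ) (ρ : E → ℝ → ℝ),
        QuantumGraph.IsMaximiser (QuantumGraph.alphaEigenvalue G α 1) g ρ) ∧
      (¬ ∃ (g : E → ℝ) (ρ : E → ℝ → ℝ),
        QuantumGraph.IsMinimiser (QuantumGraph.alphaEigenvalue G α 1) g ρ)) ∧
    (∀ g : E → ℝ, QuantumGraph.IsRegularMetric g →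
      ¬ ∃ (n : ℕ) (R : ℝ) (F : E → ℝ → EuclideanSpace ℝ (Fin n)),
        0 < R ∧ QuantumGraph.IsIsometricMinimalImmersion G g n R F ∧
        ∀ i : Fin n, QuantumGraph.MemEigenspace G g (fun _ _ => 1)
          (QuantumGraph.eigenvalue G 1 g (fun _ _ => 1)) (fun e x => F e x i)) := by
  have : Nonempty E := Fintype.card_pos_iff.1 (by omega)
  refine ⟨?_, fun α hα _ => ⟨?_, ?_, ?_⟩, ?_⟩
  · rintro ⟨g, ρ, h⟩
    exact QuantumGraph.not_isMaximiser_natural hG g ρ h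
  · rintro ⟨g, ρ, h⟩
    exact QuantumGraph.not_isExtremalPair hG hE hα h
  · rintro ⟨g, ρ, h⟩
    exact QuantumGraph.not_isExtremalPair hG hE hα h.isExtremalPair
  · rintro ⟨g, ρ, h⟩
    exact QuantumGraph.not_isExtremalPair hG hE hα h.isExtremalPair
  · rintro g hg ⟨n, R, F, hR, hF, hmem⟩
    exact QuantumGraph.not_isometricMinimalImmersion hG hE hg hR hF hmem
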